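/- All graphs are finite and simple. A $k$-bend apRAC (axis-parallel right-angle-crossing) drawing of a graph places the vertices at distinct points of the integer grid $\mathbb{Z}^2$ and draws every edge as a simple polyline between its two end vertices with at most $k$ bends, all of them grid points, such that no edge contains a vertex other than its ends, and such that every point common to two different edges is either a common end vertex of both or a crossing, i.e. a point interior to a segment of each of the two edges, one of these two segments being horizontal and the other one vertical. (In particular, edges do not overlap and no bend lies on another edge; two edges may cross several times, and adjacent edges may cross.) The area of a drawing is that of its smallest axis-parallel bounding box, with sides measured by the number of grid lines that meet them. Theorem. Every graph $G$ with $n \ge 1$ vertices and maximum degree at most $8$ admits a $2$-bend apRAC drawing of area $O(n^2)$. Moreover, such a drawing can be computed in $O(n)$ time: there are an absolute constant $c$ and a program for a random access machine with words of $O(\log n)$ bits (unit-cost addition, truncated subtraction, indirect addressing and tests) that, given $n$, the number of edges of $G$ and any list of the edges of $G$, halts after at most $c\,n$ steps, with no word or address written exceeding $c\,n$, and outputs the coordinates of all vertices and all bends of a $2$-bend apRAC drawing of $G$ with area at most $c\,n^2$. -/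

import Mathlib

/-! ### Polyline drawings on the integer grid -/

/-- A grid point, seen as a point of the plane. -/
def toPlane (p : ℤ × ℤ) : ℝ × ℝ := ((p.1 : ℝ), (p.2 : ℝ))

/-- The data of a polyline drawing of `G` whose vertices and bends are grid points: a point for
every vertex and, for every edge in each of its two directions, the list of its bends in the order
in which they are met. -/
structure PolylineDrawing {V : Type*} (G : SimpleGraph V) where
  pos : V → ℤ × ℤ
  bends : G.Dart → List (ℤ × ℤ)
  bends_symm : ∀ d : G.Dart, bends d.symm = (bends d).reverse

namespace PolylineDrawing

variable {V : Type*} {G : SimpleGraph V} (D : PolylineDrawing G)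

/-- The number of segments of the polyline of an edge. -/
def numSegs (d : G.Dart) : ℕ := (D.bends d).length + 1

/-- The corner number `i` (for `i ≤ numSegs d`) of the polyline of `d`: first the start vertex, then
the bends, then the end vertex. -/
def corner (d : G.Dart) (i : ℕ) : ℤ × ℤ :=
  (D.pos d.fst :: (D.bends d ++ [D.pos d.snd])).getD i (0, 0)

/-- The segment number `i` (for `i < numSegs d`), with its two ends. -/
def seg (d : G.Dart) (i : ℕ) : Set (ℝ × ℝ) :=
  segment ℝ (toPlane (D.corner d i)) (toPlane (D.corner d (i + 1)))

/-- The segment number `i` without its two ends. -/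
def openSeg (d : G.Dart) (i : ℕ) : Set (ℝ × ℝ) :=
  openSegment ℝ (toPlane (D.corner d i)) (toPlane (D.corner d (i + 1)))

/-- The segment number `i` is parallel to the `x`-axis. -/
def IsHorizontal (d : G.Dart) (i : ℕ) : Prop :=
  (D.corner d i).2 = (D.corner d (i + 1)).2

/-- The segment number `i` is parallel to the `y`-axis. -/
def IsVertical (d : G.Dart) (i : ℕ) : Prop :=
  (D.corner d i).1 = (D.corner d (i + 1)).1

/-- `D` is a (valid) `k`-bend axis-parallel right-angle-crossing drawing. -/
structure IsApRAC (k : ℕ) : Prop where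
  /-- Distinct vertices are distinct points. -/
  pos_injective : Function.Injective D.pos
  /-- Every edge has at most `k` bends. -/
  bends_le : ∀ d : G.Dart, (D.bends d).length ≤ k
  /-- No segment is degenerate. -/
  corner_ne : ∀ (d : G.Dart) (i : ℕ), i < D.numSegs d → D.corner d i ≠ D.corner d (i + 1)
  /-- Every edge is a simple curve: two of its segments meet only if they are consecutive, and then
  only at their common end. -/
  simple : ∀ (d : G.Dart) (i j : ℕ), i < j → j < D.numSegs d →
    ∀ p, p ∈ D.seg d i → p ∈ D.seg d j → j = i + 1 ∧ p = toPlane (D.corner d j)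
  /-- An edge contains no vertex other than its ends. -/
  vertex : ∀ (d : G.Dart) (i : ℕ), i < D.numSegs d →
    ∀ w : V, toPlane (D.pos w) ∈ D.seg d i → w = d.fst ∨ w = d.snd
  /-- A point common to two different edges is a common end vertex of theirs, or it is a crossing:
  it lies in the interior of a segment of either edge, and one of these two segments is horizontal
  and the other one vertical. In particular, two edges never overlap, and no bend of an edge lies
  on another edge. -/
  crossing : ∀ d d' : G.Dart, d.edge ≠ d'.edge →
    ∀ i j : ℕ, i < D.numSegs d → j < D.numSegs d' →
    ∀ p, p ∈ D.seg d i → p ∈ D.seg d' j →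
      (∃ w : V, w ∈ d.edge ∧ w ∈ d'.edge ∧ p = toPlane (D.pos w)) ∨
      (p ∈ D.openSeg d i ∧ p ∈ D.openSeg d' j ∧
        ((D.IsHorizontal d i ∧ D.IsVertical d' j) ∨ (D.IsVertical d i ∧ D.IsHorizontal d' j)))

/-- The grid points that are vertices or bends of the drawing. -/
def points : Set (ℤ × ℤ) := Set.range D.pos ∪ {p | ∃ d : G.Dart, p ∈ D.bends d}

/-- The number of vertical grid lines that meet the smallest bounding box of the drawing (of a
finite graph with at least one vertex). -/
noncomputable def width : ℤ := sSup (Prod.fst '' D.points) - sInf (Prod.fst '' D.points) + 1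

/-- The number of horizontal grid lines that meet the smallest bounding box. -/
noncomputable def height : ℤ := sSup (Prod.snd '' D.points) - sInf (Prod.snd '' D.points) + 1

/-- The area of the smallest bounding box. As the sides are counted in grid lines, this is at least
the Euclidean area of the box, and it does not vanish for drawings on a line. -/
noncomputable def area : ℤ := D.width * D.height

end PolylineDrawing

/-! ### A random access machine, as a structured language with a step count -/

/-- The memory of the machine: registers, and arrays of words. A program names its registers and
arrays by literals, so it uses finitely many of them. -/
structure RamState where
  reg : ℕ → ℕ
  arr : ℕ → ℕ → ℕ

/-- Expressions: literals, registers, array accesses, addition and truncated subtraction. -/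
inductive RamExpr : Type
  | lit (k : ℕ)
  | reg (x : ℕ)
  | get (a : ℕ) (i : RamExpr)
  | add (e f : RamExpr)
  | sub (e f : RamExpr)

namespace RamExpr

def eval (σ : RamState) : RamExpr → ℕ
  | lit k => k
  | reg x => σ.reg x
  | get a i => σ.arr a (i.eval σ)
  | add e f => e.eval σ + f.eval σ
  | sub e f => e.eval σ - f.eval σ

/-- The number of steps for the evaluation: one for each operation, register and literal. -/
def cost : RamExpr → ℕ
  | lit _ => 1
  | reg _ => 1
  | get _ i => i.cost + 1
  | add e f => e.cost + f.cost + 1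
  | sub e f => e.cost + f.cost + 1

end RamExpr

/-- Programs. The test of a branch or a loop succeeds if its value is not zero. -/
inductive RamProgram : Type
  | skip
  | assign (x : ℕ) (e : RamExpr)
  | store (a : ℕ) (i e : RamExpr)
  | seq (p q : RamProgram)
  | branch (c : RamExpr) (p q : RamProgram)
  | loop (c : RamExpr) (p : RamProgram)

namespace RamState

def setReg (σ : RamState) (x v : ℕ) : RamState :=
  { σ with reg := Function.update σ.reg x v }

def setArr (σ : RamState) (a i v : ℕ) : RamState :=
  { σ with arr := Function.update σ.arr a (Function.update (σ.arr a) i v) }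

end RamState

/-- `RamExec W p σ t τ`: started in the state `σ`, the program `p` halts after exactly `t` steps in
the state `τ`, and every word and every address that it writes is at most `W` (the values that occur
during the evaluation of an expression are then sums of a fixed number of words and literals).
Each command and each test costs one step more than the evaluation of its expressions. -/
inductive RamExec (W : ℕ) : RamProgram → RamState → ℕ → RamState → Prop
  | skip (σ : RamState) : RamExec W .skip σ 1 σ
  | assign (x : ℕ) (e : RamExpr) (σ : RamState) :
      e.eval σ ≤ W → RamExec W (.assign x e) σ (e.cost + 1) (σ.setReg x (e.eval σ))
  | store (a : ℕ) (i e : RamExpr) (σ : RamState) :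
      i.eval σ ≤ W → e.eval σ ≤ W →
      RamExec W (.store a i e) σ (i.cost + e.cost + 1) (σ.setArr a (i.eval σ) (e.eval σ))
  | seq (p q : RamProgram) (σ τ υ : RamState) (s t : ℕ) :
      RamExec W p σ s τ → RamExec W q τ t υ → RamExec W (.seq p q) σ (s + t) υ
  | branch_true (c : RamExpr) (p q : RamProgram) (σ τ : RamState) (t : ℕ) :
      c.eval σ ≠ 0 → RamExec W p σ t τ → RamExec W (.branch c p q) σ (c.cost + 1 + t) τ
  | branch_false (c : RamExpr) (p q : RamProgram) (σ τ : RamState) (t : ℕ) :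
      c.eval σ = 0 → RamExec W q σ t τ → RamExec W (.branch c p q) σ (c.cost + 1 + t) τ
  | loop_true (c : RamExpr) (p : RamProgram) (σ τ υ : RamState) (s t : ℕ) :
      c.eval σ ≠ 0 → RamExec W p σ s τ → RamExec W (.loop c p) τ t υ →
      RamExec W (.loop c p) σ (c.cost + 1 + s + t) υ
  | loop_false (c : RamExpr) (p : RamProgram) (σ : RamState) :
      c.eval σ = 0 → RamExec W (.loop c p) σ (c.cost + 1) σ

/-! ### Input and output of a drawing algorithm -/

/-- A list of the edges of `G`, each one exactly once, in an arbitrary order and in an arbitrary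
direction. -/
structure EdgeList {V : Type*} (G : SimpleGraph V) (m : ℕ) where
  dart : Fin m → G.Dart
  existsUnique_edge : ∀ d : G.Dart, ∃! i : Fin m, (dart i).edge = d.edge

/-- The initial state: registers `0` and `1` hold the numbers of vertices and of edges, the
arrays `0` and `1` hold the ends of the edges, and the rest of the memory is zero. -/
def EdgeList.initialState {n m : ℕ} {G : SimpleGraph (Fin n)} (E : EdgeList G m) : RamState where
  reg x := if x = 0 then n else if x = 1 then m else 0
  arr a i :=
    if h : i < m then
      if a = 0 then ((E.dart ⟨i, h⟩).fst : ℕ)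
      else if a = 1 then ((E.dart ⟨i, h⟩).snd : ℕ)
      else 0
    else 0

/-- The drawing `D` is stored in the state `τ`: the coordinates of the vertices in the arrays `2`
and `3`, the number of bends of each edge of the list in the array `4`, and the coordinates of its
bend number `j` (counted from `0`) in the arrays `5 + 2 * j` and `6 + 2 * j`. -/
def EdgeList.Outputs {n m : ℕ} {G : SimpleGraph (Fin n)} (E : EdgeList G m) (τ : RamState)
    (D : PolylineDrawing G) : Prop :=
  (∀ v : Fin n, D.pos v = ((τ.arr 2 v : ℤ), (τ.arr 3 v : ℤ))) ∧
  (∀ i : Fin m, D.bends (E.dart i) = (List.range (τ.arr 4 i)).map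
    (fun j => ((τ.arr (5 + 2 * j) i : ℤ), (τ.arr (6 + 2 * j) i : ℤ))))

/-! The graph is completed by further half-edges to a multigraph, possibly with loops, in which all
degrees are 8. Its edges can be directed so that all in- and out-degrees are 4, and then divided
into four classes, each of which is the graph of a permutation of the vertices (Petersen). One tool
does this three times. Suppose that a set carries two keys, every value of which is taken an even
number of times. Pair the elements with equal first key, and pair those with equal second key; the
union of the two matchings consists of even cycles, and its proper colouring with two colours halves
every fibre of both keys (`Swaps.count`, `ensures_split`). The keys are the edge and the vertex of a
half-edge, then the tail and the head of an edge, then tail and head combined with the colour just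
found.

Two permutations form the family of the column edges, the other two that of the row edges;
exchanging the axes exchanges the families. The first family determines the order of the vertices in
`x`, the second one that in `y`. A column edge has a vertical middle segment in a column of its own.
At an end `u` it either uses a port, that is, a horizontal segment at the height of `u`, or a
segment that is slanted by one unit towards the other end; then the column is within distance 5 of
`u`, where vertices are 10 apart. Slanted segments are crossed by nothing, and all other segments
are parallel to the axes. What remains to be ensured (`IsColumns`) is that an edge uses at most one
port and that two edges with ports at the same vertex leave it on opposite sides.

Let `π` (path class) and `ρ` (port class) be the permutations of a family. The vertices of each
cycle of `π` are consecutive in the order. So an edge of `π` runs between neighbours and needs no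
port, except for one closing edge of each cycle, which gets a column near its other end and a port
at the root of the cycle. An edge of `ρ` normally has its port at the tail and its column near the
head. Hence a root `v` may have two ports in use, and the freedom to put `v` first or last in its
cycle is used to send the closing edge to the side away from `ρ v`. If `ρ v` lies in the cycle of
`v`, this is impossible. Then the edge from `v` to `ρ v` is flipped: its column is near `v`, and its
port at `ρ v`, where it competes with the edge to `ρ (ρ v)`; now the place of `v` is chosen on the
side of `ρ v` away from `ρ (ρ v)`. This choice is `IsLast`, and `IsTwoClass.opposite` shows that it
works.

For the running time, every traversal is a loop whose number of iterations is known beforehand,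
because each iteration increases the same potential by a fixed amount (the clauses `count` and `sum`
of the invariants). -/

/-! ### Verification of programs -/

namespace RamProgram

/-- `Ensures W p σ B Q`: started in `σ`, the program `p` halts after at most `B` steps in a state
that satisfies `Q`, and writes only words and addresses up to `W`. -/
def Ensures (W : ℕ) (p : RamProgram) (σ : RamState) (B : ℕ) (Q : RamState → Prop) : Prop :=
  ∃ t τ, RamExec W p σ t τ ∧ t ≤ B ∧ Q τ

/-- May the register `x` be written by the program? -/
def writesReg : RamProgram → ℕ → Bool
  | skip, _ => false
  | assign y _, x => decide (x = y)
  | store _ _ _, _ => false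
  | seq p q, x => p.writesReg x || q.writesReg x
  | branch _ p q, x => p.writesReg x || q.writesReg x
  | loop _ p, x => p.writesReg x

/-- May the array `a` be written by the program? -/
def writesArr : RamProgram → ℕ → Bool
  | skip, _ => false
  | assign _ _, _ => false
  | store b _ _, a => decide (a = b)
  | seq p q, a => p.writesArr a || q.writesArr a
  | branch _ p q, a => p.writesArr a || q.writesArr a
  | loop _ p, a => p.writesArr a

/-- The states `σ` and `τ` agree on everything that `p` cannot write. -/
structure Frame (p : RamProgram) (σ τ : RamState) : Prop where
  arr : ∀ a, p.writesArr a = false → τ.arr a = σ.arr a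
  reg : ∀ x, p.writesReg x = false → τ.reg x = σ.reg x

theorem Frame.refl (p : RamProgram) (σ : RamState) : Frame p σ σ :=
  ⟨fun _ _ => rfl, fun _ _ => rfl⟩

theorem Frame.trans {p : RamProgram} {σ τ υ : RamState} (h : Frame p σ τ) (h' : Frame p τ υ) :
    Frame p σ υ :=
  ⟨fun a ha => (h'.arr a ha).trans (h.arr a ha), fun x hx => (h'.reg x hx).trans (h.reg x hx)⟩

/-- Whether a register or array may be written is read off the program text, so the preservation of
data by a concrete program becomes a computation. -/
theorem Frame.of_exec {W : ℕ} {p : RamProgram} {σ τ : RamState} {t : ℕ} (h : RamExec W p σ t τ) :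
    Frame p σ τ := by
  induction h with
  | skip σ => exact .refl _ _
  | assign x e σ _ =>
    refine ⟨fun _ _ => rfl, fun y hy => ?_⟩
    have : y ≠ x := by simpa [writesReg] using hy
    simp [RamState.setReg, this]
  | store a i e σ _ _ =>
    refine ⟨fun b hb => ?_, fun _ _ => rfl⟩
    have : b ≠ a := by simpa [writesArr] using hb
    simp [RamState.setArr, this]
  | seq p q σ τ υ s t _ _ ih₁ ih₂ =>
    refine ⟨fun a ha => ?_, fun x hx => ?_⟩
    · simp only [writesArr, Bool.or_eq_false_iff] at ha
      rw [ih₂.arr a ha.2, ih₁.arr a ha.1]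
    · simp only [writesReg, Bool.or_eq_false_iff] at hx
      rw [ih₂.reg x hx.2, ih₁.reg x hx.1]
  | branch_true c p q σ τ t _ _ ih =>
    refine ⟨fun a ha => ?_, fun x hx => ?_⟩
    · simp only [writesArr, Bool.or_eq_false_iff] at ha
      exact ih.arr a ha.1
    · simp only [writesReg, Bool.or_eq_false_iff] at hx
      exact ih.reg x hx.1
  | branch_false c p q σ τ t _ _ ih =>
    refine ⟨fun a ha => ?_, fun x hx => ?_⟩
    · simp only [writesArr, Bool.or_eq_false_iff] at ha
      exact ih.arr a ha.2
    · simp only [writesReg, Bool.or_eq_false_iff] at hx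
      exact ih.reg x hx.2
  | loop_true c p σ τ υ s t _ _ _ ih₁ ih₂ =>
    exact ⟨fun a ha => (ih₂.arr a ha).trans (ih₁.arr a ha),
      fun x hx => (ih₂.reg x hx).trans (ih₁.reg x hx)⟩
  | loop_false c p σ _ => exact .refl _ _

theorem Ensures.mono {W : ℕ} {p : RamProgram} {σ : RamState} {B B' : ℕ} {Q Q' : RamState → Prop}
    (h : Ensures W p σ B Q) (hB : B ≤ B') (hQ : ∀ τ, Frame p σ τ → Q τ → Q' τ) :
    Ensures W p σ B' Q' := by
  obtain ⟨t, τ, h₁, h₂, h₃⟩ := h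
  exact ⟨t, τ, h₁, h₂.trans hB, hQ τ (.of_exec h₁) h₃⟩

theorem Ensures.seq {W : ℕ} {p q : RamProgram} {σ : RamState} {B C : ℕ} {Q R : RamState → Prop}
    (h : Ensures W p σ B R) (h' : ∀ τ, Frame p σ τ → R τ → Ensures W q τ C Q) :
    Ensures W (.seq p q) σ (B + C) Q := by
  obtain ⟨s, τ, h₁, h₂, h₃⟩ := h
  obtain ⟨t, υ, h₄, h₅, h₆⟩ := h' τ (.of_exec h₁) h₃
  exact ⟨s + t, υ, .seq _ _ _ _ _ _ _ h₁ h₄, by omega, h₆⟩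

/-- A bound for the number of steps of a program without loops. -/
def stepBound : RamProgram → ℕ
  | skip => 1
  | assign _ e => e.cost + 1
  | store _ i e => i.cost + e.cost + 1
  | seq p q => p.stepBound + q.stepBound
  | branch c p q => c.cost + 1 + max p.stepBound q.stepBound
  | loop _ _ => 0

/-- The weakest precondition of a program without loops. -/
def Wp (W : ℕ) : RamProgram → (RamState → Prop) → RamState → Prop
  | skip, Q, σ => Q σ
  | assign x e, Q, σ => e.eval σ ≤ W ∧ Q (σ.setReg x (e.eval σ))
  | store a i e, Q, σ => i.eval σ ≤ W ∧ e.eval σ ≤ W ∧ Q (σ.setArr a (i.eval σ) (e.eval σ))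
  | seq p q, Q, σ => Wp W p (Wp W q Q) σ
  | branch c p q, Q, σ => (c.eval σ ≠ 0 → Wp W p Q σ) ∧ (c.eval σ = 0 → Wp W q Q σ)
  | loop _ _, _, _ => False

/-- Loops need no bound in `stepBound`, as their precondition `Wp` is false. -/
theorem Ensures.of_wp {W : ℕ} {p : RamProgram} {σ : RamState} {Q : RamState → Prop}
    (h : Wp W p Q σ) : Ensures W p σ p.stepBound Q := by
  induction p generalizing σ Q with
  | skip => exact ⟨_, _, .skip _, le_rfl, h⟩
  | assign x e => exact ⟨_, _, .assign _ _ _ h.1, le_rfl, h.2⟩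
  | store a i e => exact ⟨_, _, .store _ _ _ _ h.1 h.2.1, le_rfl, h.2.2⟩
  | seq p q ihp ihq =>
    exact Ensures.seq (ihp (Q := Wp W q Q) h) fun τ _ hτ => ihq hτ
  | branch c p q ihp ihq =>
    by_cases hc : c.eval σ = 0
    · obtain ⟨t, τ, h₁, h₂, h₃⟩ := ihq (h.2 hc)
      exact ⟨_, τ, .branch_false _ _ _ _ _ _ hc h₁, by simp only [stepBound]; omega, h₃⟩
    · obtain ⟨t, τ, h₁, h₂, h₃⟩ := ihp (h.1 hc)
      exact ⟨_, τ, .branch_true _ _ _ _ _ _ hc h₁, by simp only [stepBound]; omega, h₃⟩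
  | loop c p => exact h.elim

/-- Run `p` with the register `x` counting from zero up to the value of the register `N`. -/
def forLoop (x N : ℕ) (p : RamProgram) : RamProgram :=
  .seq (.assign x (.lit 0))
    (.loop (.sub (.reg N) (.reg x)) (.seq p (.assign x (.add (.reg x) (.lit 1)))))

/-- The limit is never written and the body does not touch the counter, so there are exactly `M`
iterations. Each one costs the body, 4 steps for the test and 4 for the increment; the 6 steps left
over are the initial assignment and the final failing test. -/
theorem Ensures.forLoop {W x N M : ℕ} {p : RamProgram} {σ : RamState}
    (Inv : ℕ → RamState → Prop) (hM : σ.reg N = M) (hW : M ≤ W)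
    (hN : (forLoop x N p).writesReg N = false) (hx : p.writesReg x = false)
    (h0 : Inv 0 (σ.setReg x 0))
    (hstep : ∀ k < M, ∀ τ, τ.reg x = k → Frame (RamProgram.forLoop x N p) σ τ → Inv k τ →
      Wp W p (fun υ => Inv (k + 1) (υ.setReg x (k + 1))) τ) :
    Ensures W (RamProgram.forLoop x N p) σ (M * (p.stepBound + 8) + 6) (Inv M) := by
  -- Induction on the number `j` of iterations still to come, as a loop is unfolded at its front.
  have key : ∀ j k τ, j + k = M → τ.reg x = k → Frame (RamProgram.forLoop x N p) σ τ → Inv k τ →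
      Ensures W (.loop (.sub (.reg N) (.reg x)) (.seq p (.assign x (.add (.reg x) (.lit 1))))) τ
        (j * (p.stepBound + 8) + 4) (Inv M) := by
    intro j
    induction j with
    | zero =>
      intro k τ hjk hk hF hI
      refine ⟨_, τ, .loop_false _ _ _ ?_, ?_, ?_⟩
      · simp only [RamExpr.eval]
        rw [hF.reg N hN, hM, hk]; omega
      · simp [RamExpr.cost]
      · have : k = M := by omega
        exact this ▸ hI
    | succ j ih =>
      intro k τ hjk hk hF hI
      obtain ⟨s, υ, h₁, h₂, h₃⟩ := Ensures.of_wp (hstep k (by omega) τ hk hF hI)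
      have hυ : υ.reg x = k := by rw [(Frame.of_exec h₁).reg x hx, hk]
      have hex : RamExec W (.seq p (.assign x (.add (.reg x) (.lit 1)))) τ (s + 4)
          (υ.setReg x (k + 1)) := by
        refine .seq _ _ _ _ _ _ _ h₁ ?_
        have h := RamExec.assign (W := W) x (.add (.reg x) (.lit 1)) υ
          (by simp only [RamExpr.eval, hυ]; omega)
        simpa only [RamExpr.eval, hυ, RamExpr.cost] using h
      obtain ⟨t, ω, h₄, h₅, h₆⟩ := ih (k + 1) (υ.setReg x (k + 1)) (by omega)
        (by simp [RamState.setReg])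
        (hF.trans ⟨fun a ha => (Frame.of_exec hex).arr a
            (by simpa [RamProgram.forLoop, writesArr] using ha),
          fun y hy => (Frame.of_exec hex).reg y
            (by simp [RamProgram.forLoop, writesReg] at hy ⊢; exact hy.2)⟩) h₃
      refine ⟨_, ω, .loop_true _ _ _ _ _ _ _ ?_ hex h₄, ?_, h₆⟩
      · simp only [RamExpr.eval]
        rw [hF.reg N hN, hM, hk]; omega
      · simp only [RamExpr.cost]
        rw [Nat.succ_mul]; omega
  have hinit : RamExec W (.assign x (.lit 0)) σ 2 (σ.setReg x 0) :=
    .assign x (.lit 0) σ (Nat.zero_le _)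
  obtain ⟨t, τ, h₁, h₂, h₃⟩ := key M 0 (σ.setReg x 0) (by simp) (by simp [RamState.setReg])
    ⟨fun _ _ => rfl, fun y hy => (Frame.of_exec hinit).reg y (by
      simp only [RamProgram.forLoop, writesReg, Bool.or_eq_false_iff] at hy ⊢; exact hy.1)⟩ h0
  exact ⟨_, τ, .seq _ _ _ _ _ _ _ hinit h₁, by omega, h₃⟩

end RamProgram

/-! ### Pairing elements with equal keys -/

/-- `α` is a fixed-point-free involution of the numbers below `M` that preserves the key `k`. -/
structure IsMating (M : ℕ) (k α : ℕ → ℕ) : Prop where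
  lt : ∀ j < M, α j < M
  ne : ∀ j < M, α j ≠ j
  invol : ∀ j < M, α (α j) = j
  key : ∀ j < M, k (α j) = k j

/-- The state of the greedy pairing after `i` elements: `l κ` is the successor of the unpaired
element with the key `κ`, if there is one, and zero otherwise. -/
structure PairInv (k : ℕ → ℕ) (i : ℕ) (l α : ℕ → ℕ) : Prop where
  last : ∀ κ, l κ = 0 ∨ (l κ - 1 < i ∧ k (l κ - 1) = κ)
  mate : ∀ j < i, l (k j) = j + 1 ∨ (α j < i ∧ α j ≠ j ∧ α (α j) = j ∧ k (α j) = k j ∧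
    l (k j) ≠ α j + 1)
  even : ∀ κ, Even (Nat.count (fun j => k j = κ) i) ↔ l κ = 0

theorem PairInv.init (k α : ℕ → ℕ) : PairInv k 0 (fun _ => 0) α :=
  ⟨fun _ => .inl rfl, fun _ h => by omega, fun κ => by simp⟩

/-- Nobody with the key of `i` is waiting, so `i` starts to wait. Storing the successor keeps zero
free for an empty place. -/
theorem PairInv.open {k l α : ℕ → ℕ} {i : ℕ} (h : PairInv k i l α) (hi : l (k i) = 0) :
    PairInv k (i + 1) (Function.update l (k i) (i + 1)) α := by
  refine ⟨fun κ => ?_, fun j hj => ?_, fun κ => ?_⟩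
  · by_cases hκ : κ = k i
    · subst hκ; right; simp
    · rw [Function.update_of_ne hκ]
      rcases h.last κ with h | h
      · exact .inl h
      · exact .inr ⟨by omega, h.2⟩
  · rcases Nat.lt_succ_iff_lt_or_eq.1 hj with hj | rfl
    · rcases h.mate j hj with h' | ⟨h₁, h₂, h₃, h₄, h₅⟩
      · have : k j ≠ k i := fun he => by rw [he, hi] at h'; omega
        left; rw [Function.update_of_ne this]; exact h'
      · right
        refine ⟨by omega, h₂, h₃, h₄, ?_⟩
        by_cases he : k j = k i
        · rw [he, Function.update_self]; omega
        · rw [Function.update_of_ne he]; exact h₅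
    · left; simp
  · rw [Nat.count_succ]
    have := h.even κ
    by_cases hκ : k i = κ
    · subst hκ
      simp only [if_true, Function.update_self]
      rw [hi] at this
      rw [Nat.even_add_one]; simp_all
    · rw [Function.update_of_ne (Ne.symm hκ), if_neg hκ]; exact this

/-- The waiting element with the key of `i` and `i` itself become mates, and the place of their key
is empty again. -/
theorem PairInv.close {k l α : ℕ → ℕ} {i : ℕ} (h : PairInv k i l α) (hi : l (k i) ≠ 0) :
    PairInv k (i + 1) (Function.update l (k i) 0)
      (Function.update (Function.update α i (l (k i) - 1)) (l (k i) - 1) i) := by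
  obtain ⟨p, hp⟩ : ∃ p, l (k i) = p + 1 := ⟨l (k i) - 1, by omega⟩
  have hlast := h.last (k i)
  rw [hp] at hlast ⊢
  simp only [Nat.add_sub_cancel] at hlast ⊢
  have hpi : p < i := by rcases hlast with h | h <;> omega
  have hkp : k p = k i := by rcases hlast with h | h; · omega
                             exact h.2
  refine ⟨fun κ => ?_, fun j hj => ?_, fun κ => ?_⟩
  · by_cases hκ : κ = k i
    · subst hκ; left; simp
    · rw [Function.update_of_ne hκ]
      rcases h.last κ with h | h
      · exact .inl h
      · exact .inr ⟨by omega, h.2⟩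
  · by_cases hjp : j = p
    · right
      subst hjp
      rw [Function.update_self, Function.update_of_ne (by omega : i ≠ j), Function.update_self, hkp,
        Function.update_self]
      exact ⟨by omega, by omega, rfl, rfl, by omega⟩
    by_cases hji : j = i
    · right
      subst hji
      rw [Function.update_of_ne hjp, Function.update_self, Function.update_self,
        Function.update_self]
      exact ⟨by omega, by omega, rfl, hkp, by omega⟩
    rw [Function.update_of_ne hjp, Function.update_of_ne hji]
    rcases h.mate j (by omega) with h' | ⟨h₁, h₂, h₃, h₄, h₅⟩
    · have he : k j ≠ k i := fun he => by rw [he, hp] at h'; omega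
      left; rw [Function.update_of_ne he]; exact h'
    · right
      -- An older pair contains no waiting element, by the last clause of `mate`; so the updates of
      -- `α` do not touch it.
      have h6 : α j ≠ p := fun he => by
        rw [he] at h₄ h₅
        rw [← h₄, hkp, hp] at h₅; omega
      rw [Function.update_of_ne h6, Function.update_of_ne (by omega : α j ≠ i)]
      refine ⟨by omega, h₂, h₃, h₄, ?_⟩
      by_cases he : k j = k i
      · rw [he, Function.update_self]; omega
      · rw [Function.update_of_ne he]; exact h₅
  · rw [Nat.count_succ]
    have := h.even κ
    by_cases hκ : k i = κ
    · subst hκ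
      simp only [if_true, Function.update_self]
      rw [Nat.even_add_one]; simp_all
    · rw [Function.update_of_ne (Ne.symm hκ), if_neg hκ]; exact this

/-- By the parity clause, an even fibre leaves nobody waiting. -/
theorem PairInv.isMating {k l α : ℕ → ℕ} {M : ℕ} (h : PairInv k M l α)
    (he : ∀ j < M, Even (Nat.count (fun i => k i = k j) M)) : IsMating M k α := by
  have key : ∀ j < M, α j < M ∧ α j ≠ j ∧ α (α j) = j ∧ k (α j) = k j := fun j hj => by
    have h0 := (h.even (k j)).1 (he j hj)
    rcases h.mate j hj with h' | ⟨h₁, h₂, h₃, h₄, _⟩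
    · omega
    · exact ⟨h₁, h₂, h₃, h₄⟩
  exact ⟨fun j hj => (key j hj).1, fun j hj => (key j hj).2.1, fun j hj => (key j hj).2.2.1,
    fun j hj => (key j hj).2.2.2⟩

/-! ### Colouring the union of two perfect matchings -/

/-- The number of indices below `M` at which `f` does not vanish. -/
def numSet (M : ℕ) (f : ℕ → ℕ) : ℕ := Nat.count (fun j => f j ≠ 0) M

theorem numSet_le (M : ℕ) (f : ℕ → ℕ) : numSet M f ≤ M := Nat.count_le _

theorem numSet_eq {M : ℕ} {f : ℕ → ℕ} (h : ∀ j < M, f j ≠ 0) : numSet M f = M := by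
  unfold numSet
  rw [Nat.count_iff_forall]
  exact fun j hj => h j hj

theorem numSet_update {M : ℕ} {f : ℕ → ℕ} {i c : ℕ} (hi : i < M) (h : f i = 0) (hc : c ≠ 0) :
    numSet M (Function.update f i c) = numSet M f + 1 := by
  unfold numSet
  rw [Nat.count_eq_card_filter_range, Nat.count_eq_card_filter_range]
  have : (Finset.range M).filter (fun j => Function.update f i c j ≠ 0) =
      insert i ((Finset.range M).filter (fun j => f j ≠ 0)) := by
    ext j
    by_cases hj : j = i
    · subst hj; simp [hi, hc]
    · simp [hj]
  rw [this, Finset.card_insert_of_notMem (by simp [h])]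

/-- Two elements matched by `α` have the two different colours `1` and `2`. -/
def Swaps (M : ℕ) (α col : ℕ → ℕ) : Prop :=
  ∀ j < M, (col j = 1 ∧ col (α j) = 2) ∨ (col j = 2 ∧ col (α j) = 1)

/-- The state of the traversal that colours the union of the matchings `α` and `β`, after `t`
steps: `v` is the start of the current cycle, and `w` the next element to be coloured. -/
structure ColInv (M : ℕ) (α β : ℕ → ℕ) (t v w : ℕ) (col : ℕ → ℕ) : Prop where
  le : v ≤ M
  next : w = v ∨ (w < M ∧ v < M ∧ col v ≠ 0 ∧ col (β w) = 2 ∧ col w = 0)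
  start : w = v → v < M → col v = 1 → col (β v) = 2
  count : 2 * t = 2 * v + numSet M col
  before : ∀ x < v, col x ≠ 0
  mate : ∀ j < M, (col j = 0 ∧ col (α j) = 0) ∨ (col j = 1 ∧ col (α j) = 2) ∨
    (col j = 2 ∧ col (α j) = 1)
  two : ∀ j < M, col j = 2 → col (β j) = 1 ∨ β j = w
  one : ∀ j < M, col j = 1 → col (β j) = 2 ∨ j = v

theorem ColInv.init (M : ℕ) (α β : ℕ → ℕ) : ColInv M α β 0 0 0 (fun _ => 0) := by
  refine ⟨by omega, .inl rfl, by simp, ?_, by simp, by simp, by simp, by simp⟩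
  simp [numSet]

/-- If `v` had reached `M`, all elements would be coloured, and `count` would read `2 * t = 3 * M`,
that is `t = 3 * N`. -/
theorem ColInv.lt {M N : ℕ} {α β : ℕ → ℕ} {t v w : ℕ} {col : ℕ → ℕ}
    (h : ColInv M α β t v w col) (hM : M = 2 * N) (ht : t < 3 * N) : v < M ∧ w < M := by
  have hv : v < M := by
    by_contra hv
    have hv : v = M := by have := h.le; omega
    have := numSet_eq (M := M) (f := col) (by intro j hj; exact h.before j (by omega))
    have := h.count
    omega
  rcases h.next with h | h
  · exact ⟨hv, by omega⟩
  · exact ⟨hv, h.1⟩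

/-- The traversal colours both ends of the `α`-edge at `w` and passes on along the `β`-edge at `α
w`. Only the `β`-edges at the two ends of the path coloured so far can violate the colouring, which
is what the exceptions in `two` and `one` allow. -/
theorem ColInv.visit {M : ℕ} {k k' α β : ℕ → ℕ} {t v w : ℕ} {col : ℕ → ℕ}
    (h : ColInv M α β t v w col) (hα : IsMating M k α) (hβ : IsMating M k' β) (hv : v < M)
    (hw : w < M) (h0 : col w = 0) :
    ColInv M α β (t + 1) v (β (α w))
      (Function.update (Function.update col w 1) (α w) 2) := by
  have ha := hα.ne w hw
  have hal := hα.lt w hw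
  have ha0 : col (α w) = 0 := by rcases h.mate w hw with h | h | h <;> omega
  set col' := Function.update (Function.update col w 1) (α w) 2 with hcol'
  have c1 : col' w = 1 := by rw [hcol', Function.update_of_ne ha.symm, Function.update_self]
  have c2 : col' (α w) = 2 := by rw [hcol', Function.update_self]
  have c3 : ∀ x, col x ≠ 0 → col' x = col x := fun x hx => by
    have h1 : x ≠ w := by rintro rfl; exact hx h0
    have h2 : x ≠ α w := by rintro rfl; exact hx ha0
    rw [hcol', Function.update_of_ne h2, Function.update_of_ne h1]
  have c4 : ∀ x, x ≠ w → x ≠ α w → col' x = col x := fun x h1 h2 => by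
    rw [hcol', Function.update_of_ne h2, Function.update_of_ne h1]
  have hb := hβ.lt _ hal
  have hbb := hβ.invol _ hal
  have hvc : col' v ≠ 0 := by
    rcases h.next with h | h
    · rw [← h, c1]; omega
    · rw [c3 v h.2.2.1]; exact h.2.2.1
  refine ⟨h.le, ?_, ?_, ?_, ?_, ?_, ?_, ?_⟩
  · by_cases hwv : β (α w) = v
    · exact .inl hwv
    right
    refine ⟨hb, hv, hvc, by rw [hbb, c2], ?_⟩
    -- If `β (α w)` were coloured already and different from `v`, then its mate `α w` would be
    -- coloured too, or equal to `w`.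
    by_contra hc
    have hne : β (α w) ≠ α w := hβ.ne _ hal
    have hnw : β (α w) ≠ w := by
      intro he
      rcases h.next with h | h
      · exact hwv (he.trans h)
      · rw [he] at hbb; rw [hbb, ha0] at h; omega
    rw [c4 _ hnw hne] at hc
    have : col (β (α w)) = 1 ∨ col (β (α w)) = 2 := by
      rcases h.mate _ hb with h | h | h <;> omega
    rcases this with h1 | h2
    · rcases h.one _ hb h1 with h3 | h3
      · rw [hbb, ha0] at h3; omega
      · exact hwv h3
    · rcases h.two _ hb h2 with h3 | h3
      · rw [hbb, ha0] at h3; omega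
      · rw [hbb] at h3; exact ha h3
  · intro he _ _
    rw [← he, hbb, c2]
  · have := h.count
    rw [hcol', numSet_update hal (by rw [Function.update_of_ne ha]; exact ha0) (by omega),
      numSet_update hw h0 (by omega)]
    omega
  · intro x hx
    rw [c3 x (h.before x hx)]; exact h.before x hx
  · intro j hj
    by_cases h1 : j = w
    · subst h1; exact .inr (.inl ⟨c1, c2⟩)
    by_cases h2 : j = α w
    · subst h2; rw [hα.invol w hw]; exact .inr (.inr ⟨c2, c1⟩)
    have h3 : α j ≠ w := by rintro rfl; exact h2 (hα.invol j hj).symm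
    have h4 : α j ≠ α w := fun he => h1 (by rw [← hα.invol j hj, he, hα.invol w hw])
    rw [c4 j h1 h2, c4 _ h3 h4]
    exact h.mate j hj
  · intro j hj hj2
    by_cases h2 : j = α w
    · subst h2; exact .inr rfl
    have h1 : j ≠ w := by rintro rfl; omega
    rw [c4 j h1 h2] at hj2
    rcases h.two j hj hj2 with h3 | h3
    · left; rw [c3 _ (by omega)]; exact h3
    · left; rw [h3]; exact c1
  · intro j hj hj1
    by_cases h1 : j = w
    · subst h1
      rcases h.next with h | h
      · exact .inr h
      · left; rw [c3 _ (by omega)]; omega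
    have h2 : j ≠ α w := by rintro rfl; omega
    rw [c4 j h1 h2] at hj1
    rcases h.one j hj hj1 with h3 | h3
    · left; rw [c3 _ (by omega)]; exact h3
    · exact .inr h3

/-- A coloured `w` can only be `v`: the current cycle is closed, or `v` was coloured as part of an
earlier cycle. -/
theorem ColInv.advance {M : ℕ} {k' α β : ℕ → ℕ} {t v w : ℕ} {col : ℕ → ℕ}
    (h : ColInv M α β t v w col) (hβ : IsMating M k' β) (hv : v < M) (h0 : col w ≠ 0) :
    ColInv M α β (t + 1) (v + 1) (v + 1) col := by
  obtain rfl : w = v := by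
    rcases h.next with h | h
    · exact h
    · exact absurd h.2.2.2.2 h0
  refine ⟨hv, .inl rfl, ?_, ?_, ?_, h.mate, ?_, ?_⟩
  · intro _ h1 h2
    rcases h.one _ h1 h2 with h | h
    · exact h
    · omega
  · have := h.count; omega
  · intro x hx
    rcases Nat.lt_succ_iff_lt_or_eq.1 hx with hx | rfl
    · exact h.before x hx
    · exact h0
  · intro j hj hj2
    left
    rcases h.two j hj hj2 with h3 | h3
    · exact h3
    -- The mate `w` of `j` must have colour 1: if it had colour 2 like `j`, the clause `two` at `w`
    -- would give `j` the colour 1 or make `w` its own mate.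
    have hbj : β w = j := by rw [← h3]; exact hβ.invol j hj
    rcases h.mate w hv with h4 | h4 | h4
    · omega
    · rw [h3]; exact h4.1
    · rcases h.two w hv h4.1 with h5 | h5
      · rw [hbj] at h5; omega
      · exact absurd h5 (hβ.ne w hv)
  · intro j hj hj1
    rcases h.one j hj hj1 with h3 | h3
    · exact .inl h3
    · subst h3; exact .inl (h.start rfl hv hj1)

/-- With `t = 3 * N`, the clause `count` forces `v = M`. Then `v` and `w` are out of range, and so
are the exceptions in `one` and `two`. -/
theorem ColInv.swaps {M N : ℕ} {k' α β : ℕ → ℕ} {v w : ℕ} {col : ℕ → ℕ}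
    (h : ColInv M α β (3 * N) v w col) (hM : M = 2 * N)
    (hβ : IsMating M k' β) : Swaps M α col ∧ Swaps M β col := by
  have hv : v = M := by
    have := h.le; have := h.count; have := numSet_le M col; omega
  have hw : w = M := by rcases h.next with h | h <;> omega
  have hc : ∀ j < M, col j ≠ 0 := fun j hj => h.before j (by omega)
  have hα' : Swaps M α col := fun j hj => by
    have := hc j hj
    rcases h.mate j hj with h | h | h
    · omega
    · exact .inl h
    · exact .inr h
  refine ⟨hα', fun j hj => ?_⟩
  rcases hα' j hj with h1 | h1
  · left
    refine ⟨h1.1, ?_⟩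
    rcases h.one j hj h1.1 with h2 | h2 <;> omega
  · right
    refine ⟨h1.1, ?_⟩
    rcases h.two j hj h1.1 with h2 | h2
    · exact h2
    · have := hβ.lt j hj; omega

/-- A colouring that swaps the colours along a mating splits every fibre of the key in half. -/
theorem Swaps.count {M : ℕ} {k α col : ℕ → ℕ} (h : Swaps M α col) (hα : IsMating M k α)
    (κ : ℕ) {c : ℕ} (hc : c = 1 ∨ c = 2) :
    2 * Nat.count (fun j => k j = κ ∧ col j = c) M = Nat.count (fun j => k j = κ) M := by
  -- The mating preserves the fibre and exchanges the colours, so it injects either colour class of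
  -- the fibre into the other.
  have hle : ∀ c d, (c = 1 ∧ d = 2) ∨ (c = 2 ∧ d = 1) →
      ((Finset.range M).filter (fun j => k j = κ ∧ col j = c)).card ≤
      ((Finset.range M).filter (fun j => k j = κ ∧ col j = d)).card := by
    intro c d hcd
    refine Finset.card_le_card_of_injOn α ?_ ?_
    · intro j hj
      simp only [Finset.coe_filter, Finset.mem_range, Set.mem_ofPred_eq] at hj ⊢
      refine ⟨hα.lt j hj.1, by rw [hα.key j hj.1]; exact hj.2.1, ?_⟩
      rcases h j hj.1 with h1 | h1 <;> omega
    · intro i hi j hj hij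
      simp only [Finset.coe_filter, Finset.mem_range, Set.mem_ofPred_eq] at hi hj
      rw [← hα.invol i hi.1, hij, hα.invol j hj.1]
  have h12 := le_antisymm (hle 1 2 (by simp)) (hle 2 1 (by simp))
  have hsum : ((Finset.range M).filter (fun j => k j = κ ∧ col j = 1)).card +
      ((Finset.range M).filter (fun j => k j = κ ∧ col j = 2)).card =
      ((Finset.range M).filter (fun j => k j = κ)).card := by
    rw [← Finset.card_union_of_disjoint]
    · congr 1
      ext j
      simp only [Finset.mem_union, Finset.mem_filter, Finset.mem_range]
      constructor
      · rintro (h | h) <;> exact ⟨h.1, h.2.1⟩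
      · rintro ⟨hj, hk⟩
        rcases h j hj with h1 | h1
        · exact .inl ⟨hj, hk, h1.1⟩
        · exact .inr ⟨hj, hk, h1.1⟩
    · rw [Finset.disjoint_left]
      intro j h1 h2
      simp only [Finset.mem_filter] at h1 h2
      omega
  rw [Nat.count_eq_card_filter_range, Nat.count_eq_card_filter_range]
  rcases hc with rfl | rfl <;> omega

/-! ### Traversing the cycles of a permutation -/

/-- The function `π` permutes the numbers below `n`. -/
structure IsPerm (n : ℕ) (π : ℕ → ℕ) : Prop where
  lt : ∀ x < n, π x < n
  inj : ∀ x < n, ∀ y < n, π x = π y → x = y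

/-- The state of the traversal of the cycles of `π` after `k` steps: `v` is the root of the current
cycle, `w` the next element, `r` the time of the visit of an element (zero if it is still to come),
`root` the root of its cycle, and `fin` the time at which the cycle of a root has been closed. -/
structure WalkInv (n : ℕ) (π : ℕ → ℕ) (k v w : ℕ) (r root fin : ℕ → ℕ) : Prop where
  le : v ≤ n
  count : k = v + numSet n r
  state : (w = v ∧ ∀ x < n, r x ≠ 0 → root x < v) ∨
    (v < n ∧ r v ≠ 0 ∧ root v = v ∧ ∃ x < n, r x = k ∧ r x ≠ 0 ∧ π x = w ∧ root x = v)
  before : ∀ x < v, r x ≠ 0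
  time_le : ∀ x < n, r x ≤ k
  inj : ∀ x < n, ∀ y < n, r x ≠ 0 → r x = r y → x = y
  root_le : ∀ x < n, r x ≠ 0 → root x ≤ v ∧ root x < n
  root_time : ∀ x < n, r x ≠ 0 → r (root x) ≠ 0 ∧ root (root x) = root x ∧ r (root x) ≤ r x
  succ : ∀ x < n, r x ≠ 0 → (root (π x) = root x ∧ r (π x) = r x + 1) ∨
    (π x = root x ∧ fin (root x) = r x + 1 ∧ root x < v) ∨ (π x = w ∧ r x = k ∧ root x = v)
  pred : ∀ x < n, r x ≠ 0 → root x = x ∨ ∃ y < n, r y ≠ 0 ∧ π y = x ∧ r x = r y + 1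
  closed : ∀ z < v, r z ≠ 0 → root z = z → ∃ y < n, r y ≠ 0 ∧ π y = z ∧ root y = z
  fin_le : ∀ x < n, r x ≠ 0 → root x < v → r x < fin (root x) ∧ fin (root x) ≤ k
  sep : ∀ x < n, ∀ y < n, r x ≠ 0 → root x ≠ root y → r x < r y →
    root x < v ∧ fin (root x) < r (root y)

namespace WalkInv

variable {n : ℕ} {π : ℕ → ℕ} {k v w : ℕ} {r root fin : ℕ → ℕ}

theorem init (n : ℕ) (π root fin : ℕ → ℕ) : WalkInv n π 0 0 0 (fun _ => 0) root fin := by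
  refine ⟨by omega, ?_, .inl ⟨rfl, by simp⟩, by simp, by simp, by simp, by simp, by simp, by simp,
    by simp, by simp, by simp, by simp⟩
  simp [numSet]

/-- Every step either visits an element or moves `v`, and each of these happens at most `n` times.
-/
theorem lt (h : WalkInv n π k v w r root fin) (hπ : IsPerm n π) (hk : k < 2 * n) :
    v < n ∧ w < n := by
  have hv : v < n := by
    by_contra hv
    have hv : v = n := by have := h.le; omega
    have := numSet_eq (M := n) (f := r) (by intro j hj; exact h.before j (by omega))
    have := h.count
    omega
  rcases h.state with h' | ⟨_, _, _, x, hx, _, _, hw, _⟩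
  · exact ⟨hv, by omega⟩
  · exact ⟨hv, hw ▸ hπ.lt x hx⟩

theorem visit (h : WalkInv n π k v w r root fin) (hv : v < n) (hw : w < n)
    (h0 : r w = 0) :
    WalkInv n π (k + 1) v (π w) (Function.update r w (k + 1)) (Function.update root w v) fin := by
  set r' := Function.update r w (k + 1) with hr'
  set root' := Function.update root w v with hroot'
  have a1 : r' w = k + 1 := by rw [hr', Function.update_self]
  have a2 : root' w = v := by rw [hroot', Function.update_self]
  have a3 : ∀ x, x ≠ w → r' x = r x := fun x hx => by rw [hr', Function.update_of_ne hx]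
  have a4 : ∀ x, x ≠ w → root' x = root x := fun x hx => by rw [hroot', Function.update_of_ne hx]
  have hne : ∀ x, r x ≠ 0 → x ≠ w := by rintro x hx rfl; exact hx h0
  have a5 : ∀ x, r x ≠ 0 → r' x = r x ∧ root' x = root x :=
    fun x hx => ⟨a3 x (hne x hx), a4 x (hne x hx)⟩
  have hvr : r' v ≠ 0 ∧ root' v = v := by
    rcases h.state with h | h
    · rw [← h.1, a1, a2, h.1]; omega
    · rw [(a5 v h.2.1).1, (a5 v h.2.1).2]; exact h.2.1 |> fun _ => ⟨h.2.1, h.2.2.1⟩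
  refine ⟨h.le, ?_, ?_, ?_, ?_, ?_, ?_, ?_, ?_, ?_, ?_, ?_, ?_⟩
  · rw [hr', numSet_update hw h0 (by omega)]; have := h.count; omega
  · exact .inr ⟨hv, hvr.1, hvr.2, w, hw, a1, by omega, rfl, a2⟩
  · intro x hx
    have := h.before x hx
    rw [(a5 x this).1]; exact this
  · intro x hx
    by_cases hxw : x = w
    · subst hxw; omega
    · rw [a3 x hxw]; have := h.time_le x hx; omega
  · intro x hx y hy hrx hxy
    have := h.time_le x hx
    have := h.time_le y hy
    by_cases hxw : x = w <;> by_cases hyw : y = w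
    · rw [hxw, hyw]
    · subst hxw; rw [a3 y hyw] at hxy; omega
    · subst hyw; rw [a3 x hxw] at hxy; omega
    · rw [a3 x hxw] at hrx hxy
      rw [a3 y hyw] at hxy
      exact h.inj x hx y hy hrx hxy
  · intro x hx hrx
    by_cases hxw : x = w
    · subst hxw; rw [a2]; exact ⟨le_rfl, hv⟩
    · rw [a3 x hxw] at hrx; rw [a4 x hxw]; exact h.root_le x hx hrx
  · intro x hx hrx
    by_cases hxw : x = w
    · subst hxw; rw [a2]
      refine ⟨hvr.1, hvr.2, ?_⟩
      by_cases hvx : v = x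
      · rw [hvx]
      · rw [a1, a3 v hvx]; have := h.time_le v hv; omega
    · rw [a3 x hxw] at hrx ⊢; rw [a4 x hxw]
      have := h.root_time x hx hrx
      rw [(a5 _ this.1).1, (a5 _ this.1).2]; exact this
  · intro x hx hrx
    by_cases hxw : x = w
    · subst hxw; exact .inr (.inr ⟨rfl, a1, a2⟩)
    · rw [a3 x hxw] at hrx ⊢; rw [a4 x hxw]
      rcases h.succ x hx hrx with h1 | h1 | h1
      · left
        rw [(a5 (π x) (by omega)).1, (a5 (π x) (by omega)).2]; exact h1
      · exact .inr (.inl h1)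
      · left
        rw [h1.1, a1, a2]; omega
  · intro x hx hrx
    by_cases hxw : x = w
    · subst hxw
      rcases h.state with h1 | ⟨_, _, _, y, hy, h2, h3, h4, _⟩
      · left; rw [a2, h1.1]
      · right
        exact ⟨y, hy, by rw [(a5 y h3).1]; exact h3, h4, by rw [a1, (a5 y h3).1, h2]⟩
    · rw [a3 x hxw] at hrx ⊢; rw [a4 x hxw]
      rcases h.pred x hx hrx with h1 | ⟨y, hy, h2, h3, h4⟩
      · exact .inl h1
      · exact .inr ⟨y, hy, by rw [(a5 y h2).1]; exact h2, h3, by rw [(a5 y h2).1]; exact h4⟩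
  · intro z hz hrz hroot
    have hzr := h.before z hz
    rw [(a5 z hzr).2] at hroot
    obtain ⟨y, hy, h2, h3, h4⟩ := h.closed z hz hzr hroot
    exact ⟨y, hy, by rw [(a5 y h2).1]; exact h2, h3, by rw [(a5 y h2).2]; exact h4⟩
  · intro x hx hrx hroot
    by_cases hxw : x = w
    · subst hxw; omega
    · rw [a3 x hxw] at hrx ⊢; rw [a4 x hxw] at hroot ⊢
      have := h.fin_le x hx hrx hroot
      omega
  · intro x hx y hy hrx hxy hlt
    have hty := h.time_le y hy
    by_cases hxw : x = w
    · subst hxw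
      by_cases hyw : y = x
      · subst hyw; omega
      · rw [a1, a3 y hyw] at hlt; omega
    rw [a3 x hxw] at hrx hlt
    rw [a4 x hxw] at hxy ⊢
    by_cases hyw : y = w
    · subst hyw
      rw [a2] at hxy ⊢
      have hx1 : root x < v := by have := h.root_le x hx hrx; omega
      refine ⟨hx1, ?_⟩
      -- The new element belongs to the open cycle of `v`. If it opens this cycle, its time exceeds
      -- all closing times so far. Otherwise `v` has been visited, and not before `x`: the clause
      -- `sep` would then say that the cycle of `v` is closed.
      rcases h.state with h1 | h1
      · rw [← h1.1, a1]; have := h.fin_le x hx hrx hx1; omega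
      · rw [(a5 v h1.2.1).1]
        have hvx : r v ≠ r x := fun he => hxy (by rw [← h.inj v hv x hx h1.2.1 he, h1.2.2.1])
        rcases lt_or_gt_of_ne hvx with h2 | h2
        · have := h.sep v hv x hx h1.2.1 (by rw [h1.2.2.1]; exact hxy.symm) h2
          rw [h1.2.2.1] at this; omega
        · have := (h.sep x hx v hv hrx (by rw [h1.2.2.1]; exact hxy) h2).2
          rwa [h1.2.2.1] at this
    · rw [a3 y hyw] at hlt; rw [a4 y hyw] at hxy ⊢
      have := h.sep x hx y hy hrx hxy hlt
      rw [(a5 (root y) (h.root_time y hy (by omega)).1).1]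
      exact this

/-- Either the cycle of the root `v` is closed, or `v` lies in an earlier cycle and is passed over.
In the latter case the value written to `fin v` is irrelevant, as `fin` is used at roots only. -/
theorem advance (h : WalkInv n π k v w r root fin) (hπ : IsPerm n π) (hv : v < n) (hw : w < n)
    (h0 : r w ≠ 0) :
    WalkInv n π (k + 1) (v + 1) (v + 1) r root (Function.update fin v (k + 1)) := by
  have hroot : ∀ x < n, r x ≠ 0 → root x < v + 1 := fun x hx hrx => by
    have := h.root_le x hx hrx; omega
  have hfin : ∀ z, z < v → Function.update fin v (k + 1) z = fin z := fun z hz => by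
    rw [Function.update_of_ne (by omega)]
  have hrv : r v ≠ 0 := by
    rcases h.state with h1 | h1
    · rw [← h1.1]; exact h0
    · exact h1.2.1
  -- An open walk can only run into its own root. The last element `x` is the only preimage of `w`.
  -- If `w` were no root, `pred` would give it the future time `k + 1`. If `w` were a root before
  -- `v`, its preimage would have the root `w`, but `x` has the root `v`.
  have hclose : (∀ x < n, r x ≠ 0 → root x < v) ∨
      ∃ x < n, r x = k ∧ r x ≠ 0 ∧ π x = v ∧ root x = v ∧ w = v := by
    rcases h.state with h1 | ⟨_, _, h1, x, hx, h2, h3, h4, h5⟩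
    · exact .inl h1.2
    right
    have hyx : ∀ y < n, π y = w → y = x := fun y hy hyw => hπ.inj y hy x hx (hyw.trans h4.symm)
    have hww : root w = w := by
      rcases h.pred w hw h0 with h6 | ⟨y, hy, h6, h7, h8⟩
      · exact h6
      · have := h.time_le w hw
        rw [hyx y hy h7] at h8; omega
    have hwv : w = v := by
      have := (h.root_le w hw h0).1
      rw [hww] at this
      rcases Nat.lt_or_ge w v with hlt | hge
      · obtain ⟨y, hy, h6, h7, h8⟩ := h.closed w hlt h0 hww
        rw [hyx y hy h7] at h8; omega
      · omega
    exact ⟨x, hx, h2, h3, h4.trans hwv, h5, hwv⟩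
  refine ⟨hv, ?_, .inl ⟨rfl, hroot⟩, ?_, ?_, h.inj, ?_, h.root_time, ?_, h.pred, ?_, ?_, ?_⟩
  · have := h.count; omega
  · intro x hx
    rcases Nat.lt_succ_iff_lt_or_eq.1 hx with hx | rfl
    · exact h.before x hx
    · exact hrv
  · intro x hx
    have := h.time_le x hx; omega
  · intro x hx hrx
    have := h.root_le x hx hrx; omega
  · intro x hx hrx
    rcases h.succ x hx hrx with h1 | h1 | h1
    · exact .inl h1
    · right; left
      rw [hfin _ h1.2.2]; omega
    · right; left
      rcases hclose with h2 | ⟨y, _, _, _, _, _, h2⟩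
      · have := h2 x hx hrx; omega
      · rw [h1.2.2, Function.update_self, h1.1, h1.2.1]; exact ⟨h2, rfl, by omega⟩
  · intro z hz hrz hroot
    rcases Nat.lt_succ_iff_lt_or_eq.1 hz with hz | rfl
    · exact h.closed z hz hrz hroot
    · rcases hclose with h2 | ⟨y, hy, _, h3, h4, h5, _⟩
      · have := h2 z hv hrz; omega
      · exact ⟨y, hy, h3, h4, h5⟩
  · intro x hx hrx hlt
    rcases Nat.lt_succ_iff_lt_or_eq.1 hlt with hlt | heq
    · rw [hfin _ hlt]; have := h.fin_le x hx hrx hlt; omega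
    · rw [heq, Function.update_self]; have := h.time_le x hx; omega
  · intro x hx y hy hrx hxy hlt
    have := h.sep x hx y hy hrx hxy hlt
    rw [hfin _ this.1]; omega

end WalkInv

/-- The result of the traversal of the cycles of `π`. -/
structure IsWalk (n : ℕ) (π r root fin : ℕ → ℕ) : Prop where
  pos : ∀ x < n, r x ≠ 0
  inj : ∀ x < n, ∀ y < n, r x = r y → x = y
  root_root : ∀ x < n, root (root x) = root x
  root_le : ∀ x < n, r (root x) ≤ r x
  lt_fin : ∀ x < n, r x < fin (root x)
  fin_le : ∀ x < n, fin (root x) ≤ 2 * n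
  succ : ∀ x < n, (root (π x) = root x ∧ r (π x) = r x + 1) ∨
    (π x = root x ∧ fin (root x) = r x + 1)
  sep : ∀ x < n, ∀ y < n, root x ≠ root y → r x < r y → fin (root x) < r (root y)

/-- After `2 * n` steps `v = n` exceeds every root, so no cycle is open. -/
theorem WalkInv.isWalk {n : ℕ} {π : ℕ → ℕ} {v w : ℕ} {r root fin : ℕ → ℕ}
    (h : WalkInv n π (2 * n) v w r root fin) : IsWalk n π r root fin := by
  have hv : v = n := by
    have := h.le; have := h.count; have := numSet_le n r; omega
  have hr : ∀ x < n, r x ≠ 0 := fun x hx => h.before x (by omega)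
  have hroot : ∀ x < n, root x < v := fun x hx => by
    have := (h.root_le x hx (hr x hx)).2; omega
  refine ⟨hr, fun x hx y hy => h.inj x hx y hy (hr x hx),
    fun x hx => (h.root_time x hx (hr x hx)).2.1, fun x hx => (h.root_time x hx (hr x hx)).2.2,
    fun x hx => (h.fin_le x hx (hr x hx) (hroot x hx)).1,
    fun x hx => (h.fin_le x hx (hr x hx) (hroot x hx)).2, fun x hx => ?_,
    fun x hx y hy hxy hlt => (h.sep x hx y hy (hr x hx) hxy hlt).2⟩
  rcases h.succ x hx (hr x hx) with h1 | h1 | h1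
  · exact .inl h1
  · exact .inr ⟨h1.1, h1.2.1⟩
  · have := hroot x hx; omega

/-! ### Columns for the edges of two classes -/

/-- Must the root `v` of a cycle of the path class be put at the end of its cycle? -/
def IsLast (ρ r root : ℕ → ℕ) (v : ℕ) : Prop :=
  if root (ρ v) = v then ¬ r (ρ v) < r (ρ (ρ v)) else ¬ r (ρ v) < r v

/-- The order `X` of the vertices: that of the visits, except for the roots that must be last. -/
structure IsSlot (n : ℕ) (ρ r root fin X : ℕ → ℕ) : Prop where
  last : ∀ v < n, root v = v → IsLast ρ r root v → X v = fin v
  first : ∀ v < n, root v = v → ¬ IsLast ρ r root v → X v = r v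
  other : ∀ v < n, root v ≠ v → X v = r v

/-- The vertex at which the edge from `a` to `b` uses a port, or `n` if there is none. -/
def portOf (n : ℕ) (X root : ℕ → ℕ) (path : Prop) [Decidable path] (a b : ℕ) : ℕ :=
  if path then if X b = X a + 1 then n else if root a = a then a else b
  else if root a = a ∧ root b = a then b else a

/-- The column of the edge from `a` to `b`. -/
def colOf (X root : ℕ → ℕ) (path : Prop) [Decidable path] (a b : ℕ) : ℕ :=
  if path then if X b = X a + 1 then 10 * X a + 5 else if root a = a then 10 * X b + 4
    else 10 * X a + 4
  else if root a = a ∧ root b = a then 10 * X a + 3 else 10 * X b + 2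

theorem colOf_mod (X root : ℕ → ℕ) (p : Prop) [Decidable p] (a b : ℕ) :
    2 ≤ colOf X root p a b % 10 ∧ colOf X root p a b % 10 ≤ 5 := by
  unfold colOf
  split_ifs <;> omega

/-- At an end without a port, the column is near. -/
theorem colOf_near {n : ℕ} {X root : ℕ → ℕ} {p : Prop} [Decidable p] {a b u : ℕ}
    (hu : u = a ∨ u = b) (hp : portOf n X root p a b ≠ u) :
    10 * X u ≤ colOf X root p a b + 5 ∧ colOf X root p a b ≤ 10 * X u + 5 := by
  unfold portOf at hp
  unfold colOf
  rcases hu with rfl | rfl <;> split_ifs at hp ⊢ <;> omega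

/-- The edges `i` with `S i`, from `T i` to `H i`, are distinct edges of a simple graph; those of the
path class follow the permutation `π`, and the other ones the permutation `ρ`. -/
structure IsTwoClass (n : ℕ) (π ρ T H : ℕ → ℕ) (S path : ℕ → Prop) : Prop where
  permPath : IsPerm n π
  permPort : IsPerm n ρ
  lt : ∀ i, S i → T i < n ∧ H i < n
  ne : ∀ i, S i → T i ≠ H i
  inj : ∀ i j, S i → S j → T i = T j → H i = H j → i = j
  anti : ∀ i j, S i → S j → T i = H j → H i = T j → i = j
  path_eq : ∀ i, S i → path i → H i = π (T i)
  port_eq : ∀ i, S i → ¬ path i → H i = ρ (T i)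

section

variable {n : ℕ} {π ρ r root fin X : ℕ → ℕ}

theorem IsSlot.cases (h : IsSlot n ρ r root fin X) {x : ℕ} (hx : x < n) :
    X x = r x ∨ (root x = x ∧ X x = fin x) := by
  by_cases h1 : root x = x
  · by_cases h2 : IsLast ρ r root x
    · exact .inr ⟨h1, h.last x hx h1 h2⟩
    · exact .inl (h.first x hx h1 h2)
  · exact .inl (h.other x hx h1)

theorem IsSlot.bounds (hX : IsSlot n ρ r root fin X) (hw : IsWalk n π r root fin) {x : ℕ}
    (hx : x < n) : r x ≤ X x ∧ X x ≤ fin (root x) := by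
  have := hw.lt_fin x hx
  rcases hX.cases hx with h | ⟨h1, h⟩
  · omega
  · rw [h1] at this ⊢; omega

/-- Cycles occupy disjoint intervals of the order. -/
theorem IsSlot.lt_iff (hX : IsSlot n ρ r root fin X) (hw : IsWalk n π r root fin) {x y : ℕ}
    (hx : x < n) (hy : y < n) (hxy : root x ≠ root y) : X x < X y ↔ r x < r y := by
  have bx := hX.bounds hw hx
  have bY := hX.bounds hw hy
  have rx := hw.root_le x hx
  have ry := hw.root_le y hy
  have hne : r x ≠ r y := fun he => hxy (by rw [hw.inj x hx y hy he])
  constructor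
  · intro h
    by_contra hlt
    have := hw.sep y hy x hx hxy.symm (by omega)
    omega
  · intro h
    have := hw.sep x hx y hy hxy h
    omega

/-- Within a cycle, a root that is put last gets the closing time, which is later than all visits;
different cycles occupy disjoint intervals. -/
theorem IsSlot.inj (hX : IsSlot n ρ r root fin X) (hw : IsWalk n π r root fin) {x y : ℕ}
    (hx : x < n) (hy : y < n) (hxy : X x = X y) : x = y := by
  by_cases hr : root x = root y
  · have fx := hw.lt_fin x hx
    have fy := hw.lt_fin y hy
    rcases hX.cases hx with h1 | ⟨h1, h2⟩ <;> rcases hX.cases hy with h3 | ⟨h3, h4⟩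
    · exact hw.inj x hx y hy (by omega)
    · rw [hr, h3] at fx; omega
    · rw [← hr, h1] at fy; omega
    · rw [← h1, hr, h3]
  · have h1 := hX.lt_iff hw hx hy hr
    have h2 := hX.lt_iff hw hy hx (Ne.symm hr)
    exact hw.inj x hx y hy (by omega)

theorem IsWalk.succ_root (hw : IsWalk n π r root fin) {x : ℕ} (hx : x < n) :
    root (π x) = root x := by
  rcases hw.succ x hx with h | h
  · exact h.1
  · rw [h.1, hw.root_root x hx]

/-- An edge of the path class that does not join consecutive vertices joins the root of its cycle to
another vertex, and leaves the root exactly if the root is last. -/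
theorem IsSlot.closing (hX : IsSlot n ρ r root fin X) (hw : IsWalk n π r root fin)
    (hπ : IsPerm n π) {x : ℕ} (hx : x < n) (hne : x ≠ π x) (hc : X (π x) ≠ X x + 1) :
    (root x = x ∧ IsLast ρ r root x ∧ root (π x) = x) ∨
    (root x ≠ x ∧ root x = π x ∧ root (π x) = π x ∧ ¬ IsLast ρ r root (π x)) := by
  have hp := hπ.lt x hx
  have hroot := hw.succ_root hx
  by_cases h1 : root x = x
  · refine .inl ⟨h1, ?_, by rw [hroot, h1]⟩
    by_contra h2
    have h3 := hX.first x hx h1 h2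
    rw [hX.other (π x) hp (by rw [hroot, h1]; exact hne), h3] at hc
    rcases hw.succ x hx with h | h
    · exact hc h.2
    · rw [h1] at h; exact hne h.1.symm
  · right
    have h2 := hX.other x hx h1
    rcases hw.succ x hx with h | h
    · have h3 : root (π x) = π x := by
        by_contra h3
        have := hX.other (π x) hp h3
        omega
      have := hw.root_le x hx
      rw [← hroot, h3] at this; omega
    · have h3 : root (π x) = π x := by rw [h.1, hw.root_root x hx]
      refine ⟨h1, h.1.symm, h3, fun h4 => ?_⟩
      have := hX.last (π x) hp h3 h4
      rw [← h.1] at h; omega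

variable {T H : ℕ → ℕ} {S path : ℕ → Prop} [DecidablePred path]

/-- A port edge at `u`, together with the vertex `a` near its column. -/
theorem IsTwoClass.port_cases (hc : IsTwoClass n π ρ T H S path) (hX : IsSlot n ρ r root fin X)
    (hw : IsWalk n π r root fin) {i : ℕ} (hi : S i)
    (hp : portOf n X root (path i) (T i) (H i) < n) :
    ∃ a < n, a ≠ portOf n X root (path i) (T i) (H i) ∧
      10 * X a + 2 ≤ colOf X root (path i) (T i) (H i) ∧
      colOf X root (path i) (T i) (H i) ≤ 10 * X a + 4 ∧
      ((path i ∧ portOf n X root (path i) (T i) (H i) = T i ∧ a = H i ∧ root (T i) = T i ∧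
          IsLast ρ r root (T i) ∧ root a = T i) ∨
        (path i ∧ portOf n X root (path i) (T i) (H i) = H i ∧ a = T i ∧ root (H i) = H i ∧
          ¬ IsLast ρ r root (H i) ∧ root a = H i) ∨
        (¬ path i ∧ portOf n X root (path i) (T i) (H i) = H i ∧ a = T i ∧ root a = a ∧
          root (H i) = a) ∨
        (¬ path i ∧ portOf n X root (path i) (T i) (H i) = T i ∧ a = H i ∧
          ¬ (root (T i) = T i ∧ root a = T i))) := by
  have hlt := hc.lt i hi
  have hne := hc.ne i hi
  by_cases h1 : path i
  · have hH := hc.path_eq i hi h1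
    by_cases h2 : X (H i) = X (T i) + 1
    · simp [portOf, h1, h2] at hp
    have h3 := hX.closing hw hc.permPath hlt.1 (by rw [← hH]; exact hne) (by rw [← hH]; exact h2)
    rw [← hH] at h3
    rcases h3 with h3 | h3
    · have e1 : portOf n X root (path i) (T i) (H i) = T i := by simp [portOf, h1, h2, h3]
      have e2 : colOf X root (path i) (T i) (H i) = 10 * X (H i) + 4 := by
        simp [colOf, h1, h2, h3]
      rw [e1, e2]
      exact ⟨H i, hlt.2, hne.symm, by omega, by omega, .inl ⟨h1, rfl, rfl, h3⟩⟩
    · have e1 : portOf n X root (path i) (T i) (H i) = H i := by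
        unfold portOf; rw [if_pos h1, if_neg h2, if_neg h3.1]
      have e2 : colOf X root (path i) (T i) (H i) = 10 * X (T i) + 4 := by
        unfold colOf; rw [if_pos h1, if_neg h2, if_neg h3.1]
      rw [e1, e2]
      exact ⟨T i, hlt.1, hne, by omega, by omega,
        .inr (.inl ⟨h1, rfl, rfl, h3.2.2.1, h3.2.2.2, h3.2.1⟩)⟩
  · by_cases h2 : root (T i) = T i ∧ root (H i) = T i
    · have e1 : portOf n X root (path i) (T i) (H i) = H i := by
        unfold portOf; rw [if_neg h1, if_pos h2]
      have e2 : colOf X root (path i) (T i) (H i) = 10 * X (T i) + 3 := by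
        unfold colOf; rw [if_neg h1, if_pos h2]
      rw [e1, e2]
      exact ⟨T i, hlt.1, hne, by omega, by omega, .inr (.inr (.inl ⟨h1, rfl, rfl, h2⟩))⟩
    · have e1 : portOf n X root (path i) (T i) (H i) = T i := by
        unfold portOf; rw [if_neg h1, if_neg h2]
      have e2 : colOf X root (path i) (T i) (H i) = 10 * X (H i) + 2 := by
        unfold colOf; rw [if_neg h1, if_neg h2]
      rw [e1, e2]
      exact ⟨H i, hlt.2, hne.symm, by omega, by omega, .inr (.inr (.inr ⟨h1, rfl, rfl, h2⟩))⟩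

/-- If a root is first (or last) in its cycle, then the other vertices of the cycle lie to its right
(to its left). -/
theorem IsSlot.root_side (hX : IsSlot n ρ r root fin X) (hw : IsWalk n π r root fin) {u z : ℕ}
    (hz : z < n) (hr : root z = u) (hzu : z ≠ u) (hun : u < n) :
    (¬ IsLast ρ r root u → X u < X z) ∧ (IsLast ρ r root u → X z < X u) := by
  have h1 : root u = u := by rw [← hr, hw.root_root z hz]
  have h2 : X z = r z := hX.other z hz (by rw [hr]; exact hzu.symm)
  have h3 := hw.root_le z hz
  have h4 := hw.lt_fin z hz
  have h5 : r u ≠ r z := fun he => hzu (hw.inj u hun z hz he).symm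
  rw [hr] at h3 h4
  refine ⟨fun h => ?_, fun h => ?_⟩
  · rw [hX.first u hun h1 h]; omega
  · rw [hX.last u hun h1 h]; omega

/-- Two edges with ports at the same vertex use opposite ports. -/
theorem IsTwoClass.opposite (hc : IsTwoClass n π ρ T H S path) (hX : IsSlot n ρ r root fin X)
    (hw : IsWalk n π r root fin) {i j u : ℕ} (hi : S i) (hj : S j) (hij : i ≠ j) (hu : u < n)
    (hpi : portOf n X root (path i) (T i) (H i) = u)
    (hpj : portOf n X root (path j) (T j) (H j) = u) :
    (colOf X root (path i) (T i) (H i) < 10 * X u ∧ 10 * X u < colOf X root (path j) (T j) (H j)) ∨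
    (colOf X root (path j) (T j) (H j) < 10 * X u ∧
      10 * X u < colOf X root (path i) (T i) (H i)) := by
  obtain ⟨a, ha, hau, ha1, ha2, hA⟩ := hc.port_cases hX hw hi (by omega)
  obtain ⟨b, hb, hbu, hb1, hb2, hB⟩ := hc.port_cases hX hw hj (by omega)
  rw [hpi] at hau hA
  rw [hpj] at hbu hB
  -- The columns exceed `10 * X a` and `10 * X b` by 2 to 4 only, so they lie on the same side of
  -- `u` as `a` and `b`.
  suffices h : (X a < X u ∧ X u < X b) ∨ (X b < X u ∧ X u < X a) by omega
  -- a closing edge and an unflipped edge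
  have hAC : ∀ a b j, b < n → S j → ¬ path j → u = T j → b = H j →
      ¬ (root (T j) = T j ∧ root b = T j) → root u = u → a < n → a ≠ u → root a = u →
      (X a < X u ∧ X u < X b) ∨ (X b < X u ∧ X u < X a) := by
    intro a b j hb hj hpj hTj hHj hnot hru ha hau hra
    have hρ := hc.port_eq j hj hpj
    have hside := hX.root_side hw ha hra hau hu
    have hrb : root b ≠ u := fun he => hnot ⟨by rw [← hTj]; exact hru, by rw [← hTj]; exact he⟩
    rw [← hTj, ← hHj] at hρ
    -- Here `b = ρ u` lies outside the cycle of `u`. The second case of `IsLast` puts the rest of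
    -- this cycle, and `a` with it, on the side of `u` away from `b`.
    have hlast : IsLast ρ r root u ↔ ¬ r b < r u := by
      unfold IsLast; rw [← hρ, if_neg hrb]
    have h1 := hX.lt_iff hw hb hu (by rw [hru]; exact hrb)
    have h2 : X b ≠ X u := fun he => hrb (by rw [hX.inj hw hb hu he, hru])
    by_cases hl : IsLast ρ r root u
    · have := hside.2 hl
      rw [hlast] at hl; omega
    · have := hside.1 hl
      rw [hlast] at hl; omega
  -- a flipped edge and an unflipped edge
  have hAB : ∀ a b i j, a < n → b < n → S i → S j → ¬ path i → ¬ path j → i ≠ j → u = H i →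
      a = T i → root a = a → root u = a → u = T j → b = H j → a ≠ u → b ≠ u →
      (X a < X u ∧ X u < X b) ∨ (X b < X u ∧ X u < X a) := by
    intro a b i j ha hb hi hj hpi hpj hij hHi hTi hra hru hTj hHj hau hbu
    have e1 : u = ρ a := by rw [hHi, hTi]; exact hc.port_eq i hi hpi
    have e2 : b = ρ u := by rw [hHj, hTj]; exact hc.port_eq j hj hpj
    have hba : b ≠ a := fun he => hij (hc.anti i j hi hj (by omega) (by omega))
    -- Here `u = ρ a` lies in the cycle of the root `a`. The first case of `IsLast` puts `a` on the
    -- side of `u` away from `b = ρ u`.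
    have hlast : IsLast ρ r root a ↔ ¬ r u < r b := by
      unfold IsLast; rw [← e1, if_pos hru, ← e2]
    have hside := hX.root_side hw hu hru hau.symm ha
    -- Moving roots does not change the order of `u` and `b`: in a common cycle neither is the root,
    -- and otherwise cycles are ordered as their visits.
    have hub : X u < X b ↔ r u < r b := by
      by_cases hrb : root b = a
      · rw [hX.other u hu (by rw [hru]; exact hau),
          hX.other b hb (by rw [hrb]; exact hba.symm)]
      · exact hX.lt_iff hw hu hb (by rw [hru]; exact fun he => hrb he.symm)
    have h2 : X b ≠ X u := fun he => hbu (hX.inj hw hb hu he)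
    by_cases hl : IsLast ρ r root a
    · have := hside.2 hl
      rw [hlast] at hl; omega
    · have := hside.1 hl
      rw [hlast] at hl; omega
  have hTT : T i = T j → (path i ↔ path j) → False := fun h1 h2 => by
    refine hij (hc.inj i j hi hj h1 ?_)
    by_cases hp : path i
    · rw [hc.path_eq i hi hp, hc.path_eq j hj (h2.1 hp), h1]
    · rw [hc.port_eq i hi hp, hc.port_eq j hj (fun h => hp (h2.2 h)), h1]
  have hHH : H i = H j → (path i ↔ path j) → False := fun h1 h2 => by
    refine hTT ?_ h2
    have li := (hc.lt i hi).1
    have lj := (hc.lt j hj).1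
    by_cases hp : path i
    · rw [hc.path_eq i hi hp, hc.path_eq j hj (h2.1 hp)] at h1
      exact hc.permPath.inj _ li _ lj h1
    · rw [hc.port_eq i hi hp, hc.port_eq j hj (fun h => hp (h2.2 h))] at h1
      exact hc.permPort.inj _ li _ lj h1
  -- Two edges of the same kind would share their tail or their head within one permutation. The two
  -- kinds of closing edges require different places of the root. A closing edge has its port at a
  -- root, a flipped edge at a vertex that is none. This leaves an unflipped edge together with a
  -- closing or a flipped one.
  rcases hA with ⟨p, e, f, A1, A2, A3⟩ | ⟨p, e, f, A1, A2, A3⟩ | ⟨p, e, f, A1, A2⟩ |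
      ⟨p, e, f, A1⟩ <;>
    rcases hB with ⟨q, g, k, B1, B2, B3⟩ | ⟨q, g, k, B1, B2, B3⟩ | ⟨q, g, k, B1, B2⟩ |
      ⟨q, g, k, B1⟩
  · exact (hTT (by omega) (by tauto)).elim
  · rw [← e] at A2; rw [← g] at B2; exact absurd A2 B2
  · rw [← g, e, A1] at B2; omega
  · rw [← e] at A1 A3
    exact hAC a b j hb hj q g k B1 A1 ha hau A3
  · rw [← e] at A2; rw [← g] at B2; exact absurd B2 A2
  · exact (hHH (by omega) (by tauto)).elim
  · rw [← g, e, A1] at B2; omega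
  · rw [← e] at A1 A3
    exact hAC a b j hb hj q g k B1 A1 ha hau A3
  · rw [← e, g, B1] at A2; omega
  · rw [← e, g, B1] at A2; omega
  · exact (hHH (by omega) (by tauto)).elim
  · exact hAB a b i j ha hb hi hj p q hij e f A1 (by rw [e]; exact A2) g k hau hbu
  · rw [← g] at B1 B3
    exact (hAC b a i ha hi p e f A1 B1 hb hbu B3).symm
  · rw [← g] at B1 B3
    exact (hAC b a i ha hi p e f A1 B1 hb hbu B3).symm
  · exact (hAB b a j i hb ha hj hi q p hij.symm g k B1 (by rw [g]; exact B2) e f hbu hau).symm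
  · exact (hTT (by omega) (by tauto)).elim

/-- The residue modulo 10 tells the kind of the edge, up to the direction of a closing edge, and the
slot then tells its tail or its head, which determines the edge within its permutation. -/
theorem IsTwoClass.colOf_inj (hc : IsTwoClass n π ρ T H S path) (hX : IsSlot n ρ r root fin X)
    (hw : IsWalk n π r root fin) {i j : ℕ} (hi : S i) (hj : S j)
    (h : colOf X root (path i) (T i) (H i) = colOf X root (path j) (T j) (H j)) : i = j := by
  have li := hc.lt i hi
  have lj := hc.lt j hj
  have hTT : T i = T j → (path i ↔ path j) → i = j := fun h1 h2 => by
    refine hc.inj i j hi hj h1 ?_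
    by_cases hp : path i
    · rw [hc.path_eq i hi hp, hc.path_eq j hj (h2.1 hp), h1]
    · rw [hc.port_eq i hi hp, hc.port_eq j hj (fun h => hp (h2.2 h)), h1]
  have hHH : H i = H j → (path i ↔ path j) → i = j := fun h1 h2 => by
    refine hTT ?_ h2
    by_cases hp : path i
    · rw [hc.path_eq i hi hp, hc.path_eq j hj (h2.1 hp)] at h1
      exact hc.permPath.inj _ li.1 _ lj.1 h1
    · rw [hc.port_eq i hi hp, hc.port_eq j hj (fun h => hp (h2.2 h))] at h1
      exact hc.permPort.inj _ li.1 _ lj.1 h1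
  have hclose : ∀ i, S i → path i → X (H i) ≠ X (T i) + 1 →
      (root (T i) = T i ∧ root (H i) = T i) ∨ (root (T i) ≠ T i ∧ root (T i) = H i) := by
    intro i hi hp h2
    have hH := hc.path_eq i hi hp
    have h3 := hX.closing hw hc.permPath (hc.lt i hi).1 (by rw [← hH]; exact hc.ne i hi)
      (by rw [← hH]; exact h2)
    rw [← hH] at h3
    rcases h3 with h3 | h3
    · exact .inl ⟨h3.1, h3.2.2⟩
    · exact .inr ⟨h3.1, h3.2.1⟩
  -- Closing edges of both directions with columns near the same vertex join this vertex to the same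
  -- root, in opposite directions; in a simple graph they are one edge.
  have hmix : ∀ i j, S i → S j → path i → path j → X (H i) ≠ X (T i) + 1 →
      X (H j) ≠ X (T j) + 1 → root (T i) = T i → root (T j) ≠ T j → X (H i) = X (T j) → i = j := by
    intro i j hi hj pi pj h1 h2 h3 h4 h5
    have h6 := hX.inj hw (hc.lt i hi).2 (hc.lt j hj).1 h5
    rcases hclose i hi pi h1 with h7 | h7
    · rcases hclose j hj pj h2 with h8 | h8
      · exact absurd h8.1 h4
      · refine hc.anti i j hi hj ?_ h6
        rw [← h8.2, ← h6, h7.2]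
    · exact absurd h3 h7.1
  unfold colOf at h
  split_ifs at h with p1 p2 p3 p4 p5 p6 p7 p8 p9 p10 p11 p12 p13 p14 p15 p16 p17 p18 p19 p20 <;>
    first
    | omega
    | exact hTT (hX.inj hw li.1 lj.1 (by omega)) (by tauto)
    | exact hHH (hX.inj hw li.2 lj.2 (by omega)) (by tauto)
    | exact hmix i j hi hj (by assumption) (by assumption) (by assumption) (by assumption)
        (by assumption) (by assumption) (by omega)
    | exact (hmix j i hj hi (by assumption) (by assumption) (by assumption) (by assumption)
        (by assumption) (by assumption) (by omega)).symm

end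

/-! ### Drawings with one column or one row for every edge -/

section Columns

variable {V : Type*}

/-- The height of the bend next to `u` on the edge `e` between `u` and `v`, relative to `u`. -/
def bendLift (y : V → ℤ) (port : Sym2 V → V → Bool) (e : Sym2 V) (u v : V) : ℤ :=
  if port e u then 0 else if y u < y v then 1 else -1

/-- The conditions on the columns `c e` of the edges `e` with `F e`, each of which consists of a
segment from either end to this column and of a part of the column. -/
structure IsColumns (x y : V → ℤ) (c : Sym2 V → ℤ) (port : Sym2 V → V → Bool)
    (F : Sym2 V → Prop) : Prop where
  sep_x : ∀ u v, u ≠ v → x u + 10 ≤ x v ∨ x v + 10 ≤ x u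
  sep_y : ∀ u v, u ≠ v → y u + 10 ≤ y v ∨ y v + 10 ≤ y u
  far : ∀ e, F e → ∀ w, c e + 2 ≤ x w ∨ x w + 2 ≤ c e
  inj : ∀ e e', F e → F e' → c e = c e' → e = e'
  near : ∀ u v, F s(u, v) → port s(u, v) u = false →
    x u ≤ c s(u, v) + 5 ∧ c s(u, v) ≤ x u + 5
  one : ∀ u v, F s(u, v) → port s(u, v) u = true → port s(u, v) v = false
  opp : ∀ u v v', F s(u, v) → F s(u, v') → s(u, v) ≠ s(u, v') → port s(u, v) u = true →
    port s(u, v') u = true →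
    (c s(u, v) < x u ∧ x u < c s(u, v')) ∨ (c s(u, v') < x u ∧ x u < c s(u, v))

/-- The point `(a, b)` lies on the first segment of the edge from `u` to `v`. -/
def OnEnd (x y : V → ℤ) (c : Sym2 V → ℤ) (port : Sym2 V → V → Bool) (u v : V) (a b : ℝ) : Prop :=
  ∃ s : ℝ, 0 ≤ s ∧ s ≤ 1 ∧ a = x u + s * (c s(u, v) - x u) ∧
    b = y u + s * bendLift y port s(u, v) u v

/-- The point `(a, b)` lies on the middle segment of the edge from `u` to `v`. -/
def OnMid (y : V → ℤ) (c : Sym2 V → ℤ) (port : Sym2 V → V → Bool) (u v : V) (a b : ℝ) : Prop :=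
  a = c s(u, v) ∧ ∃ s : ℝ, 0 ≤ s ∧ s ≤ 1 ∧
    b = (1 - s) * (y u + bendLift y port s(u, v) u v) + s * (y v + bendLift y port s(u, v) v u)

variable {x y : V → ℤ} {c : Sym2 V → ℤ} {port : Sym2 V → V → Bool} {F : Sym2 V → Prop}

theorem bendLift_cases (y : V → ℤ) (port : Sym2 V → V → Bool) (e : Sym2 V) (u v : V) :
    bendLift y port e u v = 0 ∧ port e u = true ∨
    bendLift y port e u v = 1 ∧ port e u = false ∧ y u < y v ∨
    bendLift y port e u v = -1 ∧ port e u = false ∧ y v ≤ y u := by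
  unfold bendLift
  cases h : port e u
  · by_cases h' : y u < y v
    · simp [h']
    · simp [h']; omega
  · simp

theorem OnMid.symm {u v : V} {a b : ℝ} (h : OnMid y c port u v a b) : OnMid y c port v u a b := by
  obtain ⟨h, s, h0, h1, hb⟩ := h
  unfold OnMid
  rw [Sym2.eq_swap]
  exact ⟨h, 1 - s, by linarith, by linarith, by rw [hb]; ring⟩

theorem OnEnd.abs_le {u v : V} {a b : ℝ} (h : OnEnd x y c port u v a b) :
    y u - 1 ≤ b ∧ b ≤ y u + 1 := by
  obtain ⟨s, h0, h1, _, hb⟩ := h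
  rcases bendLift_cases y port s(u, v) u v with h | h | h <;> rw [h.1] at hb <;> push_cast at hb <;>
    constructor <;> linarith

namespace IsColumns

variable (h : IsColumns x y c port F)

include h

theorem ne_of_near {u w : V} {b : ℝ} (h1 : y u - 1 ≤ b) (h2 : b ≤ y u + 1) (h3 : y w - 1 ≤ b)
    (h4 : b ≤ y w + 1) : u = w := by
  by_contra hne
  rcases h.sep_y u w hne with h5 | h5
  · have : (y u : ℝ) + 10 ≤ y w := by exact_mod_cast h5
    linarith
  · have : (y w : ℝ) + 10 ≤ y u := by exact_mod_cast h5
    linarith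

theorem near_left {u v : V} {a b : ℝ} (hF : F s(u, v)) (hp : port s(u, v) u = false)
    (he : OnEnd x y c port u v a b) : x u - 5 ≤ a ∧ a ≤ x u + 5 := by
  obtain ⟨s, h0, h1, ha, _⟩ := he
  obtain ⟨h2, h3⟩ := h.near u v hF hp
  have h2' : (x u : ℝ) ≤ c s(u, v) + 5 := by exact_mod_cast h2
  have h3' : (c s(u, v) : ℝ) ≤ x u + 5 := by exact_mod_cast h3
  rw [ha]
  constructor <;> nlinarith

/-- First segments stay within height 1 of their vertices, so both start at the same one, and there
they have different directions: slanted segments go up or down by one unit to different columns,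
ports are level, and two ports go to opposite sides. -/
theorem end_end {u v u' v' : V} {a b : ℝ} (hF : F s(u, v)) (hF' : F s(u', v'))
    (hne : s(u, v) ≠ s(u', v') ∨ u ≠ u') (he : OnEnd x y c port u v a b)
    (he' : OnEnd x y c port u' v' a b) : u = u' ∧ a = x u ∧ b = y u := by
  obtain rfl : u = u' := h.ne_of_near he.abs_le.1 he.abs_le.2 he'.abs_le.1 he'.abs_le.2
  have hne : s(u, v) ≠ s(u, v') := by tauto
  obtain ⟨s, h0, h1, ha, hb⟩ := he
  obtain ⟨t, t0, t1, ha', hb'⟩ := he'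
  have hc : (c s(u, v) : ℝ) ≠ c s(u, v') := by
    exact_mod_cast fun hc => hne (h.inj _ _ hF hF' hc)
  have hcu : (c s(u, v) : ℝ) - x u ≠ 0 := by
    have : c s(u, v) - x u ≠ 0 := by rcases h.far _ hF u with h | h <;> omega
    exact_mod_cast this
  have hcu' : (c s(u, v') : ℝ) - x u ≠ 0 := by
    have : c s(u, v') - x u ≠ 0 := by rcases h.far _ hF' u with h | h <;> omega
    exact_mod_cast this
  have e1 : s * (c s(u, v) - x u) = t * (c s(u, v') - x u) := by linarith
  have e2 : s * (bendLift y port s(u, v) u v : ℝ) = t * bendLift y port s(u, v') u v' := by linarith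
  suffices hs : s = 0 by
    subst hs; exact ⟨rfl, by linarith, by linarith⟩
  have hst : s = t → s = 0 := fun hst => by
    subst hst
    by_contra hs
    exact hc (by have := mul_left_cancel₀ hs e1; linarith)
  have ht : t = 0 → s = 0 := fun ht => by
    rw [ht, zero_mul] at e1
    rcases mul_eq_zero.1 e1 with h | h
    · exact h
    · exact absurd h hcu
  rcases bendLift_cases y port s(u, v) u v with k | k | k <;>
    rcases bendLift_cases y port s(u, v') u v' with k' | k' | k' <;>
    rw [k.1, k'.1] at e2 <;> push_cast at e2
  · by_contra hs
    have hs : 0 < s := lt_of_le_of_ne h0 (Ne.symm hs)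
    rcases h.opp u v v' hF hF' hne k.2 k'.2 with h3 | h3
    · have h4 : (c s(u, v) : ℝ) < x u := by exact_mod_cast h3.1
      have h5 : (x u : ℝ) < c s(u, v') := by exact_mod_cast h3.2
      nlinarith
    · have h4 : (c s(u, v') : ℝ) < x u := by exact_mod_cast h3.1
      have h5 : (x u : ℝ) < c s(u, v) := by exact_mod_cast h3.2
      nlinarith
  all_goals first
    | exact hst (by linarith)
    | exact ht (by linarith)
    | linarith

theorem mid_mid {u v u' v' : V} {a b : ℝ} (hF : F s(u, v)) (hF' : F s(u', v'))
    (hne : s(u, v) ≠ s(u', v')) (he : OnMid y c port u v a b)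
    (he' : OnMid y c port u' v' a b) : False := by
  have : (c s(u, v) : ℝ) = c s(u', v') := by rw [← he.1, he'.1]
  exact hne (h.inj _ _ hF hF' (by exact_mod_cast this))

/-- The segment starts off the column, so it reaches the column only at its end. -/
theorem end_mid_self {u v : V} {a b : ℝ} (hF : F s(u, v)) (he : OnEnd x y c port u v a b)
    (ha' : a = c s(u, v)) :
    a = c s(u, v) ∧ b = y u + bendLift y port s(u, v) u v := by
  obtain ⟨s, h0, h1, ha, hb⟩ := he
  have hcu : (c s(u, v) : ℝ) - x u ≠ 0 := by
    have : c s(u, v) - x u ≠ 0 := by rcases h.far _ hF u with h | h <;> omega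
    exact_mod_cast this
  have : s = 1 := by
    have : (s - 1) * (c s(u, v) - x u) = 0 := by linarith
    rcases mul_eq_zero.1 this with h | h
    · linarith
    · exact absurd h hcu
  subst this
  exact ⟨ha', by linarith⟩

/-- The middle segment keeps its distance from the ends of the edge. -/
theorem mid_far {u v : V} {a b : ℝ} (huv : u ≠ v) (hp : port s(u, v) u = false)
    (he : OnMid y c port u v a b) : b ≤ y u - 1 ∨ y u + 1 ≤ b := by
  obtain ⟨_, s, h0, h1, hb⟩ := he
  have hv : -1 ≤ (bendLift y port s(u, v) v u : ℝ) ∧ (bendLift y port s(u, v) v u : ℝ) ≤ 1 := by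
    rcases bendLift_cases y port s(u, v) v u with k | k | k <;> rw [k.1] <;> norm_num
  rcases bendLift_cases y port s(u, v) u v with k | k | k
  · rw [hp] at k; simp at k
  · right
    have : (y u : ℝ) + 10 ≤ y v := by
      have : y u + 10 ≤ y v := by rcases h.sep_y u v huv with h | h <;> omega
      exact_mod_cast this
    rw [k.1] at hb; push_cast at hb
    nlinarith
  · left
    have : (y v : ℝ) + 10 ≤ y u := by
      have : y v + 10 ≤ y u := by rcases h.sep_y u v huv with h | h <;> omega
      exact_mod_cast this
    rw [k.1] at hb; push_cast at hb
    nlinarith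

/-- Only a port segment can meet the middle segment of another edge. A slanted segment would have to
start at an end of that edge without a port, but there the middle segment begins only at the height
where slanted segments stop, and leads away. -/
theorem end_mid {u v u' v' : V} {a b : ℝ} (hF : F s(u, v)) (hF' : F s(u', v'))
    (hne : s(u, v) ≠ s(u', v')) (huv' : u' ≠ v') (he : OnEnd x y c port u v a b)
    (he' : OnMid y c port u' v' a b) :
    port s(u, v) u = true ∧ a ≠ x u ∧ a ≠ c s(u, v) ∧
      b ≠ y u' + bendLift y port s(u', v') u' v' ∧ b ≠ y v' + bendLift y port s(u', v') v' u' := by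
  have ha1 : a ≠ x u := by
    rw [he'.1]
    have : c s(u', v') ≠ x u := by rcases h.far _ hF' u with h | h <;> omega
    exact_mod_cast this
  have ha2 : a ≠ c s(u, v) := by
    rw [he'.1]
    exact_mod_cast fun hc => hne (h.inj _ _ hF' hF hc).symm
  obtain ⟨s, h0, h1, ha, hb⟩ := id he
  have hs0 : 0 < s := lt_of_le_of_ne h0 (by rintro rfl; exact ha1 (by linarith))
  have hs1 : s < 1 := lt_of_le_of_ne h1 (by rintro rfl; exact ha2 (by linarith))
  have hport : port s(u, v) u = true := by
    by_contra hp
    have hp : port s(u, v) u = false := by simpa using hp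
    have key : ∀ u' v', u' ≠ v' → F s(u', v') → OnMid y c port u' v' a b →
        port s(u', v') u' = false → False := by
      intro u' v' huv' hF' he' hp'
      have hn := h.near_left hF hp he
      have hn' := h.near u' v' hF' hp'
      have h2 : (x u' : ℝ) ≤ c s(u', v') + 5 := by exact_mod_cast hn'.1
      have h3 : (c s(u', v') : ℝ) ≤ x u' + 5 := by exact_mod_cast hn'.2
      have h4 := he'.1
      have h2u := h.near u v hF hp
      have h5 : (x u : ℝ) ≤ c s(u, v) + 5 := by exact_mod_cast h2u.1
      have h6 : (c s(u, v) : ℝ) ≤ x u + 5 := by exact_mod_cast h2u.2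
      -- The point is less than 5 away from `x u`, because `s < 1`, and at most 5 away from `x u'`;
      -- distinct vertices are at least 10 apart.
      obtain rfl : u = u' := by
        by_contra hu
        rcases h.sep_x u u' hu with h7 | h7
        · have : (x u : ℝ) + 10 ≤ x u' := by exact_mod_cast h7
          nlinarith
        · have : (x u' : ℝ) + 10 ≤ x u := by exact_mod_cast h7
          nlinarith
      have hf := h.mid_far huv' hp' he'
      rcases bendLift_cases y port s(u, v) u v with k | k | k <;> rw [k.1] at hb <;>
        push_cast at hb <;> rcases hf with h | h <;> linarith
    -- Every edge has an end without a port, from which it can be viewed.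
    cases hp' : port s(u', v') u'
    · exact key u' v' huv' hF' he' hp'
    · have := h.one u' v' hF' hp'
      rw [Sym2.eq_swap] at this hF'
      exact key v' u' huv'.symm hF' he'.symm this
  have hb0 : b = y u := by
    rcases bendLift_cases y port s(u, v) u v with k | k | k
    · rw [k.1] at hb; push_cast at hb; linarith
    · rw [hport] at k; simp at k
    · rw [hport] at k; simp at k
  -- A bend at the height `y u` could only belong to another port at `u`, and this one is on the
  -- other side.
  have key : ∀ u' v', F s(u', v') → s(u, v) ≠ s(u', v') → a = c s(u', v') →
      b ≠ y u' + bendLift y port s(u', v') u' v' := by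
    intro u' v' hF' hne ha' hb'
    rw [hb0] at hb'
    have hb' : y u = y u' + bendLift y port s(u', v') u' v' := by exact_mod_cast hb'
    have hcases := bendLift_cases y port s(u', v') u' v'
    obtain rfl : u = u' := by
      by_contra hu
      rcases h.sep_y u u' hu with h7 | h7 <;> rcases hcases with k | k | k <;> omega
    have hp' : port s(u, v') u = true := by
      rcases hcases with k | k | k
      · exact k.2
      · omega
      · omega
    rcases h.opp u v v' hF hF' hne hport hp' with h3 | h3
    · have h4 : (c s(u, v) : ℝ) < x u := by exact_mod_cast h3.1
      have h5 : (x u : ℝ) < c s(u, v') := by exact_mod_cast h3.2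
      nlinarith
    · have h4 : (c s(u, v') : ℝ) < x u := by exact_mod_cast h3.1
      have h5 : (x u : ℝ) < c s(u, v) := by exact_mod_cast h3.2
      nlinarith
  refine ⟨hport, ha1, ha2, key u' v' hF' hne he'.1, ?_⟩
  have := key v' u' (by rwa [Sym2.eq_swap]) (by rwa [Sym2.eq_swap (a := v')]) he'.symm.1
  rwa [Sym2.eq_swap] at this

theorem vertex_end {u v w : V} (he : OnEnd x y c port u v (x w) (y w)) : w = u :=
  h.ne_of_near (by linarith) (by linarith) he.abs_le.1 he.abs_le.2

theorem vertex_mid {u v w : V} (hF : F s(u, v)) (he : OnMid y c port u v (x w) (y w)) : False := by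
  have : x w = c s(u, v) := by exact_mod_cast he.1
  rcases h.far _ hF w with h | h <;> omega

variable {F' : Sym2 V → Prop} (h' : IsColumns y x c port F')

include h'

/-- A column keeps a distance of 2 from the vertices, whereas the bends of the row edges are
displaced from them by at most 1; hence no crossing of a column with a row is a bend. -/
theorem mid_mid' {u v u' v' : V} {a b : ℝ} (hF : F s(u, v)) (hF' : F' s(u', v'))
    (he : OnMid y c port u v a b) (he' : OnMid x c port u' v' b a) :
    (b ≠ y u + bendLift y port s(u, v) u v ∧ b ≠ y v + bendLift y port s(u, v) v u) ∧
      (a ≠ x u' + bendLift x port s(u', v') u' v' ∧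
        a ≠ x v' + bendLift x port s(u', v') v' u') := by
  have key : ∀ {x y : V → ℤ} {F}, IsColumns x y c port F → ∀ (e : Sym2 V), F e → ∀ e' u v,
      ((c e : ℤ) : ℝ) ≠ x u + bendLift x port e' u v := by
    intro x y F h e he e' u v heq
    have heq : c e = x u + bendLift x port e' u v := by exact_mod_cast heq
    rcases h.far e he u with h | h <;>
      rcases bendLift_cases x port e' u v with k | k | k <;> omega
  rw [he.1, he'.1]
  exact ⟨⟨key h' _ hF' _ _ _, key h' _ hF' _ _ _⟩,
    ⟨key h _ hF _ _ _, key h _ hF _ _ _⟩⟩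

-- The first segment stays within height 1 of its vertex, and the row is at least 2 away from it.
omit h in
theorem end_mid' {u v u' v' : V} {a b : ℝ} (hF' : F' s(u', v'))
    (he : OnEnd x y c port u v a b) (he' : OnMid x c port u' v' b a) : False := by
  have h1 := he.abs_le
  rw [he'.1] at h1
  rcases h'.far _ hF' u with h2 | h2
  · have : (c s(u', v') : ℝ) + 2 ≤ y u := by exact_mod_cast h2
    linarith
  · have : (y u : ℝ) + 2 ≤ c s(u', v') := by exact_mod_cast h2
    linarith

/-- At a common vertex, the segment of the column edge extends at least 2 in `x` and at most 1 in
`y`, that of the row edge conversely, so they share only the vertex. At different vertices, the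
point is within 1 of `u` in height and within 1 of `u'` in the other coordinate; a slanted segment
does not reach that far, so both are ports. -/
theorem end_end' {u v u' v' : V} {a b : ℝ} (hF : F s(u, v)) (hF' : F' s(u', v'))
    (he : OnEnd x y c port u v a b) (he' : OnEnd y x c port u' v' b a) :
    (u = u' ∧ a = x u ∧ b = y u) ∨ (port s(u, v) u = true ∧ port s(u', v') u' = true ∧
      a ≠ x u ∧ a ≠ c s(u, v) ∧ b ≠ y u' ∧ b ≠ c s(u', v')) := by
  have b1 := he.abs_le
  have b2 := he'.abs_le
  by_cases hu : u = u'
  · subst hu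
    left
    obtain ⟨s, h0, h1, ha, hb⟩ := he
    obtain ⟨t, t0, t1, hb', ha'⟩ := he'
    have k1 : -1 ≤ (bendLift y port s(u, v) u v : ℝ) ∧ (bendLift y port s(u, v) u v : ℝ) ≤ 1 := by
      rcases bendLift_cases y port s(u, v) u v with k | k | k <;> rw [k.1] <;> norm_num
    have k2 : -1 ≤ (bendLift x port s(u, v') u v' : ℝ) ∧
        (bendLift x port s(u, v') u v' : ℝ) ≤ 1 := by
      rcases bendLift_cases x port s(u, v') u v' with k | k | k <;> rw [k.1] <;> norm_num
    have e1 : s * (c s(u, v) - x u) = t * (bendLift x port s(u, v') u v' : ℝ) := by linarith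
    have e2 : s * (bendLift y port s(u, v) u v : ℝ) = t * (c s(u, v') - y u) := by linarith
    have l1 : 2 * s ≤ t := by
      rcases h.far _ hF u with h2 | h2
      · have : (c s(u, v) : ℝ) + 2 ≤ x u := by exact_mod_cast h2
        nlinarith
      · have : (x u : ℝ) + 2 ≤ c s(u, v) := by exact_mod_cast h2
        nlinarith
    have l2 : 2 * t ≤ s := by
      rcases h'.far _ hF' u with h2 | h2
      · have : (c s(u, v') : ℝ) + 2 ≤ y u := by exact_mod_cast h2
        nlinarith
      · have : (y u : ℝ) + 2 ≤ c s(u, v') := by exact_mod_cast h2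
        nlinarith
    obtain rfl : s = 0 := by linarith
    exact ⟨rfl, by linarith, by linarith⟩
  · right
    have hp : port s(u, v) u = true := by
      by_contra hp
      have := h.near_left hF (by simpa using hp) he
      rcases h.sep_x u u' hu with h7 | h7
      · have : (x u : ℝ) + 10 ≤ x u' := by exact_mod_cast h7
        linarith
      · have : (x u' : ℝ) + 10 ≤ x u := by exact_mod_cast h7
        linarith
    have hp' : port s(u', v') u' = true := by
      by_contra hp
      have := h'.near_left hF' (by simpa using hp) he'
      rcases h'.sep_x u u' hu with h7 | h7
      · have : (y u : ℝ) + 10 ≤ y u' := by exact_mod_cast h7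
        linarith
      · have : (y u' : ℝ) + 10 ≤ y u := by exact_mod_cast h7
        linarith
    obtain ⟨s, h0, h1, ha, hb⟩ := he
    obtain ⟨t, t0, t1, hb', ha'⟩ := he'
    have hb : b = y u := by simpa [bendLift, hp] using hb
    have ha : a = x u' := by simpa [bendLift, hp'] using ha'
    refine ⟨hp, hp', ?_, ?_, ?_, ?_⟩
    · rw [ha]
      have : x u' ≠ x u := by rcases h.sep_x u u' hu with h | h <;> omega
      exact_mod_cast this
    · rw [ha]
      have : x u' ≠ c s(u, v) := by rcases h.far _ hF u' with h | h <;> omega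
      exact_mod_cast this
    · rw [hb]
      have : y u ≠ y u' := by rcases h.sep_y u u' hu with h | h <;> omega
      exact_mod_cast this
    · rw [hb]
      have : y u ≠ c s(u', v') := by rcases h'.far _ hF' u with h | h <;> omega
      exact_mod_cast this

end IsColumns

end Columns

/-! ### The polyline drawing with columns and rows, and its validity -/

section Drawing

variable {V : Type*} {G : SimpleGraph V}

/-- The drawing with a column `c e` for every edge `e` with `vert e`, and a row `c e` for the other
edges. -/
def columnDrawing (G : SimpleGraph V) (x y : V → ℤ) (c : Sym2 V → ℤ) (port : Sym2 V → V → Bool)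
    (vert : Sym2 V → Bool) : PolylineDrawing G where
  pos v := (x v, y v)
  bends d :=
    if vert d.edge then
      [(c d.edge, y d.fst + bendLift y port d.edge d.fst d.snd),
        (c d.edge, y d.snd + bendLift y port d.edge d.snd d.fst)]
    else
      [(x d.fst + bendLift x port d.edge d.fst d.snd, c d.edge),
        (x d.snd + bendLift x port d.edge d.snd d.fst, c d.edge)]
  bends_symm d := by
    rw [SimpleGraph.Dart.edge_symm]
    cases vert d.edge <;> simp

theorem exists_of_mem_segment {P Q : ℤ × ℤ} {p : ℝ × ℝ}
    (h : p ∈ segment ℝ (toPlane P) (toPlane Q)) :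
    ∃ s : ℝ, 0 ≤ s ∧ s ≤ 1 ∧ p.1 = (1 - s) * P.1 + s * Q.1 ∧ p.2 = (1 - s) * P.2 + s * Q.2 := by
  rw [segment_eq_image] at h
  obtain ⟨s, hs, rfl⟩ := h
  exact ⟨s, hs.1, hs.2, by simp [toPlane], by simp [toPlane]⟩

/-- The point `(a, b)` lies on a segment of the edge `e`, of which `hor`, `ver` and `op` say that it
is parallel to the first axis, that it is parallel to the second axis, and that the point is none of
its ends. -/
def OnPiece (x y : V → ℤ) (c : Sym2 V → ℤ) (port : Sym2 V → V → Bool) (hor ver op : Prop)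
    (e : Sym2 V) (a b : ℝ) : Prop :=
  ∃ u v, u ≠ v ∧ e = s(u, v) ∧
    ((OnEnd x y c port u v a b ∧ (port s(u, v) u = true → hor) ∧
        (a ≠ x u → a ≠ c s(u, v) → op)) ∨
      (OnMid y c port u v a b ∧ ver ∧ (b ≠ y u + bendLift y port s(u, v) u v →
        b ≠ y v + bendLift y port s(u, v) v u → op)))

variable {x y : V → ℤ} {c : Sym2 V → ℤ} {port : Sym2 V → V → Bool} {F F' : Sym2 V → Prop}

theorem IsColumns.onPiece_same (h : IsColumns x y c port F) {e e' : Sym2 V} (hF : F e)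
    (hF' : F e') (hne : e ≠ e') {a b : ℝ} {hor ver op hor' ver' op' : Prop}
    (hp : OnPiece x y c port hor ver op e a b) (hp' : OnPiece x y c port hor' ver' op' e' a b) :
    (∃ w, w ∈ e ∧ w ∈ e' ∧ a = x w ∧ b = y w) ∨
      (op ∧ op' ∧ ((hor ∧ ver') ∨ (ver ∧ hor'))) := by
  obtain ⟨u, v, huv, rfl, hp⟩ := hp
  obtain ⟨u', v', huv', rfl, hp'⟩ := hp'
  rcases hp with ⟨h1, h2, h3⟩ | ⟨h1, h2, h3⟩ <;> rcases hp' with ⟨h4, h5, h6⟩ | ⟨h4, h5, h6⟩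
  · obtain ⟨rfl, ha, hb⟩ := h.end_end hF hF' (.inl hne) h1 h4
    exact .inl ⟨u, Sym2.mem_mk_left _ _, Sym2.mem_mk_left _ _, ha, hb⟩
  · obtain ⟨k1, k2, k3, k4, k5⟩ := h.end_mid hF hF' hne huv' h1 h4
    exact .inr ⟨h3 k2 k3, h6 k4 k5, .inl ⟨h2 k1, h5⟩⟩
  · obtain ⟨k1, k2, k3, k4, k5⟩ := h.end_mid hF' hF hne.symm huv h4 h1
    exact .inr ⟨h3 k4 k5, h6 k2 k3, .inr ⟨h2, h5 k1⟩⟩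
  · exact (h.mid_mid hF hF' hne h1 h4).elim

/-- The row edge is seen as a column edge after exchanging the axes, hence the exchanged arguments
of its piece. -/
theorem IsColumns.onPiece_cross (h : IsColumns x y c port F) (h' : IsColumns y x c port F')
    {e e' : Sym2 V} (hF : F e) (hF' : F' e') {a b : ℝ} {hor ver op hor' ver' op' : Prop}
    (hp : OnPiece x y c port hor ver op e a b) (hp' : OnPiece y x c port ver' hor' op' e' b a) :
    (∃ w, w ∈ e ∧ w ∈ e' ∧ a = x w ∧ b = y w) ∨
      (op ∧ op' ∧ ((hor ∧ ver') ∨ (ver ∧ hor'))) := by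
  obtain ⟨u, v, huv, rfl, hp⟩ := hp
  obtain ⟨u', v', huv', rfl, hp'⟩ := hp'
  rcases hp with ⟨h1, h2, h3⟩ | ⟨h1, h2, h3⟩ <;> rcases hp' with ⟨h4, h5, h6⟩ | ⟨h4, h5, h6⟩
  · rcases h.end_end' h' hF hF' h1 h4 with ⟨rfl, ha, hb⟩ | ⟨k1, k2, k3, k4, k5, k6⟩
    · exact .inl ⟨u, Sym2.mem_mk_left _ _, Sym2.mem_mk_left _ _, ha, hb⟩
    · exact .inr ⟨h3 k3 k4, h6 k5 k6, .inl ⟨h2 k1, h5 k2⟩⟩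
  · exact (h'.end_mid' hF' h1 h4).elim
  · exact (h.end_mid' hF h4 h1).elim
  · obtain ⟨⟨k1, k2⟩, k3, k4⟩ := h.mid_mid' h' hF hF' h1 h4
    exact .inr ⟨h3 k1 k2, h6 k3 k4, .inr ⟨h2, h5⟩⟩

variable {vert : Sym2 V → Bool} {d : G.Dart}

theorem columnDrawing_numSegs : (columnDrawing G x y c port vert).numSegs d = 3 := by
  unfold PolylineDrawing.numSegs columnDrawing
  cases h : vert d.edge <;> simp [h]

theorem toPlane_ne_left {P : ℤ × ℤ} {p : ℝ × ℝ} (h : p.1 ≠ P.1) : toPlane P ≠ p := by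
  rintro rfl; exact h rfl

theorem toPlane_ne_right {P : ℤ × ℤ} {p : ℝ × ℝ} (h : p.2 ≠ P.2) : toPlane P ≠ p := by
  rintro rfl; exact h rfl

theorem onEnd_of_segment {u v : V} {p : ℝ × ℝ}
    (h : p ∈ segment ℝ (toPlane (x u, y u))
      (toPlane (c s(u, v), y u + bendLift y port s(u, v) u v))) :
    OnEnd x y c port u v p.1 p.2 := by
  obtain ⟨s, h0, h1, ha, hb⟩ := exists_of_mem_segment h
  exact ⟨s, h0, h1, by rw [ha]; ring, by rw [hb]; push_cast; ring⟩

theorem onMid_of_segment {u v : V} {p : ℝ × ℝ}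
    (h : p ∈ segment ℝ (toPlane (c s(u, v), y u + bendLift y port s(u, v) u v))
      (toPlane (c s(u, v), y v + bendLift y port s(u, v) v u))) :
    OnMid y c port u v p.1 p.2 := by
  obtain ⟨s, h0, h1, ha, hb⟩ := exists_of_mem_segment h
  exact ⟨by rw [ha]; ring, s, h0, h1, by rw [hb]; push_cast; ring⟩

theorem onEnd_of_segment' {u v : V} {p : ℝ × ℝ}
    (h : p ∈ segment ℝ (toPlane (x u, y u))
      (toPlane (x u + bendLift x port s(u, v) u v, c s(u, v)))) :
    OnEnd y x c port u v p.2 p.1 := by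
  obtain ⟨s, h0, h1, ha, hb⟩ := exists_of_mem_segment h
  exact ⟨s, h0, h1, by rw [hb]; ring, by rw [ha]; push_cast; ring⟩

theorem onMid_of_segment' {u v : V} {p : ℝ × ℝ}
    (h : p ∈ segment ℝ (toPlane (x u + bendLift x port s(u, v) u v, c s(u, v)))
      (toPlane (x v + bendLift x port s(u, v) v u, c s(u, v)))) :
    OnMid x c port u v p.2 p.1 := by
  obtain ⟨s, h0, h1, ha, hb⟩ := exists_of_mem_segment h
  exact ⟨by rw [hb]; ring, s, h0, h1, by rw [ha]; push_cast; ring⟩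

theorem edge_eq_mk (d : G.Dart) : d.edge = s(d.fst, d.snd) := rfl

theorem edge_eq_mk' (d : G.Dart) : d.edge = s(d.snd, d.fst) := by
  rw [Sym2.eq_swap]; rfl

section Corners

theorem columnDrawing_corners (hv : vert d.edge = true) :
    (columnDrawing G x y c port vert).corner d 0 = (x d.fst, y d.fst) ∧
    (columnDrawing G x y c port vert).corner d 1 =
      (c d.edge, y d.fst + bendLift y port d.edge d.fst d.snd) ∧
    (columnDrawing G x y c port vert).corner d 2 =
      (c d.edge, y d.snd + bendLift y port d.edge d.snd d.fst) ∧
    (columnDrawing G x y c port vert).corner d 3 = (x d.snd, y d.snd) := by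
  simp [PolylineDrawing.corner, columnDrawing, hv]

theorem columnDrawing_corners' (hv : vert d.edge = false) :
    (columnDrawing G x y c port vert).corner d 0 = (x d.fst, y d.fst) ∧
    (columnDrawing G x y c port vert).corner d 1 =
      (x d.fst + bendLift x port d.edge d.fst d.snd, c d.edge) ∧
    (columnDrawing G x y c port vert).corner d 2 =
      (x d.snd + bendLift x port d.edge d.snd d.fst, c d.edge) ∧
    (columnDrawing G x y c port vert).corner d 3 = (x d.snd, y d.snd) := by
  simp [PolylineDrawing.corner, columnDrawing, hv]

theorem columnDrawing_seg (hv : vert d.edge = true) {p : ℝ × ℝ} :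
    (p ∈ (columnDrawing G x y c port vert).seg d 0 → OnEnd x y c port d.fst d.snd p.1 p.2) ∧
    (p ∈ (columnDrawing G x y c port vert).seg d 1 → OnMid y c port d.fst d.snd p.1 p.2) ∧
    (p ∈ (columnDrawing G x y c port vert).seg d 2 → OnEnd x y c port d.snd d.fst p.1 p.2) := by
  obtain ⟨h0, h1, h2, h3⟩ := columnDrawing_corners (G := G) (x := x) (y := y) (c := c)
    (port := port) hv
  refine ⟨fun h => ?_, fun h => ?_, fun h => ?_⟩ <;> unfold PolylineDrawing.seg at h
  · rw [h0, h1, edge_eq_mk] at h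
    exact onEnd_of_segment h
  · rw [h1, h2, edge_eq_mk] at h
    exact onMid_of_segment h
  · rw [h2, h3, edge_eq_mk', segment_symm] at h
    exact onEnd_of_segment h

theorem columnDrawing_seg' (hv : vert d.edge = false) {p : ℝ × ℝ} :
    (p ∈ (columnDrawing G x y c port vert).seg d 0 → OnEnd y x c port d.fst d.snd p.2 p.1) ∧
    (p ∈ (columnDrawing G x y c port vert).seg d 1 → OnMid x c port d.fst d.snd p.2 p.1) ∧
    (p ∈ (columnDrawing G x y c port vert).seg d 2 → OnEnd y x c port d.snd d.fst p.2 p.1) := by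
  obtain ⟨h0, h1, h2, h3⟩ := columnDrawing_corners' (G := G) (x := x) (y := y) (c := c)
    (port := port) hv
  refine ⟨fun h => ?_, fun h => ?_, fun h => ?_⟩ <;> unfold PolylineDrawing.seg at h
  · rw [h0, h1, edge_eq_mk] at h
    exact onEnd_of_segment' h
  · rw [h1, h2, edge_eq_mk] at h
    exact onMid_of_segment' h
  · rw [h2, h3, edge_eq_mk', segment_symm] at h
    exact onEnd_of_segment' h

theorem columnDrawing_onPiece (hv : vert d.edge = true) {i : ℕ} (hi : i < 3) {p : ℝ × ℝ}
    (hp : p ∈ (columnDrawing G x y c port vert).seg d i) :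
    OnPiece x y c port ((columnDrawing G x y c port vert).IsHorizontal d i)
      ((columnDrawing G x y c port vert).IsVertical d i)
      (p ∈ (columnDrawing G x y c port vert).openSeg d i) d.edge p.1 p.2 := by
  obtain ⟨h0, h1, h2, h3⟩ := columnDrawing_corners (G := G) (x := x) (y := y) (c := c)
    (port := port) hv
  obtain ⟨k0, k1, k2⟩ := columnDrawing_seg (G := G) (x := x) (y := y) (c := c) (port := port) hv
    (p := p)
  unfold PolylineDrawing.IsHorizontal PolylineDrawing.IsVertical PolylineDrawing.openSeg
  unfold PolylineDrawing.seg at hp k0 k1 k2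
  interval_cases i
  · refine ⟨d.fst, d.snd, d.adj.ne, rfl, .inl ⟨k0 hp, fun h => ?_, fun ha hb => ?_⟩⟩
    · rw [h0, h1]; simp [bendLift, edge_eq_mk, h]
    · refine mem_openSegment_of_ne_left_right ?_ ?_ hp
      · rw [h0]; exact toPlane_ne_left ha
      · rw [h1]; exact toPlane_ne_left hb
  · refine ⟨d.fst, d.snd, d.adj.ne, rfl, .inr ⟨k1 hp, by rw [h1, h2], fun ha hb => ?_⟩⟩
    refine mem_openSegment_of_ne_left_right ?_ ?_ hp
    · rw [h1]; exact toPlane_ne_right (by push_cast; exact ha)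
    · rw [h2]; exact toPlane_ne_right (by push_cast; exact hb)
  · refine ⟨d.snd, d.fst, d.adj.ne.symm, edge_eq_mk' d,
      .inl ⟨k2 hp, fun h => ?_, fun ha hb => ?_⟩⟩
    · rw [h2, h3]; simp [bendLift, edge_eq_mk', h]
    · refine mem_openSegment_of_ne_left_right ?_ ?_ hp
      · rw [h2]; exact toPlane_ne_left (by rw [edge_eq_mk']; exact hb)
      · rw [h3]; exact toPlane_ne_left ha

theorem columnDrawing_onPiece' (hv : vert d.edge = false) {i : ℕ} (hi : i < 3) {p : ℝ × ℝ}
    (hp : p ∈ (columnDrawing G x y c port vert).seg d i) :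
    OnPiece y x c port ((columnDrawing G x y c port vert).IsVertical d i)
      ((columnDrawing G x y c port vert).IsHorizontal d i)
      (p ∈ (columnDrawing G x y c port vert).openSeg d i) d.edge p.2 p.1 := by
  obtain ⟨h0, h1, h2, h3⟩ := columnDrawing_corners' (G := G) (x := x) (y := y) (c := c)
    (port := port) hv
  obtain ⟨k0, k1, k2⟩ := columnDrawing_seg' (G := G) (x := x) (y := y) (c := c) (port := port) hv
    (p := p)
  unfold PolylineDrawing.IsHorizontal PolylineDrawing.IsVertical PolylineDrawing.openSeg
  unfold PolylineDrawing.seg at hp k0 k1 k2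
  interval_cases i
  · refine ⟨d.fst, d.snd, d.adj.ne, rfl, .inl ⟨k0 hp, fun h => ?_, fun ha hb => ?_⟩⟩
    · rw [h0, h1]; simp [bendLift, edge_eq_mk, h]
    · refine mem_openSegment_of_ne_left_right ?_ ?_ hp
      · rw [h0]; exact toPlane_ne_right ha
      · rw [h1]; exact toPlane_ne_right hb
  · refine ⟨d.fst, d.snd, d.adj.ne, rfl, .inr ⟨k1 hp, by rw [h1, h2], fun ha hb => ?_⟩⟩
    refine mem_openSegment_of_ne_left_right ?_ ?_ hp
    · rw [h1]; exact toPlane_ne_left (by push_cast; exact ha)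
    · rw [h2]; exact toPlane_ne_left (by push_cast; exact hb)
  · refine ⟨d.snd, d.fst, d.adj.ne.symm, edge_eq_mk' d,
      .inl ⟨k2 hp, fun h => ?_, fun ha hb => ?_⟩⟩
    · rw [h2, h3]; simp [bendLift, edge_eq_mk', h]
    · refine mem_openSegment_of_ne_left_right ?_ ?_ hp
      · rw [h2]; exact toPlane_ne_right (by rw [edge_eq_mk']; exact hb)
      · rw [h3]; exact toPlane_ne_right ha

end Corners

theorem IsColumns.bend_ne (h : IsColumns x y c port F) {u v : V} (huv : u ≠ v) (e : Sym2 V) :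
    y u + bendLift y port e u v ≠ y v + bendLift y port e v u := by
  rcases h.sep_y u v huv with h1 | h1 <;>
    rcases bendLift_cases y port e u v with k | k | k <;>
    rcases bendLift_cases y port e v u with k' | k' | k' <;> omega

theorem columnDrawing_isApRAC (hX : IsColumns x y c port fun e => e ∈ G.edgeSet ∧ vert e = true)
    (hY : IsColumns y x c port fun e => e ∈ G.edgeSet ∧ vert e = false) :
    (columnDrawing G x y c port vert).IsApRAC 2 := by
  have hedge : ∀ d : G.Dart, d.edge ∈ G.edgeSet := fun d => d.edge_mem
  refine ⟨?_, ?_, ?_, ?_, ?_, ?_⟩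
  · intro u v huv
    by_contra hne
    have : x u = x v := congrArg Prod.fst huv
    rcases hX.sep_x u v hne with h | h <;> omega
  · intro d
    unfold columnDrawing
    cases h : vert d.edge <;> simp [h]
  · intro d i hi
    rw [columnDrawing_numSegs] at hi
    cases hv : vert d.edge
    · obtain ⟨h0, h1, h2, h3⟩ := columnDrawing_corners' (G := G) (x := x) (y := y) (c := c)
        (port := port) hv
      have hf := hY.far d.edge ⟨hedge d, hv⟩
      have hf1 := hf d.fst
      have hf2 := hf d.snd
      have hb := hY.bend_ne d.adj.ne d.edge
      interval_cases i <;> simp only [h0, h1, h2, h3, zero_add, Nat.reduceAdd, ne_eq,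
        Prod.mk.injEq] <;> omega
    · obtain ⟨h0, h1, h2, h3⟩ := columnDrawing_corners (G := G) (x := x) (y := y) (c := c)
        (port := port) hv
      have hf := hX.far d.edge ⟨hedge d, hv⟩
      have hf1 := hf d.fst
      have hf2 := hf d.snd
      have hb := hX.bend_ne d.adj.ne d.edge
      interval_cases i <;> simp only [h0, h1, h2, h3, zero_add, Nat.reduceAdd, ne_eq,
        Prod.mk.injEq] <;> omega
  · intro d i j hij hj p hpi hpj
    rw [columnDrawing_numSegs] at hj
    cases hv : vert d.edge
    · obtain ⟨h0, h1, h2, h3⟩ := columnDrawing_corners' (G := G) (x := x) (y := y) (c := c)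
        (port := port) hv
      obtain ⟨k0, k1, k2⟩ := columnDrawing_seg' (G := G) (x := x) (y := y) (c := c) (port := port)
        hv (p := p)
      have hE : s(d.fst, d.snd) ∈ G.edgeSet ∧ vert s(d.fst, d.snd) = false := ⟨hedge d, hv⟩
      have hE' : s(d.snd, d.fst) ∈ G.edgeSet ∧ vert s(d.snd, d.fst) = false := by
        rw [Sym2.eq_swap]; exact hE
      obtain ⟨rfl, rfl⟩ | ⟨rfl, rfl⟩ | ⟨rfl, rfl⟩ :
        (i = 0 ∧ j = 1) ∨ (i = 0 ∧ j = 2) ∨ (i = 1 ∧ j = 2) := by omega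
      · refine ⟨rfl, ?_⟩
        have := hY.end_mid_self hE (k0 hpi) (k1 hpj).1
        rw [h1, edge_eq_mk]
        exact Prod.ext (by simpa [toPlane] using this.2) (by simpa [toPlane] using this.1)
      · exact absurd (hY.end_end hE hE' (.inr d.adj.ne) (k0 hpi) (k2 hpj)).1 d.adj.ne
      · refine ⟨rfl, ?_⟩
        have := hY.end_mid_self hE' (k2 hpj) (k1 hpi).symm.1
        rw [h2, edge_eq_mk']
        exact Prod.ext (by simpa [toPlane] using this.2) (by simpa [toPlane] using this.1)
    · obtain ⟨h0, h1, h2, h3⟩ := columnDrawing_corners (G := G) (x := x) (y := y) (c := c)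
        (port := port) hv
      obtain ⟨k0, k1, k2⟩ := columnDrawing_seg (G := G) (x := x) (y := y) (c := c) (port := port)
        hv (p := p)
      have hE : s(d.fst, d.snd) ∈ G.edgeSet ∧ vert s(d.fst, d.snd) = true := ⟨hedge d, hv⟩
      have hE' : s(d.snd, d.fst) ∈ G.edgeSet ∧ vert s(d.snd, d.fst) = true := by
        rw [Sym2.eq_swap]; exact hE
      obtain ⟨rfl, rfl⟩ | ⟨rfl, rfl⟩ | ⟨rfl, rfl⟩ :
        (i = 0 ∧ j = 1) ∨ (i = 0 ∧ j = 2) ∨ (i = 1 ∧ j = 2) := by omega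
      · refine ⟨rfl, ?_⟩
        have := hX.end_mid_self hE (k0 hpi) (k1 hpj).1
        rw [h1, edge_eq_mk]
        exact Prod.ext (by simpa [toPlane] using this.1) (by simpa [toPlane] using this.2)
      · exact absurd (hX.end_end hE hE' (.inr d.adj.ne) (k0 hpi) (k2 hpj)).1 d.adj.ne
      · refine ⟨rfl, ?_⟩
        have := hX.end_mid_self hE' (k2 hpj) (k1 hpi).symm.1
        rw [h2, edge_eq_mk']
        exact Prod.ext (by simpa [toPlane] using this.1) (by simpa [toPlane] using this.2)
  · intro d i hi w hw
    rw [columnDrawing_numSegs] at hi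
    cases hv : vert d.edge
    · obtain ⟨k0, k1, k2⟩ := columnDrawing_seg' (G := G) (x := x) (y := y) (c := c) (port := port)
        hv (p := toPlane (x w, y w))
      interval_cases i
      · exact .inl (hY.vertex_end (k0 hw))
      · exact (hY.vertex_mid ⟨hedge d, hv⟩ (k1 hw)).elim
      · exact .inr (hY.vertex_end (k2 hw))
    · obtain ⟨k0, k1, k2⟩ := columnDrawing_seg (G := G) (x := x) (y := y) (c := c) (port := port)
        hv (p := toPlane (x w, y w))
      interval_cases i
      · exact .inl (hX.vertex_end (k0 hw))
      · exact (hX.vertex_mid ⟨hedge d, hv⟩ (k1 hw)).elim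
      · exact .inr (hX.vertex_end (k2 hw))
  · intro d d' hne i j hi hj p hpi hpj
    rw [columnDrawing_numSegs] at hi hj
    cases hv : vert d.edge <;> cases hv' : vert d'.edge
    · rcases hY.onPiece_same ⟨hedge d, hv⟩ ⟨hedge d', hv'⟩ hne
        (columnDrawing_onPiece' hv hi hpi) (columnDrawing_onPiece' hv' hj hpj) with
        ⟨w, h1, h2, h3, h4⟩ | ⟨h1, h2, h3⟩
      · exact .inl ⟨w, h1, h2, Prod.ext h4 h3⟩
      · exact .inr ⟨h1, h2, h3.symm⟩
    · rcases hX.onPiece_cross hY ⟨hedge d', hv'⟩ ⟨hedge d, hv⟩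
        (columnDrawing_onPiece hv' hj hpj) (columnDrawing_onPiece' hv hi hpi) with
        ⟨w, h1, h2, h3, h4⟩ | ⟨h1, h2, h3⟩
      · exact .inl ⟨w, h2, h1, Prod.ext h3 h4⟩
      · exact .inr ⟨h2, h1, by tauto⟩
    · rcases hX.onPiece_cross hY ⟨hedge d, hv⟩ ⟨hedge d', hv'⟩
        (columnDrawing_onPiece hv hi hpi) (columnDrawing_onPiece' hv' hj hpj) with
        ⟨w, h1, h2, h3, h4⟩ | ⟨h1, h2, h3⟩
      · exact .inl ⟨w, h1, h2, Prod.ext h3 h4⟩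
      · exact .inr ⟨h1, h2, h3⟩
    · rcases hX.onPiece_same ⟨hedge d, hv⟩ ⟨hedge d', hv'⟩ hne
        (columnDrawing_onPiece hv hi hpi) (columnDrawing_onPiece hv' hj hpj) with
        ⟨w, h1, h2, h3, h4⟩ | ⟨h1, h2, h3⟩
      · exact .inl ⟨w, h1, h2, Prod.ext h3 h4⟩
      · exact .inr ⟨h1, h2, h3⟩

theorem PolylineDrawing.area_le [Nonempty V] (D : PolylineDrawing G) {B : ℤ}
    (h : ∀ p ∈ D.points, 0 ≤ p.1 ∧ p.1 ≤ B ∧ 0 ≤ p.2 ∧ p.2 ≤ B) : D.area ≤ (B + 1) ^ 2 := by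
  have hne : D.points.Nonempty := ⟨D.pos (Classical.arbitrary V), .inl ⟨_, rfl⟩⟩
  have key : ∀ f : ℤ × ℤ → ℤ, (∀ p ∈ D.points, 0 ≤ f p ∧ f p ≤ B) →
      0 ≤ sSup (f '' D.points) - sInf (f '' D.points) + 1 ∧
      sSup (f '' D.points) - sInf (f '' D.points) + 1 ≤ B + 1 := by
    intro f hf
    have h1 : sSup (f '' D.points) ≤ B :=
      csSup_le (hne.image f) (by rintro _ ⟨p, hp, rfl⟩; exact (hf p hp).2)
    have h2 : 0 ≤ sInf (f '' D.points) :=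
      le_csInf (hne.image f) (by rintro _ ⟨p, hp, rfl⟩; exact (hf p hp).1)
    have h3 : sInf (f '' D.points) ≤ sSup (f '' D.points) :=
      csInf_le_csSup (hne.image f) ⟨0, by rintro _ ⟨p, hp, rfl⟩; exact (hf p hp).1⟩
        ⟨B, by rintro _ ⟨p, hp, rfl⟩; exact (hf p hp).2⟩
    omega
  have hx := key Prod.fst fun p hp => ⟨(h p hp).1, (h p hp).2.1⟩
  have hy := key Prod.snd fun p hp => (h p hp).2.2
  unfold PolylineDrawing.area PolylineDrawing.width PolylineDrawing.height
  rw [sq]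
  exact mul_le_mul hx.2 hy.2 hy.1 (by omega)

end Drawing

/-! ### The program -/

namespace RamProgram

open RamExpr

theorem arr_setReg (σ : RamState) (x v : ℕ) : (σ.setReg x v).arr = σ.arr := rfl

theorem reg_setArr (σ : RamState) (a i v : ℕ) : (σ.setArr a i v).reg = σ.reg := rfl

theorem reg_setReg (σ : RamState) (x v y : ℕ) :
    (σ.setReg x v).reg y = if y = x then v else σ.reg y := by
  simp [RamState.setReg, Function.update_apply]

theorem arr_setArr (σ : RamState) (a i v b : ℕ) :
    (σ.setArr a i v).arr b = if b = a then Function.update (σ.arr a) i v else σ.arr b := by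
  simp [RamState.setArr, Function.update_apply]

/-- Pair the elements with equal keys, as far as possible. -/
def pairBody (k l α : ℕ) : RamProgram :=
  .branch (get l (get k (reg 10)))
    (.seq (.assign 11 (sub (get l (get k (reg 10))) (lit 1)))
      (.seq (.store α (reg 10) (reg 11))
        (.seq (.store α (reg 11) (reg 10)) (.store l (get k (reg 10)) (lit 0)))))
    (.store l (get k (reg 10)) (add (reg 10) (lit 1)))

theorem ensures_pair {W k l α N M : ℕ} {σ : RamState} (hkl : k ≠ l) (hkα : k ≠ α) (hlα : l ≠ α)
    (hN : N ≠ 10 ∧ N ≠ 11) (hM : σ.reg N = M) (hMW : M ≤ W) (hk : ∀ i < M, σ.arr k i ≤ W)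
    (hl : σ.arr l = fun _ => 0) :
    Ensures W (forLoop 10 N (pairBody k l α)) σ (M * 40 + 6)
      fun τ => PairInv (σ.arr k) M (τ.arr l) (τ.arr α) := by
  refine Ensures.mono (Ensures.forLoop (fun i τ => PairInv (σ.arr k) i (τ.arr l) (τ.arr α)) hM hMW
    ?_ ?_ ?_ ?_) ?_ fun _ _ h => h
  · simp [forLoop, pairBody, writesReg, hN]
  · simp [pairBody, writesReg]
  · rw [arr_setReg, hl]; exact .init _ _
  · intro i hi τ hx hF hI
    have e : τ.arr k = σ.arr k := hF.arr k (by simp [forLoop, pairBody, writesArr, hkl, hkα])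
    have hki := hk i hi
    have hlast := hI.last (σ.arr k i)
    simp only [pairBody, Wp, RamExpr.eval, arr_setReg, reg_setArr, reg_setReg, arr_setArr, hx, e]
    simp only [hkα, hlα, hlα.symm, if_true, if_false, Nat.reduceEqDiff]
    refine ⟨fun h => ⟨by omega, by omega, by omega, by omega, by omega, hki, by omega, hI.close h⟩,
      fun h => ⟨hki, by omega, hI.open h⟩⟩
  · refine Nat.add_le_add_right (Nat.mul_le_mul_left _ ?_) _
    simp [pairBody, stepBound, cost]

/-- Colour the union of the matchings `α` and `β`. -/
def colBody (α β col : ℕ) : RamProgram :=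
  .branch (get col (reg 12))
    (.seq (.assign 11 (add (reg 11) (lit 1))) (.assign 12 (reg 11)))
    (.seq (.store col (reg 12) (lit 1))
      (.seq (.store col (get α (reg 12)) (lit 2)) (.assign 12 (get β (get α (reg 12))))))

/-- The registers 11 and 12 hold `v` and `w` of `ColInv`. The `3 * N` iterations are `2 * N` moves
of `v` and `N` colourings of two elements each. -/
theorem ensures_col {W α β col I M N : ℕ} {k k' : ℕ → ℕ} {σ : RamState} (hα : α ≠ col)
    (hβ : β ≠ col) (hI : I ≠ 10 ∧ I ≠ 11 ∧ I ≠ 12) (hM : M = 2 * N) (hN : σ.reg I = 3 * N)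
    (hNW : 3 * N ≤ W) (hc : σ.arr col = fun _ => 0) (mα : IsMating M k (σ.arr α))
    (mβ : IsMating M k' (σ.arr β)) (h2 : 2 ≤ W) :
    Ensures W (.seq (.assign 11 (lit 0)) (.seq (.assign 12 (lit 0))
        (forLoop 10 I (colBody α β col)))) σ (3 * N * 40 + 10)
      fun τ => Swaps M (σ.arr α) (τ.arr col) ∧ Swaps M (σ.arr β) (τ.arr col) := by
  have hfor : Ensures W (forLoop 10 I (colBody α β col)) ((σ.setReg 11 0).setReg 12 0)
      (3 * N * ((colBody α β col).stepBound + 8) + 6)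
      (fun τ => ColInv M (σ.arr α) (σ.arr β) (3 * N) (τ.reg 11) (τ.reg 12) (τ.arr col)) := by
    refine Ensures.forLoop (fun t τ => ColInv M (σ.arr α) (σ.arr β) t (τ.reg 11) (τ.reg 12)
      (τ.arr col)) (by simp [reg_setReg, hI, hN]) hNW ?_ ?_ ?_ ?_
    · simp [forLoop, colBody, writesReg, hI]
    · simp [colBody, writesReg]
    · simp only [arr_setReg, reg_setReg, hc]
      exact .init _ _ _
    · intro t ht τ hx hF hI
      have eα : τ.arr α = σ.arr α := hF.arr α (by simp [forLoop, colBody, writesArr, hα])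
      have eβ : τ.arr β = σ.arr β := hF.arr β (by simp [forLoop, colBody, writesArr, hβ])
      obtain ⟨hv, hw⟩ := hI.lt hM ht
      have b1 := mα.lt _ hw
      have b2 := mβ.lt _ b1
      simp only [colBody, Wp, RamExpr.eval, arr_setReg, reg_setArr, reg_setReg, arr_setArr, eα, eβ,
        hα, hβ, if_true, if_false, Nat.reduceEqDiff]
      exact ⟨fun h => ⟨by omega, by omega, hI.advance mβ hv h⟩,
        fun h => ⟨by omega, by omega, by omega, by omega, by omega, hI.visit mα mβ hv hw h⟩⟩
  refine Ensures.mono (B := 2 + (2 + (3 * N * ((colBody α β col).stepBound + 8) + 6)))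
    (Q := fun τ => ColInv M (σ.arr α) (σ.arr β) (3 * N) (τ.reg 11) (τ.reg 12) (τ.arr col))
    ?_ ?_ fun τ _ h => h.swaps hM mβ
  · refine Ensures.seq (Ensures.of_wp (Q := fun τ => τ = σ.setReg 11 0) ⟨by simp [eval], rfl⟩) ?_
    rintro _ _ rfl
    refine Ensures.seq (Ensures.of_wp (Q := fun τ => τ = (σ.setReg 11 0).setReg 12 0)
      ⟨by simp [eval], rfl⟩) ?_
    rintro _ _ rfl
    exact hfor
  · have : (colBody α β col).stepBound + 8 ≤ 40 := by simp [colBody, stepBound, cost]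
    have := Nat.mul_le_mul_left (3 * N) this
    omega

/-- Colour the elements `1` and `2` in such a way that, for either of the keys in the arrays `b` and
`b + 1`, both colours are equally frequent among the elements with the same key. -/
def splitProgram (b N I : ℕ) : RamProgram :=
  .seq (forLoop 10 N (pairBody b (b + 2) (b + 4)))
    (.seq (forLoop 10 N (pairBody (b + 1) (b + 3) (b + 5)))
      (.seq (.assign 11 (lit 0)) (.seq (.assign 12 (lit 0))
        (forLoop 10 I (colBody (b + 4) (b + 5) (b + 6))))))

/-- The two matings come with the colouring because `Swaps.count`, applied to either of them, yields
the halving of the fibres. Each call uses a fresh block of arrays, so that its working memory is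
zero. -/
theorem ensures_split {W b N I K : ℕ} {σ : RamState} (hN : N ≠ 10 ∧ N ≠ 11 ∧ N ≠ 12)
    (hI : I ≠ 10 ∧ I ≠ 11 ∧ I ≠ 12) (hNr : σ.reg N = 2 * K) (hIr : σ.reg I = 3 * K)
    (hK : 3 * K ≤ W) (h2 : 2 ≤ W) (hk : ∀ i < 2 * K, σ.arr b i ≤ W ∧ σ.arr (b + 1) i ≤ W)
    (h0 : ∀ a, b + 2 ≤ a → a ≤ b + 6 → σ.arr a = fun _ => 0)
    (he : ∀ j < 2 * K, Even (Nat.count (fun i => σ.arr b i = σ.arr b j) (2 * K)))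
    (he' : ∀ j < 2 * K, Even (Nat.count (fun i => σ.arr (b + 1) i = σ.arr (b + 1) j) (2 * K))) :
    Ensures W (splitProgram b N I) σ (K * 280 + 22) fun τ =>
      (∃ α, IsMating (2 * K) (σ.arr b) α ∧ Swaps (2 * K) α (τ.arr (b + 6))) ∧
      ∃ β, IsMating (2 * K) (σ.arr (b + 1)) β ∧ Swaps (2 * K) β (τ.arr (b + 6)) := by
  refine Ensures.mono (B := (2 * K * 40 + 6) + ((2 * K * 40 + 6) + (3 * K * 40 + 10)))
    (Ensures.seq (ensures_pair (by omega) (by omega) (by omega) ⟨hN.1, hN.2.1⟩ hNr (by omega)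
      (fun i hi => (hk i hi).1) (h0 _ (by omega) (by omega))) fun τ hF hτ => ?_)
    (by omega) fun _ _ h => h
  have f : ∀ a, a ≠ b + 2 → a ≠ b + 4 → τ.arr a = σ.arr a := fun a h1 h2 =>
    hF.arr a (by simp [forLoop, pairBody, writesArr, h1, h2])
  have g : ∀ x, x ≠ 10 → x ≠ 11 → τ.reg x = σ.reg x := fun x h1 h2 =>
    hF.reg x (by simp [forLoop, pairBody, writesReg, h1, h2])
  refine Ensures.seq (ensures_pair (M := 2 * K) (by omega) (by omega) (by omega) ⟨hN.1, hN.2.1⟩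
    (by rw [g N hN.1 hN.2.1, hNr]) (by omega)
    (fun i hi => by rw [f _ (by omega) (by omega)]; exact (hk i hi).2)
    (by rw [f _ (by omega) (by omega)]; exact h0 _ (by omega) (by omega))) fun υ hF' hυ => ?_
  have f' : ∀ a, a ≠ b + 3 → a ≠ b + 5 → υ.arr a = τ.arr a := fun a h1 h2 =>
    hF'.arr a (by simp [forLoop, pairBody, writesArr, h1, h2])
  have g' : ∀ x, x ≠ 10 → x ≠ 11 → υ.reg x = τ.reg x := fun x h1 h2 =>
    hF'.reg x (by simp [forLoop, pairBody, writesReg, h1, h2])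
  have mα := hτ.isMating he
  have mβ := hυ.isMating (by rw [f _ (by omega) (by omega)]; exact he')
  rw [f _ (by omega) (by omega)] at mβ
  rw [← f' _ (by omega) (by omega)] at mα
  refine Ensures.mono (ensures_col (M := 2 * K) (N := K) (by omega) (by omega) hI rfl
    (by rw [g' I hI.1 hI.2.1, g I hI.1 hI.2.1, hIr]) hK
    (by rw [f' _ (by omega) (by omega), f _ (by omega) (by omega)]
        exact h0 _ (by omega) (by omega)) mα mβ h2) le_rfl fun ω _ h => ?_
  exact ⟨⟨_, mα, h.1⟩, ⟨_, mβ, h.2⟩⟩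

/-- Traverse the cycles of the permutation in the array `b`. -/
def walkBody (b : ℕ) : RamProgram :=
  .branch (get (b + 3) (reg 12))
    (.seq (.store (b + 5) (reg 11) (add (reg 10) (lit 1)))
      (.seq (.assign 11 (add (reg 11) (lit 1))) (.assign 12 (reg 11))))
    (.seq (.store (b + 3) (reg 12) (add (reg 10) (lit 1)))
      (.seq (.store (b + 4) (reg 12) (reg 11)) (.assign 12 (get b (reg 12)))))

theorem ensures_walk {W b I n : ℕ} {σ : RamState} (hI : I ≠ 10 ∧ I ≠ 11 ∧ I ≠ 12)
    (hn : σ.reg I = 2 * n) (hW : 2 * n ≤ W) (hr : σ.arr (b + 3) = fun _ => 0)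
    (hπ : IsPerm n (σ.arr b)) :
    Ensures W (.seq (.assign 11 (lit 0)) (.seq (.assign 12 (lit 0))
        (forLoop 10 I (walkBody b)))) σ (n * 80 + 10)
      fun τ => IsWalk n (σ.arr b) (τ.arr (b + 3)) (τ.arr (b + 4)) (τ.arr (b + 5)) := by
  have hfor : Ensures W (forLoop 10 I (walkBody b)) ((σ.setReg 11 0).setReg 12 0)
      (2 * n * ((walkBody b).stepBound + 8) + 6)
      (fun τ => WalkInv n (σ.arr b) (2 * n) (τ.reg 11) (τ.reg 12) (τ.arr (b + 3))
        (τ.arr (b + 4)) (τ.arr (b + 5))) := by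
    refine Ensures.forLoop (fun k τ => WalkInv n (σ.arr b) k (τ.reg 11) (τ.reg 12) (τ.arr (b + 3))
        (τ.arr (b + 4)) (τ.arr (b + 5))) (by simp [reg_setReg, hI, hn]) hW ?_ ?_ ?_ ?_
    · simp [forLoop, walkBody, writesReg, hI]
    · simp [walkBody, writesReg]
    · simp only [arr_setReg, reg_setReg, hr]
      exact .init _ _ _ _
    · intro k hk τ hx hF hI
      have e : τ.arr b = σ.arr b := hF.arr b (by simp [forLoop, walkBody, writesArr])
      obtain ⟨hv, hw⟩ := hI.lt hπ hk
      have b1 := hπ.lt _ hw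
      have d0 : b ≠ b + 3 := by omega
      have d1 : b ≠ b + 4 := by omega
      simp only [walkBody, Wp, RamExpr.eval, arr_setReg, reg_setArr, reg_setReg, arr_setArr, e,
        d0, d1, if_true, if_false, Nat.reduceEqDiff, Nat.add_left_cancel_iff, hx]
      exact ⟨fun h => ⟨by omega, by omega, by omega, by omega, hI.advance hπ hv hw h⟩,
        fun h => ⟨by omega, by omega, by omega, by omega, by omega, hI.visit hv hw h⟩⟩
  refine Ensures.mono (B := 2 + (2 + (2 * n * ((walkBody b).stepBound + 8) + 6)))
    (Q := fun τ => WalkInv n (σ.arr b) (2 * n) (τ.reg 11) (τ.reg 12) (τ.arr (b + 3))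
        (τ.arr (b + 4)) (τ.arr (b + 5))) ?_ ?_ fun τ _ h => h.isWalk
  · refine Ensures.seq (Ensures.of_wp (Q := fun τ => τ = σ.setReg 11 0) ⟨by simp [eval], rfl⟩) ?_
    rintro _ _ rfl
    refine Ensures.seq (Ensures.of_wp (Q := fun τ => τ = (σ.setReg 11 0).setReg 12 0)
      ⟨by simp [eval], rfl⟩) ?_
    rintro _ _ rfl
    exact hfor
  · have : (walkBody b).stepBound + 8 ≤ 40 := by simp [walkBody, stepBound, cost]
    have := Nat.mul_le_mul_left (2 * n) this
    omega

/-- An expression that does not vanish if and only if the values of `e` and `f` are different. -/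
def diff (e f : RamExpr) : RamExpr := add (sub e f) (sub f e)

theorem eval_diff (σ : RamState) (e f : RamExpr) : (diff e f).eval σ = 0 ↔ e.eval σ = f.eval σ := by
  simp only [diff, eval]; omega

/-- Put the roots of the cycles at the right ends of these. -/
def slotBody (b : ℕ) : RamProgram :=
  .seq (.store (b + 6) (reg 10) (get (b + 3) (reg 10)))
    (.branch (diff (get (b + 4) (reg 10)) (reg 10)) .skip
      (.seq (.assign 11 (get (b + 1) (reg 10)))
        (.branch (diff (get (b + 4) (reg 11)) (reg 10))
          (.branch (sub (get (b + 3) (reg 10)) (get (b + 3) (reg 11))) .skip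
            (.store (b + 6) (reg 10) (get (b + 5) (reg 10))))
          (.branch (sub (get (b + 3) (get (b + 1) (reg 11))) (get (b + 3) (reg 11))) .skip
            (.store (b + 6) (reg 10) (get (b + 5) (reg 10)))))))

theorem _root_.IsSlot.update {i a : ℕ} {ρ r root fin X : ℕ → ℕ} (h : IsSlot i ρ r root fin X)
    (h1 : root i = i → IsLast ρ r root i → a = fin i)
    (h2 : (root i = i → ¬ IsLast ρ r root i) → a = r i) :
    IsSlot (i + 1) ρ r root fin (Function.update X i a) := by
  refine ⟨fun v hv => ?_, fun v hv => ?_, fun v hv => ?_⟩ <;> by_cases hvi : v = i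
  · subst hvi; rw [Function.update_self]; exact h1
  · rw [Function.update_of_ne hvi]; exact h.last v (by omega)
  · subst hvi; rw [Function.update_self]; exact fun _ h3 => h2 fun _ => h3
  · rw [Function.update_of_ne hvi]; exact h.first v (by omega)
  · subst hvi; rw [Function.update_self]; exact fun h3 => h2 fun h4 => absurd h4 h3
  · rw [Function.update_of_ne hvi]; exact h.other v (by omega)

theorem ensures_slot {W b I n : ℕ} {π : ℕ → ℕ} {σ : RamState} (hI : I ≠ 10 ∧ I ≠ 11)
    (hn : σ.reg I = n) (hW : 2 * n ≤ W) (hρ : IsPerm n (σ.arr (b + 1)))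
    (hw : IsWalk n π (σ.arr (b + 3)) (σ.arr (b + 4)) (σ.arr (b + 5))) :
    Ensures W (forLoop 10 I (slotBody b)) σ (n * 60 + 6)
      fun τ => IsSlot n (σ.arr (b + 1)) (σ.arr (b + 3)) (σ.arr (b + 4)) (σ.arr (b + 5))
        (τ.arr (b + 6)) := by
  refine Ensures.mono (Ensures.forLoop (fun i τ => IsSlot i (σ.arr (b + 1)) (σ.arr (b + 3))
    (σ.arr (b + 4)) (σ.arr (b + 5)) (τ.arr (b + 6))) hn (by omega) ?_ ?_ ?_ ?_) ?_ fun _ _ h => h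
  · simp [forLoop, slotBody, writesReg, hI]
  · simp [slotBody, writesReg]
  · exact ⟨fun _ h => by omega, fun _ h => by omega, fun _ h => by omega⟩
  · intro i hi τ hx hF hI
    have e1 : τ.arr (b + 1) = σ.arr (b + 1) := hF.arr _ (by simp [forLoop, slotBody, writesArr])
    have e3 : τ.arr (b + 3) = σ.arr (b + 3) := hF.arr _ (by simp [forLoop, slotBody, writesArr])
    have e4 : τ.arr (b + 4) = σ.arr (b + 4) := hF.arr _ (by simp [forLoop, slotBody, writesArr])
    have e5 : τ.arr (b + 5) = σ.arr (b + 5) := hF.arr _ (by simp [forLoop, slotBody, writesArr])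
    have ht := hρ.lt i hi
    have hs := hρ.lt _ ht
    have bi : σ.arr (b + 3) i ≤ W := by
      have := hw.lt_fin i hi; have := hw.fin_le i hi; omega
    have bf : σ.arr (b + 4) i = i → σ.arr (b + 5) i ≤ W := fun h => by
      have := hw.fin_le i hi; rw [h] at this; omega
    simp only [slotBody, Wp, eval_diff, ne_eq, RamExpr.eval, arr_setReg, reg_setArr, reg_setReg,
      arr_setArr, e1, e3, e4, e5, if_true, if_false, Nat.reduceEqDiff, Nat.add_left_cancel_iff, hx,
      Function.update_idem]
    refine ⟨by omega, bi, fun h => hI.update (fun h' => absurd h' h) fun _ => rfl,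
      fun h => ⟨by omega, fun h1 => ⟨fun h2 => ?_, fun h2 => ⟨by omega, bf h, ?_⟩⟩,
        fun h1 => ⟨fun h2 => ?_, fun h2 => ⟨by omega, bf h, ?_⟩⟩⟩⟩
    · refine hI.update (fun _ h3 => ?_) fun _ => rfl
      unfold IsLast at h3; rw [if_neg h1] at h3; omega
    · refine hI.update (fun _ _ => rfl) fun h3 => ?_
      refine absurd ?_ (h3 h)
      unfold IsLast; rw [if_neg h1]; omega
    · refine hI.update (fun _ h3 => ?_) fun _ => rfl
      unfold IsLast at h3; rw [if_pos h1] at h3; omega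
    · refine hI.update (fun _ _ => rfl) fun h3 => ?_
      refine absurd ?_ (h3 h)
      unfold IsLast; rw [if_pos h1]; omega
  · refine Nat.add_le_add_right (Nat.mul_le_mul_left _ ?_) _
    simp [slotBody, stepBound, cost, diff]

end RamProgram

/-! ### Counting -/

theorem Nat.eq_of_count_eq_one {p : ℕ → Prop} [DecidablePred p] {i j N : ℕ}
    (h : Nat.count p N = 1) (hi : i < N) (hj : j < N) (pi : p i) (pj : p j) : i = j := by
  rw [Nat.count_eq_card_filter_range, Finset.card_eq_one] at h
  obtain ⟨a, ha⟩ := h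
  have h1 : i ∈ ({a} : Finset ℕ) := by rw [← ha]; simp [hi, pi]
  have h2 : j ∈ ({a} : Finset ℕ) := by rw [← ha]; simp [hj, pj]
  rw [Finset.mem_singleton] at h1 h2
  rw [h1, h2]

theorem Nat.exists_of_count_pos {p : ℕ → Prop} [DecidablePred p] {N : ℕ}
    (h : 0 < Nat.count p N) : ∃ i < N, p i := by
  rw [Nat.count_eq_card_filter_range, Finset.card_pos] at h
  obtain ⟨i, hi⟩ := h
  simp at hi
  exact ⟨i, hi⟩

theorem Nat.count_congr {p q : ℕ → Prop} [DecidablePred p] [DecidablePred q] {N : ℕ}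
    (h : ∀ i < N, p i ↔ q i) : Nat.count p N = Nat.count q N := by
  rw [Nat.count_eq_card_filter_range, Nat.count_eq_card_filter_range]
  congr 1
  ext i
  simp only [Finset.mem_filter, Finset.mem_range]
  constructor <;> rintro ⟨h1, h2⟩
  · exact ⟨h1, (h i h1).1 h2⟩
  · exact ⟨h1, (h i h1).2 h2⟩

theorem sum_count_eq {n h : ℕ} {a : ℕ → ℕ} (ha : ∀ j < h, a j < n) :
    ∑ x ∈ Finset.range n, Nat.count (fun j => a j = x) h = h := by
  have := Finset.card_eq_sum_card_fiberwise (s := Finset.range h) (t := Finset.range n) (f := a)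
    (by intro j hj; simp at hj ⊢; exact ha j hj)
  rw [Finset.card_range] at this
  conv_rhs => rw [this]
  exact Finset.sum_congr rfl fun x _ => Nat.count_eq_card_filter_range _ _

/-! ### Completing the list of the half-edges -/

/-- The vertex of the half-edge `h`, if `a` and `b` list the ends of the edges. -/
def halfVertex (a b : ℕ → ℕ) (h : ℕ) : ℕ := if h % 2 = 0 then a (h / 2) else b (h / 2)

/-- The state of the completion of the list `vt` of the half-edges of `m` edges after `k` steps: `h`
is the next half-edge, `v` the current vertex, and `cnt` counts the half-edges at the vertices. -/
structure FillInv (n m : ℕ) (a b : ℕ → ℕ) (k h v : ℕ) (vt cnt : ℕ → ℕ) : Prop where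
  sum : h + v = 2 * m + k
  ge : 2 * m ≤ h
  le : v ≤ n
  full : ∀ x < v, cnt x = 8
  cnt_eq : ∀ x < n, cnt x = Nat.count (fun j => vt j = x) h
  cnt_le : ∀ x < n, cnt x ≤ 8
  lt : ∀ j < h, vt j < n
  old : ∀ j < 2 * m, vt j = halfVertex a b j

namespace FillInv

variable {n m k h v : ℕ} {a b vt cnt : ℕ → ℕ}

theorem le_eight (H : FillInv n m a b k h v vt cnt) : h ≤ 8 * n := by
  have h1 := sum_count_eq H.lt
  have h2 : ∑ x ∈ Finset.range n, Nat.count (fun j => vt j = x) h ≤ ∑ x ∈ Finset.range n, 8 :=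
    Finset.sum_le_sum fun x hx => by
      rw [← H.cnt_eq x (Finset.mem_range.1 hx)]; exact H.cnt_le x (Finset.mem_range.1 hx)
  simp at h2
  omega

/-- If all vertices were full, there would be `8 * n` half-edges, and `sum` would give `k + 2 * m =
9 * n`. -/
theorem v_lt (H : FillInv n m a b k h v vt cnt) (hk : k + 2 * m < 9 * n) : v < n := by
  by_contra hv
  have hv : v = n := by have := H.le; omega
  have h1 := sum_count_eq H.lt
  have h2 : ∑ x ∈ Finset.range n, Nat.count (fun j => vt j = x) h = ∑ x ∈ Finset.range n, 8 :=
    Finset.sum_congr rfl fun x hx => by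
      rw [← H.cnt_eq x (Finset.mem_range.1 hx), H.full x (by have := Finset.mem_range.1 hx; omega)]
  simp at h2
  have := H.sum
  omega

theorem add (H : FillInv n m a b k h v vt cnt) (hv : v < n) (h8 : cnt v < 8) :
    FillInv n m a b (k + 1) (h + 1) v (Function.update vt h v)
      (Function.update cnt v (cnt v + 1)) := by
  have hge := H.ge
  refine ⟨by have := H.sum; omega, by omega, H.le, fun x hx => ?_, fun x hx => ?_, fun x hx => ?_,
    fun j hj => ?_, fun j hj => ?_⟩
  · rw [Function.update_of_ne (by omega)]; exact H.full x hx
  · rw [Nat.count_succ, Function.update_self, Nat.count_congr (q := fun j => vt j = x)]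
    · by_cases hxv : x = v
      · subst hxv; rw [Function.update_self, H.cnt_eq x hx]; simp
      · rw [Function.update_of_ne hxv, H.cnt_eq x hx, if_neg (Ne.symm hxv)]
        rfl
    · intro j hj
      rw [Function.update_of_ne (by omega)]
  · by_cases hxv : x = v
    · subst hxv; rw [Function.update_self]; omega
    · rw [Function.update_of_ne hxv]; exact H.cnt_le x hx
  · by_cases hjh : j = h
    · subst hjh; rw [Function.update_self]; exact hv
    · rw [Function.update_of_ne hjh]; exact H.lt j (by omega)
  · rw [Function.update_of_ne (by omega)]; exact H.old j hj

theorem advance (H : FillInv n m a b k h v vt cnt) (hv : v < n) (h8 : ¬ cnt v < 8) :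
    FillInv n m a b (k + 1) h (v + 1) vt cnt := by
  refine ⟨by have := H.sum; omega, H.ge, hv, fun x hx => ?_, H.cnt_eq, H.cnt_le, H.lt, H.old⟩
  rcases Nat.lt_succ_iff_lt_or_eq.1 hx with hx | rfl
  · exact H.full x hx
  · have := H.cnt_le x hv; omega

end FillInv

/-- Every vertex has eight half-edges, among which are those of the edges listed by `a` and `b`. -/
structure IsHalves (n m : ℕ) (a b vt : ℕ → ℕ) : Prop where
  lt : ∀ j < 8 * n, vt j < n
  count : ∀ x < n, Nat.count (fun j => vt j = x) (8 * n) = 8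
  fst : ∀ i < m, vt (2 * i) = a i
  snd : ∀ i < m, vt (2 * i + 1) = b i
  le : m ≤ 4 * n

/-- Here `h + v = 9 * n`, while `h` is at most `8 * n` and `v` at most `n`; so both bounds are
attained. -/
theorem FillInv.isHalves {n m k h v : ℕ} {a b vt cnt : ℕ → ℕ}
    (H : FillInv n m a b k h v vt cnt) (hk : k + 2 * m = 9 * n) : IsHalves n m a b vt := by
  have h1 := H.le_eight
  have h2 := H.sum
  have h3 := H.le
  have h4 := H.ge
  obtain rfl : h = 8 * n := by omega
  obtain rfl : v = n := by omega
  refine ⟨H.lt, fun x hx => by rw [← H.cnt_eq x hx, H.full x hx], fun i hi => ?_, fun i hi => ?_,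
    by omega⟩
  · rw [H.old _ (by omega), halfVertex, if_pos (by omega)]; congr 1; omega
  · rw [H.old _ (by omega), halfVertex, if_neg (by omega)]; congr 1; omega

/-! ### Orienting the edges -/

/-- The edges are directed from the vertex of the half-edge of colour `1` to that of the half-edge
of colour `2`. -/
structure IsOrientation (N : ℕ) (vt col tl hd : ℕ → ℕ) : Prop where
  one : ∀ i < N, col (2 * i) = 1 → tl i = vt (2 * i) ∧ hd i = vt (2 * i + 1)
  two : ∀ i < N, col (2 * i) ≠ 1 → tl i = vt (2 * i + 1) ∧ hd i = vt (2 * i)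

/-- A fibre of `h / 2` consists of the two halves of one edge, so these are mates. -/
theorem Swaps.half {N : ℕ} {k α col : ℕ → ℕ} (hs : Swaps (2 * N) α col)
    (hα : IsMating (2 * N) k α) (hk : ∀ h < 2 * N, k h = h / 2) {i : ℕ} (hi : i < N) :
    (col (2 * i) = 1 ∧ col (2 * i + 1) = 2) ∨ (col (2 * i) = 2 ∧ col (2 * i + 1) = 1) := by
  have h0 : 2 * i < 2 * N := by omega
  have h1 := hα.key _ h0
  have h2 := hα.ne _ h0
  have h3 := hα.lt _ h0
  rw [hk _ h3, hk _ h0] at h1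
  have h4 : α (2 * i) = 2 * i + 1 := by omega
  have := hs _ h0
  rwa [h4] at this

/-- Each edge contributes one half-edge of colour 1, at its tail, and one of colour 2, at its head.
-/
theorem IsOrientation.count {N : ℕ} {k α vt col tl hd : ℕ → ℕ}
    (ho : IsOrientation N vt col tl hd) (hs : Swaps (2 * N) α col)
    (hα : IsMating (2 * N) k α) (hk : ∀ h < 2 * N, k h = h / 2) (x : ℕ) :
    Nat.count (fun i => tl i = x) N = Nat.count (fun h => vt h = x ∧ col h = 1) (2 * N) ∧
    Nat.count (fun i => hd i = x) N = Nat.count (fun h => vt h = x ∧ col h = 2) (2 * N) := by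
  have key : ∀ K ≤ N,
      Nat.count (fun i => tl i = x) K = Nat.count (fun h => vt h = x ∧ col h = 1) (2 * K) ∧
      Nat.count (fun i => hd i = x) K = Nat.count (fun h => vt h = x ∧ col h = 2) (2 * K) := by
    intro K
    induction K with
    | zero => simp
    | succ K ih =>
      intro hK
      obtain ⟨h1, h2⟩ := ih (by omega)
      rw [show 2 * (K + 1) = 2 * K + 1 + 1 by ring]
      simp only [Nat.count_succ, h1, h2]
      rcases hs.half hα hk (i := K) (by omega) with ⟨e1, e2⟩ | ⟨e1, e2⟩
      · obtain ⟨e3, e4⟩ := ho.one K (by omega) e1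
        simp [e1, e2, e3, e4]
      · obtain ⟨e3, e4⟩ := ho.two K (by omega) (by omega)
        simp [e1, e2, e3, e4]
  exact key N le_rfl

/-! ### Four permutations -/

/-- The edges below `4 * n` from `tl` to `hd` fall into four classes, according to the colours
`c₂` and `c₃`, and every vertex is the tail of one edge and the head of one edge of each class. -/
structure IsFactoring (n : ℕ) (tl hd c₂ c₃ : ℕ → ℕ) : Prop where
  lt : ∀ i < 4 * n, tl i < n ∧ hd i < n
  col₂ : ∀ i < 4 * n, c₂ i = 1 ∨ c₂ i = 2
  col₃ : ∀ i < 4 * n, c₃ i = 1 ∨ c₃ i = 2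
  tail : ∀ x < n, ∀ p q, (p = 1 ∨ p = 2) → (q = 1 ∨ q = 2) →
    Nat.count (fun i => tl i = x ∧ c₂ i = p ∧ c₃ i = q) (4 * n) = 1
  head : ∀ x < n, ∀ p q, (p = 1 ∨ p = 2) → (q = 1 ∨ q = 2) →
    Nat.count (fun i => hd i = x ∧ c₂ i = p ∧ c₃ i = q) (4 * n) = 1

theorem Swaps.col {M : ℕ} {α col : ℕ → ℕ} (h : Swaps M α col) {j : ℕ} (hj : j < M) :
    col j = 1 ∨ col j = 2 := by
  rcases h j hj with h | h
  · exact .inl h.1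
  · exact .inr h.1

/-- The key that combines a vertex with a colour. -/
def IsColKey (n N : ℕ) (v col k : ℕ → ℕ) : Prop :=
  ∀ i < N, k i = if col i = 1 then v i else v i + n

/-- As vertices are less than `n`, the shift by `n` separates the colours. The predicate `r` leaves
room for the next colour. -/
theorem IsColKey.count {n N : ℕ} {v col k : ℕ → ℕ} (h : IsColKey n N v col k)
    (hv : ∀ i < N, v i < n) (hc : ∀ i < N, col i = 1 ∨ col i = 2) {x p : ℕ} (hx : x < n)
    (hp : p = 1 ∨ p = 2) (r : ℕ → Prop) [DecidablePred r] :
    Nat.count (fun i => k i = (if p = 1 then x else x + n) ∧ r i) N =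
      Nat.count (fun i => v i = x ∧ col i = p ∧ r i) N := by
  refine Nat.count_congr fun i hi => ?_
  have h1 := h i hi
  have h2 := hv i hi
  rw [← and_assoc]
  refine and_congr_left fun _ => ?_
  rcases hc i hi with h3 | h3 <;> rcases hp with rfl | rfl <;> simp [h3] at h1 ⊢ <;> omega

theorem IsColKey.even {n N : ℕ} {v col k : ℕ → ℕ} (h : IsColKey n N v col k)
    (hv : ∀ i < N, v i < n) (hc : ∀ i < N, col i = 1 ∨ col i = 2)
    (h2 : ∀ x < n, ∀ p, (p = 1 ∨ p = 2) → Nat.count (fun i => v i = x ∧ col i = p) N = 2) :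
    ∀ j < N, Even (Nat.count (fun i => k i = k j) N) := by
  intro j hj
  have h3 := h.count hv hc (hv j hj) (hc j hj) (fun _ => True)
  simp only [and_true] at h3
  rw [← h j hj] at h3
  rw [h3, h2 _ (hv j hj) _ (hc j hj)]
  decide

/-- The fibres of the combined key have two elements, and the new colouring halves them. -/
theorem IsColKey.count_one {n N : ℕ} {v col k α col' : ℕ → ℕ} (h : IsColKey n N v col k)
    (hv : ∀ i < N, v i < n) (hc : ∀ i < N, col i = 1 ∨ col i = 2)
    (h2 : ∀ x < n, ∀ p, (p = 1 ∨ p = 2) → Nat.count (fun i => v i = x ∧ col i = p) N = 2)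
    (hs : Swaps N α col') (hα : IsMating N k α) {x p q : ℕ} (hx : x < n) (hp : p = 1 ∨ p = 2)
    (hq : q = 1 ∨ q = 2) :
    Nat.count (fun i => v i = x ∧ col i = p ∧ col' i = q) N = 1 := by
  have h3 := h.count hv hc hx hp (fun i => col' i = q)
  have h4 := h.count hv hc hx hp (fun _ => True)
  simp only [and_true] at h4
  have h5 := hs.count hα (if p = 1 then x else x + n) hq
  have h6 := h2 x hx p hp
  omega

/-- The array `π` holds the permutation that belongs to the class with the colours `p`, `q`. -/
def IsClassMap (N : ℕ) (tl hd c₂ c₃ : ℕ → ℕ) (p q : ℕ) (π : ℕ → ℕ) : Prop :=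
  ∀ i < N, c₂ i = p → c₃ i = q → π (tl i) = hd i

/-- Every vertex is the tail of an edge of the class, so its image is the head of that edge; it is
injective as every vertex is the head of only one. -/
theorem IsClassMap.isPerm {n : ℕ} {tl hd c₂ c₃ π : ℕ → ℕ} {p q : ℕ}
    (h : IsClassMap (4 * n) tl hd c₂ c₃ p q π) (hf : IsFactoring n tl hd c₂ c₃)
    (hp : p = 1 ∨ p = 2) (hq : q = 1 ∨ q = 2) : IsPerm n π := by
  have key : ∀ x < n, ∃ i < 4 * n, tl i = x ∧ c₂ i = p ∧ c₃ i = q := fun x hx =>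
    Nat.exists_of_count_pos (by rw [hf.tail x hx p q hp hq]; omega)
  refine ⟨fun x hx => ?_, fun x hx y hy hxy => ?_⟩
  · obtain ⟨i, hi, rfl, h2, h3⟩ := key x hx
    rw [h i hi h2 h3]; exact (hf.lt i hi).2
  · obtain ⟨i, hi, rfl, h2, h3⟩ := key x hx
    obtain ⟨j, hj, rfl, h5, h6⟩ := key y hy
    rw [h i hi h2 h3, h j hj h5 h6] at hxy
    rw [Nat.eq_of_count_eq_one (hf.head _ (hf.lt i hi).2 p q hp hq) hi hj ⟨rfl, h2, h3⟩
      ⟨hxy.symm, h5, h6⟩]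

theorem IsClassMap.update {n k : ℕ} {tl hd c₂ c₃ π : ℕ → ℕ} {p q : ℕ}
    (h : IsClassMap k tl hd c₂ c₃ p q π) (hf : IsFactoring n tl hd c₂ c₃) (hk : k < 4 * n)
    (hp : p = 1 ∨ p = 2) (hq : q = 1 ∨ q = 2) (h₂ : c₂ k = p) (h₃ : c₃ k = q) :
    IsClassMap (k + 1) tl hd c₂ c₃ p q (Function.update π (tl k) (hd k)) := by
  intro i hi e₂ e₃
  by_cases hik : i = k
  · subst hik; rw [Function.update_self]
  · have : tl i ≠ tl k := fun he => hik (Nat.eq_of_count_eq_one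
      (hf.tail _ (hf.lt k hk).1 p q hp hq) (by omega) hk ⟨he, e₂, e₃⟩ ⟨rfl, h₂, h₃⟩)
    rw [Function.update_of_ne this]
    exact h i (by omega) e₂ e₃

theorem IsClassMap.skip {k : ℕ} {tl hd c₂ c₃ π : ℕ → ℕ} {p q : ℕ}
    (h : IsClassMap k tl hd c₂ c₃ p q π) (hk : c₂ k ≠ p ∨ c₃ k ≠ q) :
    IsClassMap (k + 1) tl hd c₂ c₃ p q π := by
  intro i hi e₂ e₃
  refine h i ?_ e₂ e₃
  have : i ≠ k := by rintro rfl; tauto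
  omega

/-! ### Programs for the half-edges, the directions and the permutations -/

namespace RamProgram

open RamExpr

/-- The edges of the half-edges. -/
def halfKeyBody : RamProgram :=
  .seq (.store 20 (add (reg 10) (reg 10)) (reg 10))
    (.store 20 (add (add (reg 10) (reg 10)) (lit 1)) (reg 10))

theorem ensures_halfKey {W N : ℕ} {σ : RamState} (hN : σ.reg 2 = N) (hW : 2 * N ≤ W) :
    Ensures W (forLoop 10 2 halfKeyBody) σ (N * 40 + 6) fun τ => ∀ h < 2 * N, τ.arr 20 h = h / 2 := by
  refine Ensures.mono (Ensures.forLoop (fun k τ => ∀ h < 2 * k, τ.arr 20 h = h / 2) hN (by omega)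
    (by decide) (by decide) (by simp) ?_) ?_ fun _ _ h => h
  · intro k hk τ hx hF hI
    simp only [halfKeyBody, Wp, RamExpr.eval, arr_setReg, reg_setArr, arr_setArr, hx, if_true]
    refine ⟨by omega, by omega, by omega, by omega, fun h hh => ?_⟩
    by_cases h1 : h = k + k + 1
    · rw [h1, Function.update_self]; omega
    rw [Function.update_of_ne h1]
    by_cases h2 : h = k + k
    · rw [h2, Function.update_self]; omega
    rw [Function.update_of_ne h2]
    exact hI h (by omega)
  · refine Nat.add_le_add_right (Nat.mul_le_mul_left _ ?_) _
    decide

/-- The vertices of the half-edges, and the degrees of the vertices. -/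
def halfBody : RamProgram :=
  .seq (.store 21 (add (reg 10) (reg 10)) (get 0 (reg 10)))
    (.seq (.store 21 (add (add (reg 10) (reg 10)) (lit 1)) (get 1 (reg 10)))
      (.seq (.store 9 (get 0 (reg 10)) (add (get 9 (get 0 (reg 10))) (lit 1)))
        (.store 9 (get 1 (reg 10)) (add (get 9 (get 1 (reg 10))) (lit 1)))))

theorem ensures_half {W m : ℕ} {σ : RamState} (hm : σ.reg 1 = m) (hW : 2 * m + 1 ≤ W)
    (ha : ∀ i < m, σ.arr 0 i ≤ W ∧ σ.arr 1 i ≤ W) (h9 : σ.arr 9 = fun _ => 0) :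
    Ensures W (forLoop 10 1 halfBody) σ (m * 60 + 6) fun τ =>
      (∀ j < 2 * m, τ.arr 21 j = halfVertex (σ.arr 0) (σ.arr 1) j) ∧
      ∀ x, τ.arr 9 x = Nat.count (fun j => halfVertex (σ.arr 0) (σ.arr 1) j = x) (2 * m) := by
  refine Ensures.mono (Ensures.forLoop (fun k τ =>
      (∀ j < 2 * k, τ.arr 21 j = halfVertex (σ.arr 0) (σ.arr 1) j) ∧
      ∀ x, τ.arr 9 x = Nat.count (fun j => halfVertex (σ.arr 0) (σ.arr 1) j = x) (2 * k)) hm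
    (by omega) (by decide) (by decide) (by simp [arr_setReg, h9]) ?_) ?_ fun _ _ h => h
  · intro k hk τ hx hF hI
    have e0 : τ.arr 0 = σ.arr 0 := hF.arr 0 (by decide)
    have e1 : τ.arr 1 = σ.arr 1 := hF.arr 1 (by decide)
    have v0 : halfVertex (σ.arr 0) (σ.arr 1) (2 * k) = σ.arr 0 k := by
      rw [halfVertex, if_pos (by omega)]; congr 1; omega
    have v1 : halfVertex (σ.arr 0) (σ.arr 1) (2 * k + 1) = σ.arr 1 k := by
      rw [halfVertex, if_neg (by omega)]; congr 1; omega
    have hc : ∀ x, τ.arr 9 x ≤ 2 * k := fun x => by rw [hI.2 x]; exact Nat.count_le _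
    have c0 := hc (σ.arr 0 k)
    have c1 := hc (σ.arr 1 k)
    have := ha k hk
    simp only [halfBody, Wp, RamExpr.eval, arr_setReg, reg_setArr, arr_setArr, hx, if_true, e0, e1,
      Nat.reduceEqDiff, if_false]
    refine ⟨by omega, by omega, by omega, by omega, by omega, by omega, by omega, ?_,
      fun h hh => ?_, fun x => ?_⟩
    · rw [Function.update_apply]; split_ifs <;> omega
    · by_cases h1 : h = k + k + 1
      · rw [h1, Function.update_self, ← two_mul, v1]
      rw [Function.update_of_ne h1]
      by_cases h2 : h = k + k
      · rw [h2, Function.update_self, ← two_mul, v0]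
      rw [Function.update_of_ne h2]
      exact hI.1 h (by omega)
    · rw [show 2 * (k + 1) = 2 * k + 1 + 1 by ring, Nat.count_succ, Nat.count_succ, v0, v1]
      have := hI.2 x
      simp only [Function.update_apply]
      by_cases h1 : σ.arr 1 k = x <;> by_cases h2 : σ.arr 0 k = x
      · subst h1; simp [h2, this]
      · subst h1; simp [Ne.symm h2, h2, this]
      · subst h2; simp [Ne.symm h1, h1, this]
      · simp [Ne.symm h1, h1, Ne.symm h2, h2, this]
  · refine Nat.add_le_add_right (Nat.mul_le_mul_left _ ?_) _
    decide

/-- Add half-edges at the current vertex as long as there are less than eight. -/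
def fillBody : RamProgram :=
  .branch (sub (lit 8) (get 9 (reg 12)))
    (.seq (.store 21 (reg 11) (reg 12))
      (.seq (.store 9 (reg 12) (add (get 9 (reg 12)) (lit 1)))
        (.assign 11 (add (reg 11) (lit 1)))))
    (.assign 12 (add (reg 12) (lit 1)))

/-- The iterations are the `8 * n - 2 * m` missing half-edges and the `n` moves to the next vertex.
-/
theorem ensures_fill {W n m K : ℕ} {a b : ℕ → ℕ} {σ : RamState} (hK : σ.reg 4 = K)
    (hKn : K + 2 * m = 9 * n) (hW : 9 * n + 8 ≤ W)
    (h : FillInv n m a b 0 (σ.reg 11) (σ.reg 12) (σ.arr 21) (σ.arr 9)) :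
    Ensures W (forLoop 10 4 fillBody) σ (K * 60 + 6) fun τ => IsHalves n m a b (τ.arr 21) := by
  refine Ensures.mono (Ensures.forLoop (fun k τ =>
      FillInv n m a b k (τ.reg 11) (τ.reg 12) (τ.arr 21) (τ.arr 9)) hK
    (by omega) (by decide) (by decide) (by simpa [arr_setReg, reg_setReg] using h) ?_) ?_
    fun _ _ h => h.isHalves hKn
  · intro k hk τ hx hF hI
    have hv := hI.v_lt (by omega)
    have hc := hI.cnt_le _ hv
    have hh := hI.le_eight
    simp only [fillBody, Wp, RamExpr.eval, arr_setReg, reg_setArr, reg_setReg, arr_setArr, if_true,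
      Nat.reduceEqDiff, if_false]
    exact ⟨fun h => ⟨by omega, by omega, by omega, by omega, by omega, hI.add hv (by omega)⟩,
      fun h => ⟨by omega, hI.advance hv (by omega)⟩⟩
  · refine Nat.add_le_add_right (Nat.mul_le_mul_left _ ?_) _
    decide

def halvesProgram : RamProgram :=
  .seq (forLoop 10 2 halfKeyBody) (.seq (forLoop 10 1 halfBody)
    (.seq (.assign 11 (add (reg 1) (reg 1))) (.seq (.assign 12 (lit 0)) (forLoop 10 4 fillBody))))

theorem ensures_halves {W n m : ℕ} {σ : RamState} (h1 : σ.reg 1 = m) (h2 : σ.reg 2 = 4 * n)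
    (h4 : σ.reg 4 = 9 * n - 2 * m) (hW : 9 * n + 8 ≤ W)
    (ha : ∀ i < m, σ.arr 0 i < n ∧ σ.arr 1 i < n) (h9 : σ.arr 9 = fun _ => 0)
    (hdeg : ∀ x < n, Nat.count (fun j => halfVertex (σ.arr 0) (σ.arr 1) j = x) (2 * m) ≤ 8) :
    Ensures W halvesProgram σ (1000 * n + 30) fun τ =>
      (∀ h < 2 * (4 * n), τ.arr 20 h = h / 2) ∧
        IsHalves n m (σ.arr 0) (σ.arr 1) (τ.arr 21) := by
  have hlt : ∀ j < 2 * m, halfVertex (σ.arr 0) (σ.arr 1) j < n := fun j hj => by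
    unfold halfVertex
    split_ifs
    · exact (ha _ (by omega)).1
    · exact (ha _ (by omega)).2
  -- By the degree bound; it makes the truncated subtraction `9 * n - 2 * m` exact.
  have hm : 2 * m ≤ 8 * n := by
    have e1 := sum_count_eq hlt
    have e2 : ∑ x ∈ Finset.range n,
        Nat.count (fun j => halfVertex (σ.arr 0) (σ.arr 1) j = x) (2 * m) ≤
        ∑ x ∈ Finset.range n, 8 :=
      Finset.sum_le_sum fun x hx => hdeg x (Finset.mem_range.1 hx)
    simp at e2
    omega
  refine Ensures.mono (B := (4 * n * 40 + 6) + ((m * 60 + 6) + (4 + (2 + ((9 * n - 2 * m) * 60 + 6)))))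
    (Ensures.seq (ensures_halfKey h2 (by omega)) fun τ hF hτ => ?_) (by omega) fun _ _ h => h
  have r : ∀ x, x ≠ 10 → τ.reg x = σ.reg x := fun x hx =>
    hF.reg x (by simp [forLoop, halfKeyBody, writesReg, hx])
  have s : ∀ a, a ≠ 20 → τ.arr a = σ.arr a := fun a hx =>
    hF.arr a (by simp [forLoop, halfKeyBody, writesArr, hx])
  refine Ensures.seq (ensures_half (m := m) (by rw [r 1 (by omega), h1]) (by omega) ?_ ?_)
    fun υ hF' hυ => ?_
  · intro i hi
    rw [s 0 (by omega), s 1 (by omega)]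
    have := ha i hi
    omega
  · rw [s 9 (by omega), h9]
  have r' : ∀ x, x ≠ 10 → υ.reg x = σ.reg x := fun x hx => by
    rw [hF'.reg x (by simp [forLoop, halfBody, writesReg, hx]), r x hx]
  have s' : υ.arr 20 = τ.arr 20 := hF'.arr 20 (by decide)
  rw [s 0 (by omega), s 1 (by omega)] at hυ
  refine Ensures.seq (Ensures.of_wp (Q := fun ω => ω = υ.setReg 11 (2 * m)) ?_) ?_
  · simp only [Wp, RamExpr.eval, r' 1 (by omega), h1]
    exact ⟨by omega, by rw [two_mul]⟩
  rintro _ _ rfl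
  refine Ensures.seq (Ensures.of_wp (Q := fun ω => ω = (υ.setReg 11 (2 * m)).setReg 12 0)
    ⟨by simp [eval], rfl⟩) ?_
  rintro _ _ rfl
  refine Ensures.mono (ensures_fill (K := 9 * n - 2 * m) (n := n) (m := m) (a := σ.arr 0)
    (b := σ.arr 1) ?_ (by omega) hW ?_) le_rfl fun ω hF'' hω => ⟨?_, hω⟩
  · simp [reg_setReg, r', h4]
  · simp only [reg_setReg, arr_setReg, if_true, Nat.reduceEqDiff, if_false]
    refine ⟨by omega, le_rfl, by omega, by simp, fun x hx => ?_, fun x hx => ?_, fun j hj => ?_,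
      hυ.1⟩
    · rw [hυ.2 x]
      exact Nat.count_congr fun j hj => by rw [hυ.1 j hj]
    · rw [hυ.2 x]; exact hdeg x hx
    · rw [hυ.1 j hj]; exact hlt j hj
  · rw [hF''.arr 20 (by decide), arr_setReg, arr_setReg, s']
    exact hτ

/-- Direct the edges from the half-edges of colour `1` to those of colour `2`. -/
def orientBody : RamProgram :=
  .branch (diff (get 26 (add (reg 10) (reg 10))) (lit 1))
    (.seq (.store 30 (reg 10) (get 21 (add (add (reg 10) (reg 10)) (lit 1))))
      (.store 31 (reg 10) (get 21 (add (reg 10) (reg 10)))))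
    (.seq (.store 30 (reg 10) (get 21 (add (reg 10) (reg 10))))
      (.store 31 (reg 10) (get 21 (add (add (reg 10) (reg 10)) (lit 1)))))

theorem ensures_orient {W N : ℕ} {σ : RamState} (hN : σ.reg 2 = N) (hW : N ≤ W)
    (hv : ∀ h < 2 * N, σ.arr 21 h ≤ W) :
    Ensures W (forLoop 10 2 orientBody) σ (N * 60 + 6) fun τ =>
      IsOrientation N (σ.arr 21) (σ.arr 26) (τ.arr 30) (τ.arr 31) := by
  refine Ensures.mono (Ensures.forLoop (fun k τ =>
      IsOrientation k (σ.arr 21) (σ.arr 26) (τ.arr 30) (τ.arr 31)) hN hW (by decide) (by decide)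
      ⟨fun _ h => by omega, fun _ h => by omega⟩ ?_) ?_ fun _ _ h => h
  · intro k hk τ hx hF hI
    have e0 : τ.arr 21 = σ.arr 21 := hF.arr 21 (by decide)
    have e1 : τ.arr 26 = σ.arr 26 := hF.arr 26 (by decide)
    have b0 := hv (2 * k) (by omega)
    have b1 := hv (2 * k + 1) (by omega)
    simp only [orientBody, Wp, eval_diff, ne_eq, RamExpr.eval, arr_setReg, reg_setArr, arr_setArr,
      hx, if_true, e0, e1, Nat.reduceEqDiff, if_false, ← two_mul]
    refine ⟨fun h => ⟨by omega, b1, by omega, b0, fun i hi h1 => ?_, fun i hi h1 => ?_⟩,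
      fun h => ⟨by omega, b0, by omega, b1, fun i hi h1 => ?_, fun i hi h1 => ?_⟩⟩ <;>
      by_cases hik : i = k
    · subst hik; exact absurd h1 h
    · rw [Function.update_of_ne hik, Function.update_of_ne hik]; exact hI.one i (by omega) h1
    · subst hik; simp
    · rw [Function.update_of_ne hik, Function.update_of_ne hik]; exact hI.two i (by omega) h1
    · subst hik; simp
    · rw [Function.update_of_ne hik, Function.update_of_ne hik]; exact hI.one i (by omega) h1
    · subst hik; exact absurd h h1
    · rw [Function.update_of_ne hik, Function.update_of_ne hik]; exact hI.two i (by omega) h1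
  · refine Nat.add_le_add_right (Nat.mul_le_mul_left _ ?_) _
    decide

/-- Combine the ends of the edges with their colours. -/
def keyBody : RamProgram :=
  .branch (diff (get 36 (reg 10)) (lit 1))
    (.seq (.store 40 (reg 10) (add (get 30 (reg 10)) (reg 0)))
      (.store 41 (reg 10) (add (get 31 (reg 10)) (reg 0))))
    (.seq (.store 40 (reg 10) (get 30 (reg 10))) (.store 41 (reg 10) (get 31 (reg 10))))

theorem ensures_key {W n N : ℕ} {σ : RamState} (h0 : σ.reg 0 = n) (hN : σ.reg 2 = N) (hW : N ≤ W)
    (hv : ∀ i < N, σ.arr 30 i + n ≤ W ∧ σ.arr 31 i + n ≤ W) :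
    Ensures W (forLoop 10 2 keyBody) σ (N * 60 + 6) fun τ =>
      IsColKey n N (σ.arr 30) (σ.arr 36) (τ.arr 40) ∧
        IsColKey n N (σ.arr 31) (σ.arr 36) (τ.arr 41) := by
  refine Ensures.mono (Ensures.forLoop (fun k τ => IsColKey n k (σ.arr 30) (σ.arr 36) (τ.arr 40) ∧
        IsColKey n k (σ.arr 31) (σ.arr 36) (τ.arr 41)) hN hW (by decide) (by decide)
      ⟨fun _ h => by omega, fun _ h => by omega⟩ ?_) ?_ fun _ _ h => h
  · intro k hk τ hx hF hI
    have e0 : τ.arr 30 = σ.arr 30 := hF.arr 30 (by decide)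
    have e1 : τ.arr 31 = σ.arr 31 := hF.arr 31 (by decide)
    have e2 : τ.arr 36 = σ.arr 36 := hF.arr 36 (by decide)
    have e3 : τ.reg 0 = n := by rw [hF.reg 0 (by decide), h0]
    have b := hv k hk
    simp only [keyBody, Wp, eval_diff, ne_eq, RamExpr.eval, arr_setReg, reg_setArr, arr_setArr,
      hx, if_true, e0, e1, e2, e3, Nat.reduceEqDiff, if_false]
    refine ⟨fun h => ⟨by omega, by omega, by omega, by omega, fun i hi => ?_, fun i hi => ?_⟩,
      fun h => ⟨by omega, by omega, by omega, by omega, fun i hi => ?_, fun i hi => ?_⟩⟩ <;>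
      by_cases hik : i = k
    · subst hik; rw [Function.update_self, if_neg h]
    · rw [Function.update_of_ne hik]; exact hI.1 i (by omega)
    · subst hik; rw [Function.update_self, if_neg h]
    · rw [Function.update_of_ne hik]; exact hI.2 i (by omega)
    · subst hik; rw [Function.update_self, if_pos h]
    · rw [Function.update_of_ne hik]; exact hI.1 i (by omega)
    · subst hik; rw [Function.update_self, if_pos h]
    · rw [Function.update_of_ne hik]; exact hI.2 i (by omega)
  · refine Nat.add_le_add_right (Nat.mul_le_mul_left _ ?_) _
    decide

/-- The permutations that belong to the four classes. -/
def permBody : RamProgram :=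
  .branch (diff (get 36 (reg 10)) (lit 1))
    (.branch (diff (get 46 (reg 10)) (lit 1))
      (.store 61 (get 30 (reg 10)) (get 31 (reg 10)))
      (.store 60 (get 30 (reg 10)) (get 31 (reg 10))))
    (.branch (diff (get 46 (reg 10)) (lit 1))
      (.store 51 (get 30 (reg 10)) (get 31 (reg 10)))
      (.store 50 (get 30 (reg 10)) (get 31 (reg 10))))

theorem ensures_perm {W n : ℕ} {σ : RamState} (hN : σ.reg 2 = 4 * n) (hW : 4 * n ≤ W)
    (hf : IsFactoring n (σ.arr 30) (σ.arr 31) (σ.arr 36) (σ.arr 46)) :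
    Ensures W (forLoop 10 2 permBody) σ (4 * n * 60 + 6) fun τ =>
      (IsClassMap (4 * n) (σ.arr 30) (σ.arr 31) (σ.arr 36) (σ.arr 46) 1 1 (τ.arr 50) ∧
        IsClassMap (4 * n) (σ.arr 30) (σ.arr 31) (σ.arr 36) (σ.arr 46) 1 2 (τ.arr 51)) ∧
      IsClassMap (4 * n) (σ.arr 30) (σ.arr 31) (σ.arr 36) (σ.arr 46) 2 1 (τ.arr 60) ∧
        IsClassMap (4 * n) (σ.arr 30) (σ.arr 31) (σ.arr 36) (σ.arr 46) 2 2 (τ.arr 61) := by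
  refine Ensures.mono (Ensures.forLoop (fun k τ =>
      (IsClassMap k (σ.arr 30) (σ.arr 31) (σ.arr 36) (σ.arr 46) 1 1 (τ.arr 50) ∧
        IsClassMap k (σ.arr 30) (σ.arr 31) (σ.arr 36) (σ.arr 46) 1 2 (τ.arr 51)) ∧
      IsClassMap k (σ.arr 30) (σ.arr 31) (σ.arr 36) (σ.arr 46) 2 1 (τ.arr 60) ∧
        IsClassMap k (σ.arr 30) (σ.arr 31) (σ.arr 36) (σ.arr 46) 2 2 (τ.arr 61)) hN hW
      (by decide) (by decide)
      ⟨⟨fun _ h => by omega, fun _ h => by omega⟩, fun _ h => by omega, fun _ h => by omega⟩ ?_)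
      ?_ fun _ _ h => h
  · intro k hk τ hx hF hI
    have e0 : τ.arr 30 = σ.arr 30 := hF.arr 30 (by decide)
    have e1 : τ.arr 31 = σ.arr 31 := hF.arr 31 (by decide)
    have e2 : τ.arr 36 = σ.arr 36 := hF.arr 36 (by decide)
    have e3 : τ.arr 46 = σ.arr 46 := hF.arr 46 (by decide)
    have b := hf.lt k hk
    have c2 := hf.col₂ k hk
    have c3 := hf.col₃ k hk
    simp only [permBody, Wp, eval_diff, ne_eq, RamExpr.eval, arr_setReg, arr_setArr,
      hx, if_true, e0, e1, e2, e3, Nat.reduceEqDiff, if_false]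
    refine ⟨fun h => ⟨fun h' => ⟨by omega, by omega, ⟨hI.1.1.skip ?_, hI.1.2.skip ?_⟩,
          hI.2.1.skip ?_, hI.2.2.update hf hk ?_ ?_ ?_ ?_⟩,
        fun h' => ⟨by omega, by omega, ⟨hI.1.1.skip ?_, hI.1.2.skip ?_⟩,
          hI.2.1.update hf hk ?_ ?_ ?_ ?_, hI.2.2.skip ?_⟩⟩,
      fun h => ⟨fun h' => ⟨by omega, by omega, ⟨hI.1.1.skip ?_, hI.1.2.update hf hk ?_ ?_ ?_ ?_⟩,
          hI.2.1.skip ?_, hI.2.2.skip ?_⟩,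
        fun h' => ⟨by omega, by omega, ⟨hI.1.1.update hf hk ?_ ?_ ?_ ?_, hI.1.2.skip ?_⟩,
          hI.2.1.skip ?_, hI.2.2.skip ?_⟩⟩⟩ <;> omega
  · refine Nat.add_le_add_right (Nat.mul_le_mul_left _ ?_) _
    decide

end RamProgram

/-! ### Programs for the coordinates and the bends -/

namespace RamProgram

open RamExpr

/-- Ten times the value of `e`. -/
def ten (e : RamExpr) : RamExpr :=
  add (add (add (add e e) (add e e)) (add (add e e) (add e e))) (add e e)

theorem eval_ten (σ : RamState) (e : RamExpr) : (ten e).eval σ = 10 * e.eval σ := by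
  simp only [ten, eval]; omega

/-- The coordinates of the vertices. -/
def coordBody : RamProgram :=
  .seq (.store 2 (reg 10) (ten (get 56 (reg 10)))) (.store 3 (reg 10) (ten (get 66 (reg 10))))

theorem ensures_coord {W n : ℕ} {σ : RamState} (hn : σ.reg 0 = n) (hW : n ≤ W)
    (hX : ∀ v < n, 10 * σ.arr 56 v ≤ W ∧ 10 * σ.arr 66 v ≤ W) :
    Ensures W (forLoop 10 0 coordBody) σ (n * 80 + 6) fun τ =>
      ∀ v < n, τ.arr 2 v = 10 * σ.arr 56 v ∧ τ.arr 3 v = 10 * σ.arr 66 v := by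
  refine Ensures.mono (Ensures.forLoop (fun k τ =>
      ∀ v < k, τ.arr 2 v = 10 * σ.arr 56 v ∧ τ.arr 3 v = 10 * σ.arr 66 v) hn hW
      (by decide) (by decide) (by simp) ?_) ?_ fun _ _ h => h
  · intro k hk τ hx hF hI
    have e0 : τ.arr 56 = σ.arr 56 := hF.arr 56 (by decide)
    have e1 : τ.arr 66 = σ.arr 66 := hF.arr 66 (by decide)
    have b := hX k hk
    simp only [coordBody, Wp, eval_ten, RamExpr.eval, arr_setReg, reg_setArr, arr_setArr,
      hx, if_true, e0, e1, Nat.reduceEqDiff, if_false]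
    refine ⟨by omega, b.1, by omega, b.2, fun v hv => ?_⟩
    by_cases hvk : v = k
    · subst hvk; simp
    · rw [Function.update_of_ne hvk, Function.update_of_ne hvk]; exact hI v (by omega)
  · refine Nat.add_le_add_right (Nat.mul_le_mul_left _ ?_) _
    decide

/-- The port vertex (in the register `14`) and the column (in the register `13`) of an edge whose
ends are in the registers `15` and `16`. -/
def chooseProgram (b : ℕ) : RamProgram :=
  .branch (diff (get 46 (reg 10)) (lit 1))
    (.branch (add (diff (get (b + 4) (reg 15)) (reg 15)) (diff (get (b + 4) (reg 16)) (reg 15)))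
      (.seq (.assign 14 (reg 15)) (.assign 13 (add (ten (get (b + 6) (reg 16))) (lit 2))))
      (.seq (.assign 14 (reg 16)) (.assign 13 (add (ten (get (b + 6) (reg 15))) (lit 3)))))
    (.branch (diff (get (b + 6) (reg 16)) (add (get (b + 6) (reg 15)) (lit 1)))
      (.branch (diff (get (b + 4) (reg 15)) (reg 15))
        (.seq (.assign 14 (reg 16)) (.assign 13 (add (ten (get (b + 6) (reg 15))) (lit 4))))
        (.seq (.assign 14 (reg 15)) (.assign 13 (add (ten (get (b + 6) (reg 16))) (lit 4)))))
      (.seq (.assign 14 (reg 0)) (.assign 13 (add (ten (get (b + 6) (reg 15))) (lit 5)))))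

theorem wp_choose {W b n k T H : ℕ} {σ : RamState} {Q : RamState → Prop} (h0 : σ.reg 0 = n)
    (hk : σ.reg 10 = k) (hT : σ.reg 15 = T) (hH : σ.reg 16 = H) (hnW : n ≤ W) (hTW : T ≤ W)
    (hHW : H ≤ W) (hX : 10 * σ.arr (b + 6) T + 5 ≤ W ∧ 10 * σ.arr (b + 6) H + 5 ≤ W)
    (hQ : Q ((σ.setReg 14
        (portOf n (σ.arr (b + 6)) (σ.arr (b + 4)) (σ.arr 46 k = 1) T H)).setReg 13
        (colOf (σ.arr (b + 6)) (σ.arr (b + 4)) (σ.arr 46 k = 1) T H))) :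
    Wp W (chooseProgram b) Q σ := by
  simp only [chooseProgram, Wp, eval_diff, eval_ten, ne_eq, RamExpr.eval, arr_setReg, reg_setReg,
    h0, hk, hT, hH, if_false, Nat.reduceEqDiff, Nat.add_eq_zero_iff]
  refine ⟨fun h1 => ⟨fun h2 => ⟨hTW, by omega, ?_⟩, fun h2 => ⟨hHW, by omega, ?_⟩⟩,
    fun h1 => ⟨fun h2 => ⟨fun h3 => ⟨hHW, by omega, ?_⟩, fun h3 => ⟨hTW, by omega, ?_⟩⟩,
      fun h2 => ⟨hnW, by omega, ?_⟩⟩⟩ <;> convert hQ using 2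
  · rw [portOf, if_neg h1, if_neg h2]
  · rw [colOf, if_neg h1, if_neg h2]
  · rw [portOf, if_neg h1, if_pos h2]
  · rw [colOf, if_neg h1, if_pos h2]
  · rw [portOf, if_pos h1, if_neg h2, if_neg h3]
  · rw [colOf, if_pos h1, if_neg h2, if_neg h3]
  · rw [portOf, if_pos h1, if_neg h2, if_pos h3]
  · rw [colOf, if_pos h1, if_neg h2, if_pos h3]
  · rw [portOf, if_pos h1, if_pos h2]
  · rw [colOf, if_pos h1, if_pos h2]

/-- The height of the bend next to `u` on an edge between `u` and `v` with the port vertex `p`. -/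
def bendHeight (y : ℕ → ℕ) (p u v : ℕ) : ℕ :=
  if u = p then y u else if y u < y v then y u + 1 else y u - 1

/-- Store the height of the bend next to the vertex `get a (reg 10)` in the array `o`. -/
def bendProgram (y o a a' : ℕ) : RamProgram :=
  .branch (diff (get a (reg 10)) (reg 14))
    (.branch (sub (get y (get a' (reg 10))) (get y (get a (reg 10))))
      (.store o (reg 10) (add (get y (get a (reg 10))) (lit 1)))
      (.store o (reg 10) (sub (get y (get a (reg 10))) (lit 1))))
    (.store o (reg 10) (get y (get a (reg 10))))

theorem wp_bend {W y o a a' k p : ℕ} {σ : RamState} {Q : RamState → Prop} (hk : σ.reg 10 = k)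
    (hp : σ.reg 14 = p) (hkW : k ≤ W) (hy : σ.arr y (σ.arr a k) + 1 ≤ W)
    (hQ : Q (σ.setArr o k (bendHeight (σ.arr y) p (σ.arr a k) (σ.arr a' k)))) :
    Wp W (bendProgram y o a a') Q σ := by
  simp only [bendProgram, Wp, eval_diff, ne_eq, RamExpr.eval, hk, hp]
  refine ⟨fun h1 => ⟨fun h2 => ⟨hkW, by omega, ?_⟩, fun h2 => ⟨hkW, by omega, ?_⟩⟩,
    fun h1 => ⟨hkW, by omega, ?_⟩⟩ <;> convert hQ using 2
  · rw [bendHeight, if_neg h1, if_pos (by omega)]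
  · rw [bendHeight, if_neg h1, if_neg (by omega)]
  · rw [bendHeight, if_pos h1]

/-- Store the bends of an edge: the column in the arrays `c` and `c'`, the heights in the arrays `o`
and `o'`. -/
def placeProgram (y c c' o o' : ℕ) : RamProgram :=
  .seq (.store c (reg 10) (reg 13)) (.seq (.store c' (reg 10) (reg 13))
    (.seq (bendProgram y o 0 1) (bendProgram y o' 1 0)))

/-- The bends of the edges. -/
def bendsBody : RamProgram :=
  .seq (.assign 15 (get 30 (reg 10))) (.seq (.assign 16 (get 31 (reg 10)))
    (.seq (.store 4 (reg 10) (lit 2))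
      (.branch (diff (get 36 (reg 10)) (lit 1))
        (.seq (chooseProgram 60) (placeProgram 2 6 8 5 7))
        (.seq (chooseProgram 50) (placeProgram 3 5 7 6 8)))))

/-- The arrays `4` to `8` of `τ` contain the bends of the edge `i`, computed from the other arrays
of `σ`. -/
def HasBends (n : ℕ) (σ τ : RamState) (i : ℕ) : Prop :=
  τ.arr 4 i = 2 ∧
  (σ.arr 36 i = 1 →
    τ.arr 5 i = colOf (σ.arr 56) (σ.arr 54) (σ.arr 46 i = 1) (σ.arr 30 i) (σ.arr 31 i) ∧
    τ.arr 7 i = colOf (σ.arr 56) (σ.arr 54) (σ.arr 46 i = 1) (σ.arr 30 i) (σ.arr 31 i) ∧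
    τ.arr 6 i = bendHeight (σ.arr 3)
      (portOf n (σ.arr 56) (σ.arr 54) (σ.arr 46 i = 1) (σ.arr 30 i) (σ.arr 31 i))
      (σ.arr 0 i) (σ.arr 1 i) ∧
    τ.arr 8 i = bendHeight (σ.arr 3)
      (portOf n (σ.arr 56) (σ.arr 54) (σ.arr 46 i = 1) (σ.arr 30 i) (σ.arr 31 i))
      (σ.arr 1 i) (σ.arr 0 i)) ∧
  (σ.arr 36 i ≠ 1 →
    τ.arr 6 i = colOf (σ.arr 66) (σ.arr 64) (σ.arr 46 i = 1) (σ.arr 30 i) (σ.arr 31 i) ∧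
    τ.arr 8 i = colOf (σ.arr 66) (σ.arr 64) (σ.arr 46 i = 1) (σ.arr 30 i) (σ.arr 31 i) ∧
    τ.arr 5 i = bendHeight (σ.arr 2)
      (portOf n (σ.arr 66) (σ.arr 64) (σ.arr 46 i = 1) (σ.arr 30 i) (σ.arr 31 i))
      (σ.arr 0 i) (σ.arr 1 i) ∧
    τ.arr 7 i = bendHeight (σ.arr 2)
      (portOf n (σ.arr 66) (σ.arr 64) (σ.arr 46 i = 1) (σ.arr 30 i) (σ.arr 31 i))
      (σ.arr 1 i) (σ.arr 0 i))

theorem colOf_le {X root : ℕ → ℕ} {p : Prop} [Decidable p] {a b C : ℕ} (ha : 10 * X a + 5 ≤ C)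
    (hb : 10 * X b + 5 ≤ C) : colOf X root p a b ≤ C := by
  unfold colOf; split_ifs <;> omega

/-- Line and port depend on the computed direction of the edge, in the arrays 30 and 31, but the
order of the bends on the direction in which it was listed, in the arrays 0 and 1. -/
theorem ensures_bends {W n m : ℕ} {σ : RamState} (h0 : σ.reg 0 = n) (hm : σ.reg 1 = m)
    (hn : n ≤ W) (hmW : m ≤ W) (h2 : 2 ≤ W)
    (hT : ∀ i < m, σ.arr 30 i < n ∧ σ.arr 31 i < n)
    (ha : ∀ i < m, σ.arr 0 i < n ∧ σ.arr 1 i < n)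
    (hX : ∀ v < n, 10 * σ.arr 56 v + 5 ≤ W ∧ 10 * σ.arr 66 v + 5 ≤ W ∧ σ.arr 2 v + 1 ≤ W ∧
      σ.arr 3 v + 1 ≤ W) :
    Ensures W (forLoop 10 1 bendsBody) σ (m * 200 + 6) fun τ => ∀ i < m, HasBends n σ τ i := by
  refine Ensures.mono (Ensures.forLoop (fun k τ => ∀ i < k, HasBends n σ τ i) hm hmW
      (by decide) (by decide) (by simp) ?_) ?_ fun _ _ h => h
  · intro k hk τ hx hF hI
    have f : ∀ a, (forLoop 10 1 bendsBody).writesArr a = false → τ.arr a = σ.arr a := hF.arr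
    have e36 := f 36 (by decide)
    have e30 := f 30 (by decide)
    have e31 := f 31 (by decide)
    have e46 := f 46 (by decide)
    have e56 := f 56 (by decide)
    have e54 := f 54 (by decide)
    have e66 := f 66 (by decide)
    have e64 := f 64 (by decide)
    have e0 := f 0 (by decide)
    have e1 := f 1 (by decide)
    have e2 := f 2 (by decide)
    have e3 := f 3 (by decide)
    have r0 : τ.reg 0 = n := by rw [hF.reg 0 (by decide), h0]
    have bT := hT k hk
    have ba := ha k hk
    have bX0 := hX _ bT.1
    have bX1 := hX _ bT.2
    have ba0 := hX _ ba.1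
    have ba1 := hX _ ba.2
    simp only [bendsBody, placeProgram, Wp, eval_diff, ne_eq, RamExpr.eval, arr_setReg, reg_setReg,
      reg_setArr, arr_setArr, hx, if_false, Nat.reduceEqDiff, e30, e31, e36]
    refine ⟨by omega, by omega, by omega, by omega, fun h => ?_, fun h => ?_⟩
    · refine wp_choose (n := n) (k := k) (T := σ.arr 30 k) (H := σ.arr 31 k)
        (by simp [reg_setReg, reg_setArr, r0]) (by simp [reg_setReg, reg_setArr, hx])
        (by simp [reg_setReg, reg_setArr]) (by simp [reg_setReg, reg_setArr])
        hn (by omega) (by omega) (by simp [arr_setReg, arr_setArr, e66]; omega) ?_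
      simp only [arr_setReg, reg_setReg, reg_setArr, arr_setArr, hx, if_true, if_false,
        Nat.reduceEqDiff, Nat.reduceAdd, e66, e64, e46]
      have hc := colOf_le (p := σ.arr 46 k = 1) (root := σ.arr 64) bX0.2.1 bX1.2.1
      refine ⟨by omega, hc, by omega, hc, ?_⟩
      refine wp_bend (k := k)
        (p := portOf n (σ.arr 66) (σ.arr 64) (σ.arr 46 k = 1) (σ.arr 30 k) (σ.arr 31 k))
        (by simp [reg_setReg, reg_setArr, hx])
        (by simp only [reg_setReg, reg_setArr, if_true, if_false, Nat.reduceEqDiff])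
        (by omega) (by simp [arr_setReg, arr_setArr, e0, e2]; omega) ?_
      refine wp_bend (k := k)
        (p := portOf n (σ.arr 66) (σ.arr 64) (σ.arr 46 k = 1) (σ.arr 30 k) (σ.arr 31 k))
        (by simp [reg_setReg, reg_setArr, hx])
        (by simp only [reg_setReg, reg_setArr, if_true, if_false, Nat.reduceEqDiff])
        (by omega) (by simp [arr_setReg, arr_setArr, e1, e2]; omega) ?_
      simp only [arr_setReg, arr_setArr, if_false, Nat.reduceEqDiff,
        OfNat.zero_ne_ofNat, OfNat.one_ne_ofNat, e0, e1, e2]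
      intro i hi
      by_cases hik : i = k
      · subst hik
        simp [HasBends, arr_setReg, arr_setArr, h]
      · have := hI i (by omega)
        simpa only [HasBends, arr_setReg, arr_setArr, Function.update_of_ne hik, if_true, if_false,
          Nat.reduceEqDiff] using this
    · refine wp_choose (n := n) (k := k) (T := σ.arr 30 k) (H := σ.arr 31 k)
        (by simp [reg_setReg, reg_setArr, r0]) (by simp [reg_setReg, reg_setArr, hx])
        (by simp [reg_setReg, reg_setArr]) (by simp [reg_setReg, reg_setArr])
        hn (by omega) (by omega) (by simp [arr_setReg, arr_setArr, e56]; omega) ?_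
      simp only [arr_setReg, reg_setReg, reg_setArr, arr_setArr, hx, if_true, if_false,
        Nat.reduceEqDiff, Nat.reduceAdd, e56, e54, e46]
      have hc := colOf_le (p := σ.arr 46 k = 1) (root := σ.arr 54) bX0.1 bX1.1
      refine ⟨by omega, hc, by omega, hc, ?_⟩
      refine wp_bend (k := k)
        (p := portOf n (σ.arr 56) (σ.arr 54) (σ.arr 46 k = 1) (σ.arr 30 k) (σ.arr 31 k))
        (by simp [reg_setReg, reg_setArr, hx])
        (by simp only [reg_setReg, reg_setArr, if_true, if_false, Nat.reduceEqDiff])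
        (by omega) (by simp [arr_setReg, arr_setArr, e0, e3]; omega) ?_
      refine wp_bend (k := k)
        (p := portOf n (σ.arr 56) (σ.arr 54) (σ.arr 46 k = 1) (σ.arr 30 k) (σ.arr 31 k))
        (by simp [reg_setReg, reg_setArr, hx])
        (by simp only [reg_setReg, reg_setArr, if_true, if_false, Nat.reduceEqDiff])
        (by omega) (by simp [arr_setReg, arr_setArr, e1, e3]; omega) ?_
      simp only [arr_setReg, arr_setArr, if_false, Nat.reduceEqDiff,
        OfNat.zero_ne_ofNat, OfNat.one_ne_ofNat, e0, e1, e3]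
      intro i hi
      by_cases hik : i = k
      · subst hik
        simp [HasBends, arr_setReg, arr_setArr, h]
      · have := hI i (by omega)
        simpa only [HasBends, arr_setReg, arr_setArr, Function.update_of_ne hik, if_true, if_false,
          Nat.reduceEqDiff] using this
  · refine Nat.add_le_add_right (Nat.mul_le_mul_left _ ?_) _
    decide

end RamProgram

/-! ### The program for the division into four classes -/

theorem even_count_half (K κ : ℕ) : Even (Nat.count (fun h => h / 2 = κ) (2 * K)) := by
  induction K with
  | zero => simp
  | succ K ih =>
    rw [show 2 * (K + 1) = 2 * K + 1 + 1 by ring, Nat.count_succ, Nat.count_succ,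
      show (2 * K + 1) / 2 = 2 * K / 2 by omega, add_assoc]
    exact ih.add ⟨_, rfl⟩

namespace RamProgram

open RamExpr

theorem split_arr {b N I : ℕ} {σ τ : RamState} (h : Frame (splitProgram b N I) σ τ) {a : ℕ}
    (ha : a < b + 2 ∨ b + 7 ≤ a) : τ.arr a = σ.arr a :=
  h.arr a (by simp [splitProgram, forLoop, pairBody, colBody, writesArr]; omega)

theorem split_reg {b N I : ℕ} {σ τ : RamState} (h : Frame (splitProgram b N I) σ τ) {x : ℕ}
    (hx : x < 10) : τ.reg x = σ.reg x :=
  h.reg x (by simp [splitProgram, forLoop, pairBody, colBody, writesReg]; omega)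

theorem halves_arr {σ τ : RamState} (h : Frame halvesProgram σ τ) {a : ℕ}
    (ha : a < 9 ∨ 22 ≤ a) : τ.arr a = σ.arr a :=
  h.arr a (by simp [halvesProgram, forLoop, halfKeyBody, halfBody, fillBody, writesArr]; omega)

theorem halves_reg {σ τ : RamState} (h : Frame halvesProgram σ τ) {x : ℕ}
    (hx : x < 10) : τ.reg x = σ.reg x :=
  h.reg x (by simp [halvesProgram, forLoop, halfKeyBody, halfBody, fillBody, writesReg]; omega)

theorem orient_arr {σ τ : RamState} (h : Frame (forLoop 10 2 orientBody) σ τ) {a : ℕ}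
    (ha : a < 30 ∨ 32 ≤ a) : τ.arr a = σ.arr a :=
  h.arr a (by simp [forLoop, orientBody, writesArr]; omega)

theorem orient_reg {σ τ : RamState} (h : Frame (forLoop 10 2 orientBody) σ τ) {x : ℕ}
    (hx : x < 10) : τ.reg x = σ.reg x :=
  h.reg x (by simp [forLoop, orientBody, writesReg]; omega)

theorem key_arr {σ τ : RamState} (h : Frame (forLoop 10 2 keyBody) σ τ) {a : ℕ}
    (ha : a < 40 ∨ 42 ≤ a) : τ.arr a = σ.arr a :=
  h.arr a (by simp [forLoop, keyBody, writesArr]; omega)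

theorem key_reg {σ τ : RamState} (h : Frame (forLoop 10 2 keyBody) σ τ) {x : ℕ}
    (hx : x < 10) : τ.reg x = σ.reg x :=
  h.reg x (by simp [forLoop, keyBody, writesReg]; omega)

/-- The numbers of iterations of the loops are in the registers. -/
structure HasSizes (n m : ℕ) (σ : RamState) : Prop where
  r0 : σ.reg 0 = n
  r1 : σ.reg 1 = m
  r2 : σ.reg 2 = 4 * n
  r3 : σ.reg 3 = 2 * (4 * n)
  r4 : σ.reg 4 = 9 * n - 2 * m
  r5 : σ.reg 5 = 2 * n
  r6 : σ.reg 6 = 3 * (4 * n)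
  r7 : σ.reg 7 = 3 * (2 * n)

theorem HasSizes.of_reg {n m : ℕ} {σ τ : RamState} (h : HasSizes n m σ)
    (hr : ∀ x, x < 10 → τ.reg x = σ.reg x) : HasSizes n m τ := by
  obtain ⟨h0, h1, h2, h3, h4, h5, h6, h7⟩ := h
  constructor <;> rw [hr _ (by omega)] <;> assumption

/-- Direct the edges and divide them into four classes. -/
def factorProgram : RamProgram :=
  .seq halvesProgram (.seq (splitProgram 20 3 6) (.seq (forLoop 10 2 orientBody)
    (.seq (splitProgram 30 2 7) (.seq (forLoop 10 2 keyBody) (splitProgram 40 2 7)))))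

/-- Three halvings take the eight half-edges at a vertex to four edges out and four in, then to two,
then to one of each class. Only counts matter, so loops and parallel edges among the added edges do
no harm. -/
theorem ensures_factor {W n m : ℕ} {σ : RamState} (hs : HasSizes n m σ) (hW : 100 * n + 20 ≤ W)
    (ha : ∀ i < m, σ.arr 0 i < n ∧ σ.arr 1 i < n) (h9 : ∀ a, 2 ≤ a → σ.arr a = fun _ => 0)
    (hdeg : ∀ x < n, Nat.count (fun j => halfVertex (σ.arr 0) (σ.arr 1) j = x) (2 * m) ≤ 8) :
    Ensures W factorProgram σ (6000 * n + 300) fun τ =>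
      HasSizes n m τ ∧ (∀ a, a < 2 ∨ 47 ≤ a → τ.arr a = σ.arr a) ∧
      IsFactoring n (τ.arr 30) (τ.arr 31) (τ.arr 36) (τ.arr 46) ∧ m ≤ 4 * n ∧
      ∀ i < m, (τ.arr 30 i = σ.arr 0 i ∧ τ.arr 31 i = σ.arr 1 i) ∨
        (τ.arr 30 i = σ.arr 1 i ∧ τ.arr 31 i = σ.arr 0 i) := by
  have e8 : 8 * n = 2 * (4 * n) := by ring
  have e4 : 4 * n = 2 * (2 * n) := by ring
  refine Ensures.mono (B := (1000 * n + 30) + ((4 * n * 280 + 22) + ((4 * n * 60 + 6) +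
    ((2 * n * 280 + 22) + ((4 * n * 60 + 6) + (2 * n * 280 + 22))))))
    (Ensures.seq (ensures_halves hs.r1 hs.r2 hs.r4 (by omega) ha (h9 9 (by omega)) hdeg)
    fun τ₁ F₁ ⟨k20, hH⟩ => ?_) (by omega) fun _ _ h => h
  have s₁ := hs.of_reg fun x hx => halves_reg F₁ hx
  have a₁ : ∀ a, a < 9 ∨ 22 ≤ a → τ₁.arr a = σ.arr a := fun a ha => halves_arr F₁ ha
  -- the direction of the edges
  refine Ensures.seq (ensures_split (K := 4 * n) (by omega) (by omega) s₁.r3 s₁.r6 (by omega)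
    (by omega) (fun i hi => ⟨?_, ?_⟩)
    (fun a h1 h2 => by rw [a₁ a (by omega)]; exact h9 a (by omega))
    (fun j hj => ?_) (fun j hj => ?_)) fun τ₂ F₂ ⟨⟨α, mα, sα⟩, β, mβ, sβ⟩ => ?_
  · rw [k20 i hi]; omega
  · have := hH.lt i (by omega)
    show τ₁.arr 21 i ≤ W
    omega
  · rw [Nat.count_congr (q := fun h => h / 2 = τ₁.arr 20 j) fun i hi => by rw [k20 i hi]]
    exact even_count_half _ _
  · show Even (Nat.count (fun i => τ₁.arr 21 i = τ₁.arr 21 j) _)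
    rw [← e8, hH.count _ (hH.lt j (by omega))]
    decide
  have s₂ := s₁.of_reg fun x hx => split_reg F₂ hx
  have a₂ : ∀ a, a < 22 ∨ 27 ≤ a → τ₂.arr a = τ₁.arr a := fun a ha => split_arr F₂ (by omega)
  change IsMating _ (τ₁.arr 21) β at mβ
  change Swaps _ α (τ₂.arr 26) at sα
  change Swaps _ β (τ₂.arr 26) at sβ
  refine Ensures.seq (ensures_orient s₂.r2 (by omega) fun h hh => ?_) fun τ₃ F₃ hO => ?_
  · rw [a₂ 21 (by omega)]
    have := hH.lt h (by omega)
    omega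
  have s₃ := s₂.of_reg fun x hx => orient_reg F₃ hx
  have a₃ : ∀ a, a < 30 ∨ 32 ≤ a → τ₃.arr a = τ₂.arr a := fun a ha => orient_arr F₃ ha
  rw [a₂ 21 (by omega)] at hO
  set tl := τ₃.arr 30 with htl
  set hd := τ₃.arr 31 with hhd
  have hlt : ∀ i < 4 * n, tl i < n ∧ hd i < n := fun i hi => by
    have l1 := hH.lt (2 * i) (by omega)
    have l2 := hH.lt (2 * i + 1) (by omega)
    by_cases h1 : τ₂.arr 26 (2 * i) = 1
    · rw [(hO.one i hi h1).1, (hO.one i hi h1).2]; exact ⟨l1, l2⟩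
    · rw [(hO.two i hi h1).1, (hO.two i hi h1).2]; exact ⟨l2, l1⟩
  have hfour : ∀ x < n, Nat.count (fun i => tl i = x) (4 * n) = 4 ∧
      Nat.count (fun i => hd i = x) (4 * n) = 4 := fun x hx => by
    have h1 := hO.count sα mα k20 x
    have h2 := hH.count x hx
    rw [e8] at h2
    have h3 := sβ.count mβ x (c := 1) (by simp)
    have h4 := sβ.count mβ x (c := 2) (by simp)
    omega
  -- the first colour
  refine Ensures.seq (ensures_split (b := 30) (N := 2) (I := 7) (K := 2 * n) (by omega) (by omega)
    (by rw [s₃.r2, e4]) s₃.r7 (by omega) (by omega) (fun i hi => ⟨?_, ?_⟩)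
    (fun a h1 h2 => by
      rw [a₃ a (by omega), a₂ a (by omega), a₁ a (by omega)]; exact h9 a (by omega))
    (fun j hj => ?_) (fun j hj => ?_)) fun τ₄ F₄ ⟨⟨α₂, mα₂, sα₂⟩, β₂, mβ₂, sβ₂⟩ => ?_
  · have := hlt i (by omega)
    show tl i ≤ W
    omega
  · have := hlt i (by omega)
    show hd i ≤ W
    omega
  · rw [← e4, ← htl, (hfour _ (hlt j (by omega)).1).1]
    decide
  · show Even (Nat.count (fun i => hd i = hd j) _)
    rw [← e4, (hfour _ (hlt j (by omega)).2).2]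
    decide
  have s₄ := s₃.of_reg fun x hx => split_reg F₄ hx
  have a₄ : ∀ a, a < 32 ∨ 37 ≤ a → τ₄.arr a = τ₃.arr a := fun a ha => split_arr F₄ (by omega)
  change IsMating _ hd β₂ at mβ₂
  change IsMating _ tl α₂ at mα₂
  change Swaps _ α₂ (τ₄.arr 36) at sα₂
  change Swaps _ β₂ (τ₄.arr 36) at sβ₂
  rw [← e4] at mα₂ mβ₂ sα₂ sβ₂
  have hc₂ : ∀ i < 4 * n, τ₄.arr 36 i = 1 ∨ τ₄.arr 36 i = 2 := fun i hi => sα₂.col hi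
  have htwo : (∀ x < n, ∀ p, (p = 1 ∨ p = 2) →
      Nat.count (fun i => tl i = x ∧ τ₄.arr 36 i = p) (4 * n) = 2) ∧ (∀ x < n, ∀ p,
      (p = 1 ∨ p = 2) → Nat.count (fun i => hd i = x ∧ τ₄.arr 36 i = p) (4 * n) = 2) := by
    refine ⟨fun x hx p hp => ?_, fun x hx p hp => ?_⟩
    · have h1 := sα₂.count mα₂ x hp
      have h2 := (hfour x hx).1
      omega
    · have h1 := sβ₂.count mβ₂ x hp
      have h2 := (hfour x hx).2
      omega
  refine Ensures.seq (ensures_key s₄.r0 s₄.r2 (by omega) fun i hi => ?_) fun τ₅ F₅ ⟨k40, k41⟩ => ?_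
  · rw [a₄ 30 (by omega), a₄ 31 (by omega), ← htl, ← hhd]
    have := hlt i hi
    omega
  have s₅ := s₄.of_reg fun x hx => key_reg F₅ hx
  have a₅ : ∀ a, a < 40 ∨ 42 ≤ a → τ₅.arr a = τ₄.arr a := fun a ha => key_arr F₅ ha
  rw [a₄ 30 (by omega), ← htl] at k40
  rw [a₄ 31 (by omega), ← hhd] at k41
  have hk : ∀ i < 4 * n, τ₅.arr 40 i ≤ W ∧ τ₅.arr 41 i ≤ W := fun i hi => by
    have := hlt i hi
    rw [k40 i hi, k41 i hi]
    split_ifs <;> omega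
  -- the second colour
  have ev := k40.even (fun i hi => (hlt i hi).1) hc₂ htwo.1
  have ev' := k41.even (fun i hi => (hlt i hi).2) hc₂ htwo.2
  rw [e4] at ev ev' hk
  refine Ensures.mono (ensures_split (b := 40) (N := 2) (I := 7) (K := 2 * n) (by omega) (by omega)
    (by rw [s₅.r2, e4]) s₅.r7 (by omega) (by omega) hk
    (fun a h1 h2 => by
      rw [a₅ a (by omega), a₄ a (by omega), a₃ a (by omega), a₂ a (by omega), a₁ a (by omega)]
      exact h9 a (by omega)) ev ev') le_rfl fun τ₆ F₆ ⟨⟨α₃, mα₃, sα₃⟩, β₃, mβ₃, sβ₃⟩ => ?_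
  have s₆ := s₅.of_reg fun x hx => split_reg F₆ hx
  have a₆ : ∀ a, a < 42 ∨ 47 ≤ a → τ₆.arr a = τ₅.arr a := fun a ha => split_arr F₆ (by omega)
  change IsMating _ (τ₅.arr 41) β₃ at mβ₃
  change Swaps _ α₃ (τ₆.arr 46) at sα₃
  change Swaps _ β₃ (τ₆.arr 46) at sβ₃
  rw [← e4] at mα₃ mβ₃ sα₃ sβ₃
  have e30 : τ₆.arr 30 = tl := by rw [a₆ 30 (by omega), a₅ 30 (by omega), a₄ 30 (by omega)]
  have e31 : τ₆.arr 31 = hd := by rw [a₆ 31 (by omega), a₅ 31 (by omega), a₄ 31 (by omega)]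
  have e36 : τ₆.arr 36 = τ₄.arr 36 := by rw [a₆ 36 (by omega), a₅ 36 (by omega)]
  rw [e30, e31, e36]
  refine ⟨s₆, fun a ha => ?_, ⟨hlt, hc₂, fun i hi => sα₃.col hi, fun x hx p q hp hq => ?_,
    fun x hx p q hp hq => ?_⟩, hH.le, fun i hi => ?_⟩
  · rw [a₆ a (by omega), a₅ a (by omega), a₄ a (by omega), a₃ a (by omega), a₂ a (by omega),
      a₁ a (by omega)]
  · exact k40.count_one (fun i hi => (hlt i hi).1) hc₂ htwo.1 sα₃ mα₃ hx hp hq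
  · exact k41.count_one (fun i hi => (hlt i hi).2) hc₂ htwo.2 sβ₃ mβ₃ hx hp hq
  · have hi' : i < 4 * n := by have := hH.le; omega
    rw [← hH.fst i hi, ← hH.snd i hi]
    by_cases h1 : τ₂.arr 26 (2 * i) = 1
    · exact .inl (hO.one i hi' h1)
    · exact .inr (hO.two i hi' h1)

end RamProgram

/-! ### The order of the vertices, and the whole program -/

namespace RamProgram

open RamExpr

/-- The order of the vertices for the family of edges whose permutations are in the arrays `b` and
`b + 1`. -/
def orderProgram (b : ℕ) : RamProgram :=
  .seq (.seq (.assign 11 (lit 0)) (.seq (.assign 12 (lit 0)) (forLoop 10 5 (walkBody b))))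
    (forLoop 10 0 (slotBody b))

theorem order_arr {b : ℕ} {σ τ : RamState} (h : Frame (orderProgram b) σ τ) {a : ℕ}
    (ha : a < b + 3 ∨ b + 7 ≤ a) : τ.arr a = σ.arr a :=
  h.arr a (by simp [orderProgram, forLoop, walkBody, slotBody, writesArr]; omega)

theorem order_reg {b : ℕ} {σ τ : RamState} (h : Frame (orderProgram b) σ τ) {x : ℕ}
    (hx : x < 10) : τ.reg x = σ.reg x :=
  h.reg x (by simp [orderProgram, forLoop, walkBody, slotBody, writesReg]; omega)

/-- The arrays from `b` on contain two permutations and an order of the vertices. -/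
structure HasOrder (n b : ℕ) (τ : RamState) : Prop where
  walk : IsWalk n (τ.arr b) (τ.arr (b + 3)) (τ.arr (b + 4)) (τ.arr (b + 5))
  slot : IsSlot n (τ.arr (b + 1)) (τ.arr (b + 3)) (τ.arr (b + 4)) (τ.arr (b + 5)) (τ.arr (b + 6))

theorem HasOrder.of_arr {n b : ℕ} {σ τ : RamState} (h : HasOrder n b σ)
    (ha : ∀ a, b ≤ a → a ≤ b + 6 → τ.arr a = σ.arr a) : HasOrder n b τ := by
  obtain ⟨h1, h2⟩ := h
  constructor <;>
    rw [ha _ (by omega) (by omega), ha _ (by omega) (by omega), ha _ (by omega) (by omega),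
      ha _ (by omega) (by omega)]
  · exact h1
  · rw [ha _ (by omega) (by omega)]; exact h2

/-- The upper bound makes the area quadratic; the lower one keeps coordinates positive, so that
subtracting 1 for a bend is exact. -/
theorem HasOrder.slot_le {n b : ℕ} {τ : RamState} (h : HasOrder n b τ) {v : ℕ} (hv : v < n) :
    1 ≤ τ.arr (b + 6) v ∧ τ.arr (b + 6) v ≤ 2 * n := by
  have h1 := h.slot.bounds h.walk hv
  have h2 := h.walk.fin_le v hv
  have h3 := h.walk.pos v hv
  omega

theorem ensures_order {W n m b : ℕ} {σ : RamState} (hs : HasSizes n m σ) (hW : 2 * n ≤ W)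
    (hπ : IsPerm n (σ.arr b)) (hρ : IsPerm n (σ.arr (b + 1)))
    (h0 : σ.arr (b + 3) = fun _ => 0) :
    Ensures W (orderProgram b) σ (140 * n + 16) (HasOrder n b) := by
  refine Ensures.mono (B := (n * 80 + 10) + (n * 60 + 6))
    (Ensures.seq (ensures_walk (b := b) (I := 5) (by omega) hs.r5 hW h0 hπ)
      fun τ F hw => ?_) (by omega) fun _ _ h => h
  have a₁ : ∀ a, a < b + 3 ∨ b + 6 ≤ a → τ.arr a = σ.arr a := fun a ha =>
    F.arr a (by simp [forLoop, walkBody, writesArr]; omega)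
  have r₁ : ∀ x, x < 10 → τ.reg x = σ.reg x := fun x hx =>
    F.reg x (by simp [forLoop, walkBody, writesReg]; omega)
  rw [← a₁ b (by omega)] at hw
  refine Ensures.mono (ensures_slot (b := b) (I := 0) (π := τ.arr b) (by omega)
    (by rw [r₁ 0 (by omega), hs.r0]) hW (by rw [a₁ _ (by omega)]; exact hρ) hw) le_rfl
    fun υ F' h => ?_
  have a₂ : ∀ a, a ≠ b + 6 → υ.arr a = τ.arr a := fun a ha =>
    F'.arr a (by simp [forLoop, slotBody, writesArr, ha])
  constructor
  · rw [a₂ b (by omega), a₂ (b + 3) (by omega), a₂ (b + 4) (by omega), a₂ (b + 5) (by omega)]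
    exact hw
  · rw [a₂ (b + 1) (by omega), a₂ (b + 3) (by omega), a₂ (b + 4) (by omega),
      a₂ (b + 5) (by omega)]
    exact h

/-- The numbers of iterations of the loops. -/
def sizesProgram : RamProgram :=
  .seq (.assign 5 (add (reg 0) (reg 0))) (.seq (.assign 2 (add (reg 5) (reg 5)))
    (.seq (.assign 3 (add (reg 2) (reg 2))) (.seq (.assign 7 (add (reg 2) (reg 5)))
      (.seq (.assign 6 (add (reg 7) (reg 7)))
        (.assign 4 (sub (add (reg 3) (reg 0)) (add (reg 1) (reg 1))))))))

theorem ensures_sizes {W n m : ℕ} {σ : RamState} (h0 : σ.reg 0 = n) (h1 : σ.reg 1 = m)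
    (hW : 12 * n ≤ W) :
    Ensures W sizesProgram σ 30 fun τ => HasSizes n m τ := by
  refine Ensures.mono (Ensures.of_wp (Q := HasSizes n m) ?_) (by decide) fun _ _ h => h
  simp only [sizesProgram, Wp, RamExpr.eval, reg_setReg, if_true, if_false, Nat.reduceEqDiff, h0,
    h1, OfNat.zero_ne_ofNat, OfNat.one_ne_ofNat]
  refine ⟨by omega, by omega, by omega, by omega, by omega, by omega, ?_⟩
  constructor <;> simp [reg_setReg, h0, h1] <;> omega

/-- The drawing program. -/
def drawProgram : RamProgram :=
  .seq sizesProgram (.seq factorProgram (.seq (forLoop 10 2 permBody)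
    (.seq (orderProgram 50) (.seq (orderProgram 60)
      (.seq (forLoop 10 0 coordBody) (forLoop 10 1 bendsBody))))))

/-- The final state of the drawing program, for edges whose ends are listed by `a` and `b`. -/
structure HasDrawing (n m : ℕ) (a b : ℕ → ℕ) (σ τ : RamState) : Prop where
  le : m ≤ 4 * n
  factor : IsFactoring n (σ.arr 30) (σ.arr 31) (σ.arr 36) (σ.arr 46)
  ends : ∀ i < m, (σ.arr 30 i = a i ∧ σ.arr 31 i = b i) ∨ (σ.arr 30 i = b i ∧ σ.arr 31 i = a i)
  arr0 : σ.arr 0 = a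
  arr1 : σ.arr 1 = b
  map50 : IsClassMap (4 * n) (σ.arr 30) (σ.arr 31) (σ.arr 36) (σ.arr 46) 1 1 (σ.arr 50)
  map51 : IsClassMap (4 * n) (σ.arr 30) (σ.arr 31) (σ.arr 36) (σ.arr 46) 1 2 (σ.arr 51)
  map60 : IsClassMap (4 * n) (σ.arr 30) (σ.arr 31) (σ.arr 36) (σ.arr 46) 2 1 (σ.arr 60)
  map61 : IsClassMap (4 * n) (σ.arr 30) (σ.arr 31) (σ.arr 36) (σ.arr 46) 2 2 (σ.arr 61)
  order50 : HasOrder n 50 σ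
  order60 : HasOrder n 60 σ
  coord : ∀ v < n, σ.arr 2 v = 10 * σ.arr 56 v ∧ σ.arr 3 v = 10 * σ.arr 66 v
  arr2 : τ.arr 2 = σ.arr 2
  arr3 : τ.arr 3 = σ.arr 3
  bends : ∀ i < m, HasBends n σ τ i

/-- The state `υ` is the one before the last loop. It determines the drawing, and the last loop only
writes out the bends. -/
theorem ensures_draw {W n m : ℕ} {σ : RamState} (h0 : σ.reg 0 = n) (h1 : σ.reg 1 = m)
    (hW : 100 * n + 20 ≤ W)
    (ha : ∀ i < m, σ.arr 0 i < n ∧ σ.arr 1 i < n) (h9 : ∀ a, 2 ≤ a → σ.arr a = fun _ => 0)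
    (hdeg : ∀ x < n, Nat.count (fun j => halfVertex (σ.arr 0) (σ.arr 1) j = x) (2 * m) ≤ 8) :
    Ensures W drawProgram σ (10000 * n + 1000) fun τ =>
      ∃ υ, HasDrawing n m (σ.arr 0) (σ.arr 1) υ τ := by
  refine Ensures.mono (B := 30 + ((6000 * n + 300) + ((4 * n * 60 + 6) + ((140 * n + 16) +
    ((140 * n + 16) + ((n * 80 + 6) + (4 * n * 200 + 6)))))))
    (Ensures.seq (ensures_sizes h0 h1 (by omega)) fun τ₀ F₀ s₀ => ?_) (by omega) fun _ _ h => h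
  have a₀ : ∀ a, τ₀.arr a = σ.arr a := fun a => F₀.arr a (by simp [sizesProgram, writesArr])
  refine Ensures.seq (ensures_factor s₀ hW ?_ ?_ ?_) fun τ₁ F₁ ⟨s₁, a₁, hf, hm, he⟩ => ?_
  · rw [a₀, a₀]; exact ha
  · intro a h; rw [a₀, h9 a h]
  · rw [a₀, a₀]; exact hdeg
  rw [a₀, a₀] at he
  have z₁ : ∀ a, 47 ≤ a → τ₁.arr a = fun _ => 0 := fun a h => by
    rw [a₁ a (.inr h), a₀, h9 a (by omega)]
  refine Ensures.seq (ensures_perm s₁.r2 (by omega) hf) fun τ₂ F₂ ⟨⟨m50, m51⟩, m60, m61⟩ => ?_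
  have a₂ : ∀ a, a < 50 ∨ (51 < a ∧ a < 60) ∨ 61 < a → τ₂.arr a = τ₁.arr a := fun a ha =>
    F₂.arr a (by simp [forLoop, permBody, writesArr]; omega)
  have s₂ := s₁.of_reg fun x (hx : x < 10) => F₂.reg x
    (by simp [forLoop, permBody, writesReg]; omega)
  refine Ensures.seq (ensures_order (b := 50) s₂ (by omega) (m50.isPerm hf (by simp) (by simp))
    (m51.isPerm hf (by simp) (by simp))
    (by rw [a₂ _ (by omega), z₁ _ (by omega)])) fun τ₃ F₃ o50 => ?_
  have a₃ : ∀ a, a < 53 ∨ 57 ≤ a → τ₃.arr a = τ₂.arr a := fun a ha => order_arr F₃ ha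
  have s₃ := s₂.of_reg fun x hx => order_reg F₃ hx
  refine Ensures.seq (ensures_order (b := 60) s₃ (by omega)
    (by rw [a₃ _ (by omega)]; exact m60.isPerm hf (by simp) (by simp))
    (by rw [a₃ _ (by omega)]; exact m61.isPerm hf (by simp) (by simp))
    (by rw [a₃ _ (by omega), a₂ _ (by omega), z₁ _ (by omega)])) fun τ₄ F₄ o60 => ?_
  have a₄ : ∀ a, a < 63 ∨ 67 ≤ a → τ₄.arr a = τ₃.arr a := fun a ha => order_arr F₄ ha
  have s₄ := s₃.of_reg fun x hx => order_reg F₄ hx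
  have o50' : HasOrder n 50 τ₄ := o50.of_arr fun a h1 h2 => a₄ a (by omega)
  have hX : ∀ v < n, τ₄.arr 56 v ≤ 2 * n ∧ τ₄.arr 66 v ≤ 2 * n := fun v hv =>
    ⟨(o50'.slot_le hv).2, (o60.slot_le hv).2⟩
  refine Ensures.seq (ensures_coord s₄.r0 (by omega) fun v hv => ?_) fun τ₅ F₅ hc => ?_
  · have := hX v hv
    omega
  have a₅ : ∀ a, a < 2 ∨ 4 ≤ a → τ₅.arr a = τ₄.arr a := fun a ha =>
    F₅.arr a (by simp [forLoop, coordBody, writesArr]; omega)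
  have s₅ := s₄.of_reg fun x (hx : x < 10) => F₅.reg x
    (by simp [forLoop, coordBody, writesReg]; omega)
  have e : ∀ a, a < 2 ∨ (4 ≤ a ∧ a < 50) → τ₅.arr a = τ₁.arr a := fun a ha => by
    rw [a₅ a (by omega), a₄ a (by omega), a₃ a (by omega), a₂ a (by omega)]
  have e' : ∀ a, 50 ≤ a → a < 53 ∨ (60 ≤ a ∧ a < 63) → τ₅.arr a = τ₂.arr a := fun a h ha => by
    rw [a₅ a (by omega), a₄ a (by omega), a₃ a (by omega)]
  have e0 : τ₅.arr 0 = σ.arr 0 := by rw [e 0 (by omega), a₁ 0 (by omega), a₀]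
  have e1 : τ₅.arr 1 = σ.arr 1 := by rw [e 1 (by omega), a₁ 1 (by omega), a₀]
  refine Ensures.mono (ensures_bends s₅.r0 s₅.r1 (by omega) (by omega) (by omega) ?_ ?_ ?_)
    (by omega) fun τ₆ F₆ hb => ⟨τ₅, ?_⟩
  · intro i hi
    rw [e 30 (by omega), e 31 (by omega)]
    exact hf.lt i (by omega)
  · rw [e0, e1]; exact ha
  · intro v hv
    have := hX v hv
    have := hc v hv
    rw [a₅ 56 (by omega), a₅ 66 (by omega)]
    omega
  have e30 := e 30 (by omega)
  have e31 := e 31 (by omega)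
  have e36 := e 36 (by omega)
  have e46 := e 46 (by omega)
  refine ⟨hm, by rw [e30, e31, e36, e46]; exact hf, by rw [e30, e31]; exact he, e0, e1,
    by rw [e30, e31, e36, e46, e' 50 (by omega) (by omega)]; exact m50,
    by rw [e30, e31, e36, e46, e' 51 (by omega) (by omega)]; exact m51,
    by rw [e30, e31, e36, e46, e' 60 (by omega) (by omega)]; exact m60,
    by rw [e30, e31, e36, e46, e' 61 (by omega) (by omega)]; exact m61,
    o50'.of_arr fun a h1 h2 => a₅ a (by omega), o60.of_arr fun a h1 h2 => a₅ a (by omega),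
    by rw [a₅ 56 (by omega), a₅ 66 (by omega)]; exact hc, F₆.arr 2 (by decide),
    F₆.arr 3 (by decide), hb⟩

end RamProgram

/-! ### The drawing computed by the program -/

section ColumnsOfClasses

variable {n : ℕ} {π ρ r root fin X T H : ℕ → ℕ} {S path : ℕ → Prop} [DecidablePred path]

/-- With vertices at multiples of 10 and columns at residues 2 to 5, every column is at least 2 away
from all vertices and at most 5 away from those where its edge is slanted. -/
theorem IsTwoClass.isColumns (h : IsTwoClass n π ρ T H S path) (hX : IsSlot n ρ r root fin X)
    (hw : IsWalk n π r root fin) {x y : Fin n → ℤ} {c : Sym2 (Fin n) → ℤ}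
    {port : Sym2 (Fin n) → Fin n → Bool} {F : Sym2 (Fin n) → Prop} {idx : Sym2 (Fin n) → ℕ}
    (hS : ∀ e, F e → S (idx e))
    (hF : ∀ u v, F s(u, v) → (T (idx s(u, v)) = u ∧ H (idx s(u, v)) = v) ∨
      (T (idx s(u, v)) = v ∧ H (idx s(u, v)) = u))
    (hc : ∀ e, F e → c e = colOf X root (path (idx e)) (T (idx e)) (H (idx e)))
    (hp : ∀ e, F e → ∀ u, port e u = true ↔
      portOf n X root (path (idx e)) (T (idx e)) (H (idx e)) = u)
    (hx : ∀ v, x v = 10 * X v)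
    (hy : ∀ u v, u ≠ v → y u + 10 ≤ y v ∨ y v + 10 ≤ y u) : IsColumns x y c port F := by
  have hidx : ∀ e e', F e → F e' → idx e = idx e' → e = e' := by
    intro e e' he he' hee
    induction e using Sym2.ind with | _ u v =>
    induction e' using Sym2.ind with | _ u' v' =>
    have h1 := hF u v he
    have h2 := hF u' v' he'
    rw [hee] at h1
    rw [Sym2.eq_iff]
    simp only [Fin.ext_iff]
    omega
  have hfalse : ∀ e, F e → ∀ u, port e u = false →
      portOf n X root (path (idx e)) (T (idx e)) (H (idx e)) ≠ u := fun e he u hu hq => by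
    rw [(hp e he u).2 hq] at hu; exact Bool.noConfusion hu
  refine ⟨fun u v huv => ?_, hy, fun e he w => ?_, fun e e' he he' hee => ?_,
    fun u v he hu => ?_, fun u v he hu => ?_, fun u v v' he he' hne hu hu' => ?_⟩
  · have : X u ≠ X v := fun hu => huv (Fin.ext (hX.inj hw u.2 v.2 hu))
    rw [hx, hx]
    omega
  · rw [hc e he, hx]
    have := colOf_mod X root (path (idx e)) (T (idx e)) (H (idx e))
    omega
  · rw [hc e he, hc e' he'] at hee
    exact hidx e e' he he' (h.colOf_inj hX hw (hS e he) (hS e' he') (by exact_mod_cast hee))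
  · have h1 := hF u v he
    have := colOf_near (X := X) (u := u) (by omega) (hfalse _ he u hu)
    rw [hc _ he, hx]
    omega
  · have h1 := (hp _ he u).1 hu
    have h2 := hF u v he
    have h3 := h.ne _ (hS _ he)
    by_contra hv
    have h4 := (hp _ he v).1 (by simpa using hv)
    omega
  · have := h.opposite hX hw (hS _ he) (hS _ he') (fun hi => hne (hidx _ _ he he' hi)) u.2
      ((hp _ he u).1 hu) ((hp _ he' u).1 hu')
    rw [hc _ he, hc _ he', hx]
    omega

end ColumnsOfClasses

namespace RamProgram

variable {n m : ℕ} {a b : ℕ → ℕ} {σ τ : RamState}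

/-- The added edges are needed for `π` and `ρ` to be permutations, but only the edges below `m` are
drawn, and only these are known to be free of loops and repetitions. -/
theorem HasDrawing.isTwoClass (h : HasDrawing n m a b σ τ) (hab : ∀ i < m, a i ≠ b i)
    (hu : ∀ i < m, ∀ j < m, (a i = a j ∧ b i = b j) ∨ (a i = b j ∧ b i = a j) → i = j)
    {p : ℕ} (hp : p = 1 ∨ p = 2) {π ρ : ℕ → ℕ}
    (hπ : IsClassMap (4 * n) (σ.arr 30) (σ.arr 31) (σ.arr 36) (σ.arr 46) p 1 π)
    (hρ : IsClassMap (4 * n) (σ.arr 30) (σ.arr 31) (σ.arr 36) (σ.arr 46) p 2 ρ) :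
    IsTwoClass n π ρ (σ.arr 30) (σ.arr 31) (fun i => i < m ∧ σ.arr 36 i = p)
      fun i => σ.arr 46 i = 1 := by
  have hm := h.le
  refine ⟨hπ.isPerm h.factor hp (by simp), hρ.isPerm h.factor hp (by simp),
    fun i hi => h.factor.lt i (by omega), fun i hi => ?_, fun i j hi hj h1 h2 => ?_,
    fun i j hi hj h1 h2 => ?_, fun i hi h1 => (hπ i (by omega) hi.2 h1).symm, fun i hi h1 => ?_⟩
  · have := hab i hi.1
    have := h.ends i hi.1
    omega
  · have := h.ends i hi.1
    have := h.ends j hj.1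
    exact hu i hi.1 j hj.1 (by omega)
  · have := h.ends i hi.1
    have := h.ends j hj.1
    exact hu i hi.1 j hj.1 (by omega)
  · refine (hρ i (by omega) hi.2 ?_).symm
    have := h.factor.col₃ i (by omega)
    omega

/-- The column or row of the edge `i`. -/
def edgeLine (σ : RamState) (i : ℕ) : ℕ :=
  if σ.arr 36 i = 1 then colOf (σ.arr 56) (σ.arr 54) (σ.arr 46 i = 1) (σ.arr 30 i) (σ.arr 31 i)
  else colOf (σ.arr 66) (σ.arr 64) (σ.arr 46 i = 1) (σ.arr 30 i) (σ.arr 31 i)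

/-- The vertex at which the edge `i` uses a port. -/
def edgePort (n : ℕ) (σ : RamState) (i : ℕ) : ℕ :=
  if σ.arr 36 i = 1 then portOf n (σ.arr 56) (σ.arr 54) (σ.arr 46 i = 1) (σ.arr 30 i) (σ.arr 31 i)
  else portOf n (σ.arr 66) (σ.arr 64) (σ.arr 46 i = 1) (σ.arr 30 i) (σ.arr 31 i)

theorem cast_bendHeight {y : ℕ → ℕ} {p : ℕ} {u v : Fin n} (hu : 1 ≤ y u)
    {port : Sym2 (Fin n) → Fin n → Bool} {e : Sym2 (Fin n)} (hp : port e u = decide (p = u)) :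
    (bendHeight y p u v : ℤ) = y u + bendLift (fun v : Fin n => (y v : ℤ)) port e u v := by
  unfold bendHeight bendLift
  rw [hp]
  by_cases h1 : p = u
  · simp [h1]
  · by_cases h2 : y u < y v
    · simp [h1, Ne.symm h1, h2]
    · simp [h1, Ne.symm h1, h2]; omega

end RamProgram

/-! ### The drawing obtained from an edge list -/

namespace EdgeList

variable {n m : ℕ} {G : SimpleGraph (Fin n)} (E : EdgeList G m)

open Classical in
/-- The position of an edge in the list. -/
noncomputable def index (e : Sym2 (Fin n)) : ℕ :=
  if h : ∃ i, (E.dart i).edge = e then (h.choose : ℕ) else 0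

theorem edge_injective {i j : Fin m} (h : (E.dart i).edge = (E.dart j).edge) : i = j :=
  (E.existsUnique_edge (E.dart j)).unique h rfl

theorem index_edge (i : Fin m) : E.index (E.dart i).edge = i := by
  have h : ∃ j, (E.dart j).edge = (E.dart i).edge := ⟨i, rfl⟩
  rw [index, dif_pos h, E.edge_injective h.choose_spec]

theorem exists_edge {e : Sym2 (Fin n)} (he : e ∈ G.edgeSet) : ∃ i, (E.dart i).edge = e := by
  induction e using Sym2.ind with | _ u v =>
  obtain ⟨i, hi, _⟩ := E.existsUnique_edge ⟨(u, v), he⟩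
  exact ⟨i, hi⟩

theorem index_lt {e : Sym2 (Fin n)} (he : e ∈ G.edgeSet) : E.index e < m := by
  obtain ⟨i, rfl⟩ := E.exists_edge he
  rw [E.index_edge]
  exact i.2

theorem initialState_arr {a : ℕ} (ha : 2 ≤ a) : E.initialState.arr a = fun _ => 0 := by
  funext i
  simp only [initialState]
  split_ifs <;> first | rfl | omega

theorem initialState_fst (i : Fin m) : E.initialState.arr 0 i = (E.dart i).fst := by
  simp [initialState]

theorem initialState_snd (i : Fin m) : E.initialState.arr 1 i = (E.dart i).snd := by
  simp [initialState]

/-- At most `G.degree x` half-edges of the list belong to the vertex `x`. -/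
theorem count_halfVertex_le [DecidableRel G.Adj] (x : Fin n) :
    Nat.count (fun j => halfVertex (E.initialState.arr 0) (E.initialState.arr 1) j = x) (2 * m) ≤
      G.degree x := by
  rw [Nat.count_eq_card_filter_range, ← G.card_neighborFinset_eq_degree]
  -- A neighbour `v` is sent to the half at `x` of the edge between `x` and `v`: the first half if
  -- the edge is listed from `x` to `v`, the second half otherwise.
  refine Finset.card_le_card_of_surjOn (fun v => 2 * E.index s(x, v) +
    if ∃ i, (E.dart i).fst = x ∧ (E.dart i).snd = v then 0 else 1) ?_
  intro j hj
  simp only [Finset.coe_filter, Finset.mem_range, Set.mem_ofPred_eq] at hj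
  obtain ⟨hj, hx⟩ := hj
  obtain ⟨i, hi⟩ : ∃ i : Fin m, (i : ℕ) = j / 2 := ⟨⟨j / 2, by omega⟩, rfl⟩
  have hind := E.index_edge i
  unfold halfVertex at hx
  rw [← hi, initialState_fst, initialState_snd] at hx
  split_ifs at hx with h2
  · have hx : (E.dart i).fst = x := Fin.ext hx
    refine ⟨(E.dart i).snd, ?_, ?_⟩
    · simp only [Finset.mem_coe, SimpleGraph.mem_neighborFinset]
      rw [← hx]; exact (E.dart i).adj
    · simp only
      rw [if_pos ⟨i, hx, rfl⟩, ← hx, ← edge_eq_mk, hind]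
      omega
  · have hx : (E.dart i).snd = x := Fin.ext hx
    refine ⟨(E.dart i).fst, ?_, ?_⟩
    · simp only [Finset.mem_coe, SimpleGraph.mem_neighborFinset]
      rw [← hx]; exact (E.dart i).adj.symm
    · simp only
      rw [if_neg, ← hx, ← edge_eq_mk', hind]
      · omega
      · rintro ⟨k, h3, h4⟩
        have : k = i := E.edge_injective (by
          rw [edge_eq_mk, edge_eq_mk' (d := E.dart i), h3, h4, hx])
        subst this
        exact (E.dart k).adj.ne (by rw [h3, hx])

/-- The drawing whose coordinates have been computed in the state `σ`. -/
noncomputable def drawing (σ : RamState) : PolylineDrawing G :=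
  columnDrawing G (fun v => σ.arr 2 v) (fun v => σ.arr 3 v)
    (fun e => RamProgram.edgeLine σ (E.index e))
    (fun e u => decide (RamProgram.edgePort n σ (E.index e) = u))
    (fun e => decide (σ.arr 36 (E.index e) = 1))

variable {σ τ : RamState}

section

variable (h : RamProgram.HasDrawing n m (E.initialState.arr 0) (E.initialState.arr 1) σ τ)

include h

theorem isTwoClass_of_hasDrawing {p : ℕ} (hp : p = 1 ∨ p = 2) {π ρ : ℕ → ℕ}
    (hπ : IsClassMap (4 * n) (σ.arr 30) (σ.arr 31) (σ.arr 36) (σ.arr 46) p 1 π)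
    (hρ : IsClassMap (4 * n) (σ.arr 30) (σ.arr 31) (σ.arr 36) (σ.arr 46) p 2 ρ) :
    IsTwoClass n π ρ (σ.arr 30) (σ.arr 31) (fun i => i < m ∧ σ.arr 36 i = p)
      fun i => σ.arr 46 i = 1 := by
  refine h.isTwoClass ?_ ?_ hp hπ hρ
  · intro i hi
    have := (E.dart ⟨i, hi⟩).adj.ne
    rw [E.initialState_fst ⟨i, hi⟩, E.initialState_snd ⟨i, hi⟩]
    exact fun h => this (Fin.ext h)
  · intro i hi j hj
    rw [E.initialState_fst ⟨i, hi⟩, E.initialState_snd ⟨i, hi⟩, E.initialState_fst ⟨j, hj⟩,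
      E.initialState_snd ⟨j, hj⟩]
    intro he
    have : (⟨i, hi⟩ : Fin m) = ⟨j, hj⟩ := E.edge_injective (by
      rw [edge_eq_mk, edge_eq_mk (d := E.dart ⟨j, hj⟩), Sym2.eq_iff]
      simp only [Fin.ext_iff]
      exact he)
    exact congrArg Fin.val this

theorem ends_of_hasDrawing {u v : Fin n} (he : s(u, v) ∈ G.edgeSet) :
    (σ.arr 30 (E.index s(u, v)) = u ∧ σ.arr 31 (E.index s(u, v)) = v) ∨
      (σ.arr 30 (E.index s(u, v)) = v ∧ σ.arr 31 (E.index s(u, v)) = u) := by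
  obtain ⟨i, hi⟩ := E.exists_edge he
  have h1 := h.ends i i.2
  rw [E.initialState_fst, E.initialState_snd] at h1
  rw [← hi, E.index_edge]
  rw [edge_eq_mk, Sym2.eq_iff] at hi
  simp only [Fin.ext_iff] at hi
  omega

theorem drawing_isApRAC : (E.drawing σ).IsApRAC 2 := by
  have hX : ∀ v : Fin n, (σ.arr 2 v : ℤ) = 10 * σ.arr 56 v := fun v => by
    rw [(h.coord v v.2).1]; push_cast; rfl
  have hY : ∀ v : Fin n, (σ.arr 3 v : ℤ) = 10 * σ.arr 66 v := fun v => by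
    rw [(h.coord v v.2).2]; push_cast; rfl
  refine columnDrawing_isApRAC ?_ ?_
  · refine (E.isTwoClass_of_hasDrawing h (.inl rfl) h.map50 h.map51).isColumns h.order50.slot
      h.order50.walk (idx := E.index) (fun e he => ⟨E.index_lt he.1, of_decide_eq_true he.2⟩)
      (fun u v he => E.ends_of_hasDrawing h he.1) (fun e he => ?_) (fun e he u => ?_) hX
      fun u v huv => ?_
    · rw [RamProgram.edgeLine, if_pos (of_decide_eq_true he.2)]
    · rw [RamProgram.edgePort, if_pos (of_decide_eq_true he.2), decide_eq_true_iff]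
    · have : σ.arr 66 u ≠ σ.arr 66 v := fun hu =>
        huv (Fin.ext (h.order60.slot.inj h.order60.walk u.2 v.2 hu))
      rw [hY, hY]
      omega
  · have hne : ∀ e, e ∈ G.edgeSet → decide (σ.arr 36 (E.index e) = 1) = false →
        σ.arr 36 (E.index e) = 2 := fun e he hf => by
      have h1 := of_decide_eq_false hf
      have h2 := h.factor.col₂ (E.index e) (by have := E.index_lt he; have := h.le; omega)
      omega
    refine (E.isTwoClass_of_hasDrawing h (.inr rfl) h.map60 h.map61).isColumns h.order60.slot
      h.order60.walk (idx := E.index) (fun e he => ⟨E.index_lt he.1, hne e he.1 he.2⟩)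
      (fun u v he => E.ends_of_hasDrawing h he.1) (fun e he => ?_) (fun e he u => ?_) hY
      fun u v huv => ?_
    · rw [RamProgram.edgeLine, if_neg (of_decide_eq_false he.2)]
    · rw [RamProgram.edgePort, if_neg (of_decide_eq_false he.2), decide_eq_true_iff]
    · have : σ.arr 56 u ≠ σ.arr 56 v := fun hu =>
        huv (Fin.ext (h.order50.slot.inj h.order50.walk u.2 v.2 hu))
      rw [hX, hX]
      omega

theorem outputs_drawing : E.Outputs τ (E.drawing σ) := by
  refine ⟨fun v => by rw [h.arr2, h.arr3]; rfl, fun i => ?_⟩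
  obtain ⟨h4, h5, h6⟩ := h.bends i i.2
  have hpos : ∀ v : Fin n, 1 ≤ σ.arr 2 v ∧ 1 ≤ σ.arr 3 v := fun v => by
    have h1 := h.coord v v.2
    have h2 : 1 ≤ σ.arr 56 v ∧ σ.arr 56 v ≤ 2 * n := h.order50.slot_le v.2
    have h3 : 1 ≤ σ.arr 66 v ∧ σ.arr 66 v ≤ 2 * n := h.order60.slot_le v.2
    omega
  rw [h.arr0, h.arr1, E.initialState_fst, E.initialState_snd] at h5 h6
  simp only [drawing, columnDrawing, E.index_edge, h4, decide_eq_true_eq]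
  split_ifs with hv
  · obtain ⟨e5, e7, e6, e8⟩ := h5 hv
    simp only [List.range_succ, List.range_zero, List.nil_append, List.cons_append, List.map_cons,
      List.map_nil, Nat.reduceMul, Nat.reduceAdd, e5, e6, e7, e8, RamProgram.edgeLine, if_pos hv]
    rw [RamProgram.cast_bendHeight (hpos _).2, RamProgram.cast_bendHeight (hpos _).2] <;>
      simp [E.index_edge, RamProgram.edgePort, hv]
  · obtain ⟨e6, e8, e5, e7⟩ := h6 hv
    simp only [List.range_succ, List.range_zero, List.nil_append, List.cons_append, List.map_cons,
      List.map_nil, Nat.reduceMul, Nat.reduceAdd, e5, e6, e7, e8, RamProgram.edgeLine, if_neg hv]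
    rw [RamProgram.cast_bendHeight (hpos _).1, RamProgram.cast_bendHeight (hpos _).1] <;>
      simp [E.index_edge, RamProgram.edgePort, hv]

/-- The slots are at most `2 * n`, so vertices have coordinates up to `20 * n`; columns and rows
exceed this by at most 5, displaced bends by at most 1. -/
theorem drawing_area_le (hn : 0 < n) : (E.drawing σ).area ≤ (20 * n + 6) ^ 2 := by
  have : Nonempty (Fin n) := ⟨⟨0, hn⟩⟩
  have hb : ∀ v < n, 10 ≤ σ.arr 2 v ∧ σ.arr 2 v ≤ 20 * n ∧ 10 ≤ σ.arr 3 v ∧ σ.arr 3 v ≤ 20 * n ∧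
      σ.arr 2 v = 10 * σ.arr 56 v ∧ σ.arr 3 v = 10 * σ.arr 66 v := fun v hv => by
    have h1 := h.coord v hv
    have h2 : 1 ≤ σ.arr 56 v ∧ σ.arr 56 v ≤ 2 * n := h.order50.slot_le hv
    have h3 : 1 ≤ σ.arr 66 v ∧ σ.arr 66 v ≤ 2 * n := h.order60.slot_le hv
    omega
  have hl : ∀ e ∈ G.edgeSet, RamProgram.edgeLine σ (E.index e) ≤ 20 * n + 5 := fun e he => by
    have h1 := h.factor.lt (E.index e) (by have := E.index_lt he; have := h.le; omega)
    have h2 := hb _ h1.1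
    have h3 := hb _ h1.2
    unfold RamProgram.edgeLine
    split_ifs <;> exact RamProgram.colOf_le (by omega) (by omega)
  have hlift : ∀ (y : Fin n → ℤ) (port) (e : Sym2 (Fin n)) (u v : Fin n),
      -1 ≤ bendLift y port e u v ∧ bendLift y port e u v ≤ 1 := fun y port e u v => by
    rcases bendLift_cases y port e u v with h | h | h <;> omega
  refine ((E.drawing σ).area_le (B := 20 * n + 5) ?_).trans (by ring_nf; exact le_rfl)
  rintro p (⟨v, rfl⟩ | ⟨d, hd⟩)
  · have := hb v v.2
    simp only [drawing, columnDrawing]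
    omega
  · have h1 := hl d.edge d.edge_mem
    have h2 := hb d.fst d.fst.2
    have h3 := hb d.snd d.snd.2
    simp only [drawing, columnDrawing] at hd
    split_ifs at hd <;> simp only [List.mem_cons, List.not_mem_nil, or_false] at hd <;>
      rcases hd with rfl | rfl <;> simp only
    all_goals
      first
      | have h4 := hlift (fun v : Fin n => (σ.arr 3 v : ℤ))
          (fun e u => decide (RamProgram.edgePort n σ (E.index e) = u)) d.edge d.fst d.snd
        have h5 := hlift (fun v : Fin n => (σ.arr 3 v : ℤ))
          (fun e u => decide (RamProgram.edgePort n σ (E.index e) = u)) d.edge d.snd d.fst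
        omega
      | have h4 := hlift (fun v : Fin n => (σ.arr 2 v : ℤ))
          (fun e u => decide (RamProgram.edgePort n σ (E.index e) = u)) d.edge d.fst d.snd
        have h5 := hlift (fun v : Fin n => (σ.arr 2 v : ℤ))
          (fun e u => decide (RamProgram.edgePort n σ (E.index e) = u)) d.edge d.snd d.fst
        omega

end

/-- The constant comes from the step bound `10000 * n + 1000`, which is at most `11000 * n` as `n`
is positive; it is ample for the words and the area. -/
theorem exists_drawing [DecidableRel G.Adj] (hn : 0 < n) (hG : G.maxDegree ≤ 8) :
    ∃ (t : ℕ) (τ : RamState) (D : PolylineDrawing G),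
      RamExec (11000 * n) RamProgram.drawProgram E.initialState t τ ∧ t ≤ 11000 * n ∧
      E.Outputs τ D ∧ D.IsApRAC 2 ∧ D.area ≤ ((11000 : ℕ) : ℤ) * (n : ℤ) ^ 2 := by
  obtain ⟨t, τ, hx, ht, σ, hσ⟩ := RamProgram.ensures_draw (W := 11000 * n) (n := n) (m := m)
    (σ := E.initialState) (by simp [initialState]) (by simp [initialState]) (by omega)
    (fun i hi => by
      rw [E.initialState_fst ⟨i, hi⟩, E.initialState_snd ⟨i, hi⟩]
      exact ⟨Fin.isLt _, Fin.isLt _⟩)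
    (fun a ha => E.initialState_arr ha)
    (fun x hx => (E.count_halfVertex_le ⟨x, hx⟩).trans ((G.degree_le_maxDegree _).trans hG))
  refine ⟨t, τ, E.drawing σ, hx, by omega, E.outputs_drawing hσ, E.drawing_isApRAC hσ,
    (E.drawing_area_le hσ hn).trans ?_⟩
  have : (1 : ℤ) ≤ n := by exact_mod_cast hn
  push_cast
  nlinarith

end EdgeList

/-- The mere existence of a drawing follows by running the program on some list of the edges. -/
theorem SimpleGraph.exists_edgeList {V : Type*} [Fintype V] (G : SimpleGraph V)
    [DecidableRel G.Adj] : ∃ m, Nonempty (EdgeList G m) := by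
  have key : ∀ e : G.edgeSet, ∃ d : G.Dart, d.edge = e := by
    rintro ⟨e, he⟩
    induction e using Sym2.ind with | _ u v =>
    exact ⟨⟨(u, v), he⟩, rfl⟩
  choose f hf using key
  classical
  let q := Fintype.equivFin G.edgeSet
  refine ⟨_, ⟨⟨fun i => f (q.symm i), fun d => ⟨q ⟨d.edge, d.edge_mem⟩, ?_, fun i hi => ?_⟩⟩⟩⟩
  · simp [hf]
  · simp only [hf] at hi
    rw [← q.symm_apply_eq]
    exact Subtype.ext hi

theorem mainTheorem2 :
    ∃ (P : RamProgram) (c : ℕ),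
      ∀ (n : ℕ), 0 < n →
      ∀ (G : SimpleGraph (Fin n)) [DecidableRel G.Adj], G.maxDegree ≤ 8 →
        (∃ D : PolylineDrawing G, D.IsApRAC 2 ∧ D.area ≤ (c : ℤ) * (n : ℤ) ^ 2) ∧
        (∀ (m : ℕ) (E : EdgeList G m),
          ∃ (t : ℕ) (τ : RamState) (D : PolylineDrawing G),
            RamExec (c * n) P E.initialState t τ ∧ t ≤ c * n ∧
            E.Outputs τ D ∧ D.IsApRAC 2 ∧ D.area ≤ (c : ℤ) * (n : ℤ) ^ 2) := by
  refine ⟨RamProgram.drawProgram, 11000, fun n hn G _ hG =>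
    ⟨?_, fun m E => E.exists_drawing hn hG⟩⟩
  obtain ⟨m, ⟨E⟩⟩ := G.exists_edgeList
  obtain ⟨_, _, D, _, _, _, h1, h2⟩ := E.exists_drawing hn hG
  exact ⟨D, h1, h2⟩
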